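/- Let $\Omega\subset\mathbb R^2$ be a bounded connected open set whose boundary is the disjoint union of $C^2$ regular Jordan curves $C_0,C_1,\dots,C_d$ ($d\ge 0$), where $C_0$ is the outer boundary, $C_1,\dots,C_d$ are the inner ones, and every curve is oriented so that $\Omega$ is on its left. Write $\nabla^\perp f=(-\partial_2f,\partial_1f)$ and let $\Gamma_i(v)=\oint_{C_i}v\cdot d\ell$ be the circulation of $v$ around $C_i$. Let $\phi_j$ ($1\le j\le d$) be the harmonic function in $\Omega$, continuous on $\overline\Omega$, equal to $1$ on $C_j$ and to $0$ on the other boundary curves, and let $(p_{i,j})$ be the inverse of the matrix $(\Gamma_i(\nabla^\perp\phi_j))_{1\le i,j\le d}$. Let $G$ be the hydrodynamic Green function of $\Omega$, i.e. the function such that, for every $y\in\Omega$, $g(\cdot,y):=G(\cdot,y)-\frac1{2\pi}\log\|\cdot-y\|$ is harmonic in $\Omega$, and $G(\cdot,y)$ is $C^1$ up to $\partial\Omega$, vanishes on $C_0$, is constant on each $C_l$ and satisfies $\Gamma_l(\nabla^\perp G(\cdot,y))=0$ for $1\le l\le d$. Put $r(x):=g(x,x)$ and $K(x,y):=\nabla^\perp_xG(x,y)$.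 Let $\overline\Gamma\in\mathbb R^d$, let $x_1,\dots,x_N\in\Omega$ be distinct points and $\alpha_1,\dots,\alpha_N\in\mathbb R\setminus\{0\}$. Put $\psi_0:=\sum_{i,j}\overline\Gamma_i\,p_{i,j}\,\phi_j$ and $\mathbf X_0:=\nabla^\perp\psi_0$. Let $\Omega_N$ be the set of $N$-tuples of distinct points of $\Omega$ and, on $\Omega_N$, $$W(z):=\sum_l\alpha_l\psi_0(z_l)+\tfrac12\sum_l\alpha_l^2\,r(z_l)+\tfrac12\sum_{l\ne m}\alpha_l\alpha_m\,G(z_l,z_m).$$ For $T>0$, a vortex trajectory on $[0,T]$ is a differentiable $z:[0,T]\to\Omega_N$ with $z(0)=(x_1,\dots,x_N)$ that solves the Kirchhoff–Routh–Lin equations $z_i'=\frac1{\alpha_i}\nabla^\perp_{x_i}W(z)$, $1\le i\le N$ (so there is no collision on $[0,T]$). Then there is a vortex trajectory on $[0,T]$ for some $T>0$. Moreover, for every $T>0$, every vortex trajectory $z$ on $[0,T]$ is real-analytic on $[0,T]$, it is the only one on $[0,T]$, and $t\mapsto\omega(t):=\sum_l\alpha_l\delta_{z_l(t)}$ is a weak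 solution of the Euler equations on $[0,T)$ with circulations $\overline\Gamma$ and initial vorticity $\omega_0:=\sum_l\alpha_l\delta_{x_l}$, in the following sense: $\omega_0$ is in the space $\mathcal M(\Omega)$ of finite signed Radon measures on $\Omega$, $\omega\in L^\infty(0,T;\mathcal M(\Omega))$ (weak-* measurable in $t$, with bounded total variation), and for every $\varphi\in C_c^\infty([0,T)\times\Omega;\mathbb R)$ the following integrals exist and satisfy $$\int_\Omega\varphi(0,x)\,d\omega_0(x)+\int_0^T\!\!\int_\Omega L_\varphi(t,x)\,d\omega(t,x)\,dt+\int_0^T\!\!\int_\Omega\int_\Omega H_\varphi(t,x,y)\,d\omega(t,x)\,d\omega(t,y)\,dt=0,$$ where $L_\varphi(t,x):=\partial_t\varphi(t,x)+\mathbf X_0(x)\cdot\nabla_x\varphi(t,x)$, $H_\varphi(t,x,y):=\frac12\big(\nabla_x\varphi(t,x)\cdot K(x,y)+\nabla_x\varphi(t,y)\cdot K(y,x)\big)$ for $x\ne y$, and $H_\varphi(t,x,x):=\frac12\nabla_x\varphi(t,x)\cdot\nabla^\perp r(x)$. -/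

import Mathlib

open Set Filter Topology MeasureTheory

noncomputable section

namespace PointVortex

/-! The plane `ℝ²` is identified with `ℂ`; its real inner product is `inner ℝ`, its norm is the
Euclidean norm, and multiplication by `Complex.I` is the rotation by `+π/2`. -/

/-- `∇^⊥ f = (-∂₂ f, ∂₁ f)`, so that `curl ∇^⊥ f = Δ f`. -/
def perpGrad (f : ℂ → ℝ) (x : ℂ) : ℂ :=
  Complex.I * gradient f x

/-- A bounded, multiply connected domain `Ω` of class `C²`: its boundary is the disjoint union of
the `C²` Jordan curves `C_i = range (γ i)`, `0 ≤ i ≤ d`, where `C_0` is the outer boundary and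
`C_1, …, C_d` are the inner ones. Every curve has a regular `1`-periodic parametrization `γ i`,
which runs through it with `Ω` on its left. -/
structure IsC2Domain {d : ℕ} (Ω : Set ℂ) (γ : Fin (d + 1) → ℝ → ℂ) : Prop where
  isOpen : IsOpen Ω
  isConnected : IsConnected Ω
  isBounded : Bornology.IsBounded Ω
  contDiff : ∀ i, ContDiff ℝ 2 (γ i)
  periodic : ∀ i, Function.Periodic (γ i) 1
  injOn : ∀ i, InjOn (γ i) (Ico 0 1)
  regular : ∀ i s, deriv (γ i) s ≠ 0
  disjoint : ∀ i j, i ≠ j → Disjoint (range (γ i)) (range (γ j))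
  frontier_eq : frontier Ω = ⋃ i, range (γ i)
  left : ∀ i s, ∀ᶠ ε : ℝ in 𝓝[>] 0, γ i s + ε • (Complex.I * deriv (γ i) s) ∈ Ω
  /-- `Ω` lies in the bounded component of the complement of `C_0`. -/
  outer : ∀ x ∈ Ω, Bornology.IsBounded (connectedComponentIn (range (γ 0))ᶜ x)

/-- The circulation `∮ v · dl` along the boundary curve `c` of the vector field `v`, given in `Ω`;
the values of `v` on the curve are its limits from inside `Ω`. -/
def circulation (Ω : Set ℂ) (c : ℝ → ℂ) (v : ℂ → ℂ) : ℝ :=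
  ∫ s in (0 : ℝ)..1, inner ℝ (extendFrom Ω v (c s)) (deriv c s)

variable {d : ℕ}

/-- `u` is harmonic in `Ω`, continuous up to the boundary, equal to `1` on the inner boundary curve
`C_j` and to `0` on every other boundary curve (the inner curve number `j` is `γ j.succ`). -/
structure IsHarmonicMeasure (Ω : Set ℂ) (γ : Fin (d + 1) → ℝ → ℂ) (j : Fin d) (u : ℂ → ℝ) :
    Prop where
  harmonic : InnerProductSpace.HarmonicOnNhd u Ω
  continuousOn : ContinuousOn u (closure Ω)
  boundary : ∀ i, ∀ x ∈ range (γ i), u x = if i = j.succ then 1 else 0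

open Classical in
/-- The function `φ_j`: the unique solution of the preceding Dirichlet problem. -/
def harmonicMeasure (Ω : Set ℂ) (γ : Fin (d + 1) → ℝ → ℂ) (j : Fin d) : ℂ → ℝ :=
  if h : ∃ u, IsHarmonicMeasure Ω γ j u then h.choose else 0

/-- The matrix `m_{i,j} = Γ_i (∇^⊥ φ_j)` of the circulations; its inverse has the entries
`p_{i,j}`. -/
def circulationMatrix (Ω : Set ℂ) (γ : Fin (d + 1) → ℝ → ℂ) : Matrix (Fin d) (Fin d) ℝ :=
  Matrix.of fun i j => circulation Ω (γ i.succ) (perpGrad (harmonicMeasure Ω γ j))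

/-- The stream function `ψ_0 = ∑_{i,j} Γ_i p_{i,j} φ_j` of the harmonic flow that has the
circulations `Γ_i` around the inner boundary curves. -/
def psi0 (Ω : Set ℂ) (γ : Fin (d + 1) → ℝ → ℂ) (Γ : Fin d → ℝ) (x : ℂ) : ℝ :=
  ∑ i, ∑ j, Γ i * (circulationMatrix Ω γ)⁻¹ i j * harmonicMeasure Ω γ j x

/-- The vector field `X_0 = ∇^⊥ ψ_0`. -/
def X0 (Ω : Set ℂ) (γ : Fin (d + 1) → ℝ → ℂ) (Γ : Fin d → ℝ) (x : ℂ) : ℂ :=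
  perpGrad (psi0 Ω γ Γ) x

/-- `g (x, y) = G (x, y) - (1 / 2π) log ‖x - y‖`. Since `Real.log 0 = 0`, the value `G y y` stands
for the value at `x = y` of the regular part `g (·, y)`. -/
def regularPart (G : ℂ → ℂ → ℝ) (x y : ℂ) : ℝ :=
  G x y - 1 / (2 * Real.pi) * Real.log ‖x - y‖

/-- The defining properties of the hydrodynamic Green function `G` of `Ω`. The functions `G (·, y)`
are of class `C¹` up to the boundary, so that their circulations make sense. -/
structure IsHydrodynamicGreen (Ω : Set ℂ) (γ : Fin (d + 1) → ℝ → ℂ) (G : ℂ → ℂ → ℝ) : Prop where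
  /-- The regular part is harmonic in all of `Ω`, the point `x = y` included. -/
  harmonic : ∀ y ∈ Ω, InnerProductSpace.HarmonicOnNhd (fun x => regularPart G x y) Ω
  continuousOn : ∀ y ∈ Ω, ContinuousOn (fun x => G x y) (closure Ω \ {y})
  gradient_limit : ∀ y ∈ Ω, ∀ p ∈ frontier Ω,
    ∃ v, Tendsto (gradient fun x => G x y) (𝓝[Ω] p) (𝓝 v)
  const_inner : ∀ y ∈ Ω, ∀ l : Fin d, ∃ c, ∀ x ∈ range (γ l.succ), G x y = c
  zero_outer : ∀ y ∈ Ω, ∀ x ∈ range (γ 0), G x y = 0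
  circulation_inner : ∀ y ∈ Ω, ∀ l : Fin d,
    circulation Ω (γ l.succ) (perpGrad fun x => G x y) = 0

open Classical in
/-- The hydrodynamic Green function of `Ω`: the function with the preceding properties, which is
unique on `closure Ω × Ω`. -/
def green (Ω : Set ℂ) (γ : Fin (d + 1) → ℝ → ℂ) : ℂ → ℂ → ℝ :=
  if h : ∃ G, IsHydrodynamicGreen Ω γ G then h.choose else 0

/-- The hydrodynamic Robin function `r (x) = g (x, x)`. -/
def robin (Ω : Set ℂ) (γ : Fin (d + 1) → ℝ → ℂ) (x : ℂ) : ℝ :=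
  regularPart (green Ω γ) x x

/-- The kernel `K (x, y) = ∇_x^⊥ G (x, y)`. -/
def kernelK (Ω : Set ℂ) (γ : Fin (d + 1) → ℝ → ℂ) (x y : ℂ) : ℂ :=
  perpGrad (fun x' => green Ω γ x' y) x

variable {N : ℕ}

/-- The configuration space `Ω_N` of `N` distinct points of `Ω`. -/
def configSpace (Ω : Set ℂ) (N : ℕ) : Set (Fin N → ℂ) :=
  {z | (∀ l, z l ∈ Ω) ∧ Function.Injective z}

/-- The Kirchhoff–Routh–Lin function `W`. -/
def krlW (Ω : Set ℂ) (γ : Fin (d + 1) → ℝ → ℂ) (Γ : Fin d → ℝ) (α : Fin N → ℝ)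
    (z : Fin N → ℂ) : ℝ :=
  ∑ l, α l * psi0 Ω γ Γ (z l)
    + 1 / 2 * ∑ l, α l ^ 2 * robin Ω γ (z l)
    + 1 / 2 * ∑ l, ∑ m ∈ Finset.univ.erase l, α l * α m * green Ω γ (z l) (z m)

/-- The vector field `F`, with `F_i (z) = (1 / α_i) ∇^⊥_{x_i} W (z)`. -/
def krlField (Ω : Set ℂ) (γ : Fin (d + 1) → ℝ → ℂ) (Γ : Fin d → ℝ) (α : Fin N → ℝ)
    (z : Fin N → ℂ) (i : Fin N) : ℂ :=
  (1 / α i) • perpGrad (fun p => krlW Ω γ Γ α (Function.update z i p)) (z i)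

/-- `z` is, on `[0, T]`, a solution without collision of the Kirchhoff–Routh–Lin equations
`z' = F (z)`, `z (0) = x`. -/
structure IsVortexTrajectory (Ω : Set ℂ) (γ : Fin (d + 1) → ℝ → ℂ) (Γ : Fin d → ℝ)
    (α : Fin N → ℝ) (x : Fin N → ℂ) (T : ℝ) (z : ℝ → Fin N → ℂ) : Prop where
  initial : z 0 = x
  mem : ∀ t ∈ Icc 0 T, z t ∈ configSpace Ω N
  ode : ∀ t ∈ Icc 0 T, HasDerivWithinAt z (krlField Ω γ Γ α (z t)) (Icc 0 T) t

/-- The test functions `C_c^∞ ([0, T) × Ω)`: they are the restrictions to times `t ≥ 0` of the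
smooth functions with compact support in `(-∞, T) × Ω`. -/
structure IsTestFunction (Ω : Set ℂ) (T : ℝ) (φ : ℝ × ℂ → ℝ) : Prop where
  smooth : ContDiff ℝ (⊤ : ℕ∞) φ
  compact : HasCompactSupport φ
  support : tsupport φ ⊆ Iio T ×ˢ Ω

/-- The spatial gradient `∇_x φ (t, x)`. -/
def gradX (φ : ℝ × ℂ → ℝ) (t : ℝ) (x : ℂ) : ℂ :=
  gradient (fun x' => φ (t, x')) x

/-- `L_φ (t, x) = ∂_t φ (t, x) + X_0 (x) · ∇_x φ (t, x)`. -/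
def testL (Ω : Set ℂ) (γ : Fin (d + 1) → ℝ → ℂ) (Γ : Fin d → ℝ) (φ : ℝ × ℂ → ℝ)
    (t : ℝ) (x : ℂ) : ℝ :=
  deriv (fun s => φ (s, x)) t + inner ℝ (X0 Ω γ Γ x) (gradX φ t x)

open Classical in
/-- The auxiliary function `H_φ (t, x, y)`. -/
def testH (Ω : Set ℂ) (γ : Fin (d + 1) → ℝ → ℂ) (φ : ℝ × ℂ → ℝ) (t : ℝ) (x y : ℂ) : ℝ :=
  if x = y then
    1 / 2 * inner ℝ (gradX φ t x) (perpGrad (robin Ω γ) x)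
  else
    1 / 2 * (inner ℝ (gradX φ t x) (kernelK Ω γ x y) + inner ℝ (gradX φ t y) (kernelK Ω γ y x))

/-- The integral `∫ f dμ` of a real function against a finite signed measure. -/
def signedIntegral (μ : SignedMeasure ℂ) (f : ℂ → ℝ) : ℝ :=
  μ.integral f (ContinuousLinearMap.lsmul ℝ ℝ)

/-- `ω` is a (measure-valued) weak solution of the Euler equations on `[0, T)` in `Ω`, with
initial vorticity `ω₀` and circulations `Γ`. An element of the space `𝓜 (Ω)` of (finite, signed)
Radon measures on `Ω` is a finite signed Borel measure on the plane which is carried by `Ω`. The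
first four conditions express `ω₀ ∈ 𝓜 (Ω)` and `ω ∈ L^∞ (0, T; 𝓜 (Ω))`, where `𝓜 (Ω)` is the dual
of `C₀ (Ω)` (weak-* measurability in time, essentially bounded total variation); the next three
say that the integrals of the weak formulation exist. -/
structure IsWeakSolution (Ω : Set ℂ) (γ : Fin (d + 1) → ℝ → ℂ) (Γ : Fin d → ℝ) (T : ℝ)
    (ω₀ : SignedMeasure ℂ) (ω : ℝ → SignedMeasure ℂ) : Prop where
  carried_initial : ω₀.totalVariation Ωᶜ = 0
  carried : ∀ t ∈ Icc 0 T, (ω t).totalVariation Ωᶜ = 0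
  measurable : ∀ f : ℂ → ℝ, Continuous f → HasCompactSupport f → tsupport f ⊆ Ω →
    AEMeasurable (fun t => signedIntegral (ω t) f) (volume.restrict (Icc 0 T))
  bounded : ∃ C : ℝ, ∀ᵐ t ∂(volume.restrict (Icc 0 T)),
    (ω t).totalVariation univ ≤ ENNReal.ofReal C
  integrable_space : ∀ φ, IsTestFunction Ω T φ → ∀ᵐ t ∂(volume.restrict (Icc 0 T)),
    Integrable (testL Ω γ Γ φ t) (ω t).totalVariation ∧
    Integrable (fun p : ℂ × ℂ => testH Ω γ φ t p.1 p.2)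
      ((ω t).totalVariation.prod (ω t).totalVariation)
  integrable_L : ∀ φ, IsTestFunction Ω T φ →
    IntegrableOn (fun t => signedIntegral (ω t) (testL Ω γ Γ φ t)) (Icc 0 T)
  integrable_H : ∀ φ, IsTestFunction Ω T φ →
    IntegrableOn (fun t => signedIntegral (ω t) fun y =>
      signedIntegral (ω t) fun x => testH Ω γ φ t x y) (Icc 0 T)
  weak_form : ∀ φ, IsTestFunction Ω T φ →
    signedIntegral ω₀ (fun x => φ (0, x))
      + (∫ t in Icc 0 T, signedIntegral (ω t) (testL Ω γ Γ φ t))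
      + (∫ t in Icc 0 T, signedIntegral (ω t) fun y =>
          signedIntegral (ω t) fun x => testH Ω γ φ t x y) = 0

/-- The vorticity `∑_l α_l δ_{z_l}` of point vortices. -/
def vortexMeasure (α : Fin N → ℝ) (z : Fin N → ℂ) : SignedMeasure ℂ :=
  ∑ l, α l • VectorMeasure.dirac (z l) (1 : ℝ)

end PointVortex

end

noncomputable section

namespace PointVortex

open InnerProductSpace Laplacian

/-! ### Vector calculus in the plane -/

/-! Everything rests on one fact: the Kirchhoff–Routh–Lin field is real-analytic on the
configuration space (`analyticAt_krlField`). Picard–Lindelöf then gives a short trajectory. Near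
each time, all solutions of an analytic equation through a given point are one and the same analytic
function (`exists_analyticAt_eventually_eq_of_ode`, an analytic inverse function theorem on a space
of paths); this yields analyticity and uniqueness. The weak formulation is the chain rule for ∑ α_l
φ(t, z_l(t)), integrated over [0, T]: against Dirac masses, the double integral of H_φ is the
symmetrized sum of the pair interactions (`inner_krlField`, `sum_sum_testH`).

The work lies in the joint analyticity of the regular part g(x, y), which is only given to be
harmonic in x for each fixed y. Three properties of G are established for this. (1) Symmetry
(`IsHydrodynamicGreen.symm`): G(b, a) is minus the Dirichlet integral of two Green functions with
smoothed poles. Hence g is harmonic in each variable separately. (2) Sign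
(`IsHydrodynamicGreen.nonpos`): G ≤ 0, by testing Green's identity with a smooth function of G that
vanishes for G ≤ 0. Harnack's inequality in each variable then bounds G locally off the diagonal,
with no joint continuity known beforehand. (3) A separately harmonic function that is bounded on the
torus of a bidisc is a double Poisson integral, hence analytic at the centre
(`analyticAt_of_separately_harmonic`). The torus can be kept away from the diagonal even when the
centre lies on it, so the Robin function is covered too.

Properties (1) and (2) need Green's identity up to the boundary, where the gradient of G merely has
limits. For a function that vanishes on the boundary, truncating its small values makes the support
compact (`integral_mul_laplacian_eq`). A function that is constant on each inner curve is reduced to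
this case by subtracting multiples of cutoffs χ. In tubular coordinates the integral of ∇χ · ∇V
becomes the flux of ∇V through the curve, which is the circulation of ∇^⊥ V and vanishes. The pole
is replaced by the potential of a smooth radial unit mass.

Neither existence nor uniqueness of G and of the φ_j is used: the default value 0 in their
definitions is symmetric and analytic as well. -/

/-- The scalar product `∇U · ∇V`, computed in the basis `1, I` of the plane. -/
def gradDot (U V : ℂ → ℝ) (x : ℂ) : ℝ :=
  fderiv ℝ U x 1 * fderiv ℝ V x 1 + fderiv ℝ U x Complex.I * fderiv ℝ V x Complex.I

lemma gradDot_comm (U V : ℂ → ℝ) (x : ℂ) : gradDot U V x = gradDot V U x := by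
  simp only [gradDot]; ring

lemma laplacian_eq_fderiv_fderiv {V : ℂ → ℝ} {x : ℂ} (hV : ContDiffAt ℝ 2 V x) :
    Δ V x = fderiv ℝ (fun y => fderiv ℝ V y 1) x 1
      + fderiv ℝ (fun y => fderiv ℝ V y Complex.I) x Complex.I := by
  have hd : DifferentiableAt ℝ (fderiv ℝ V) x :=
    (hV.fderiv_right (m := 1) (by norm_num)).differentiableAt one_ne_zero
  have key : ∀ v : ℂ, fderiv ℝ (fun y => fderiv ℝ V y v) x v = fderiv ℝ (fderiv ℝ V) x v v := by
    intro v
    rw [fderiv_clm_apply hd (differentiableAt_const v)]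
    simp
  rw [laplacian_eq_iteratedFDeriv_complexPlane, key, key]
  simp [iteratedFDeriv_two_apply]

lemma _root_.ContDiffOn.continuousOn_fderiv_apply {V : ℂ → ℝ} {Ω : Set ℂ} (hΩ : IsOpen Ω)
    (hV : ContDiffOn ℝ 1 V Ω) (v : ℂ) : ContinuousOn (fun x => fderiv ℝ V x v) Ω :=
  (hV.continuousOn_fderiv_of_isOpen hΩ le_rfl).clm_apply continuousOn_const

lemma _root_.ContDiffOn.continuousOn_gradDot {U V : ℂ → ℝ} {Ω : Set ℂ} (hΩ : IsOpen Ω)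
    (hU : ContDiffOn ℝ 1 U Ω) (hV : ContDiffOn ℝ 1 V Ω) : ContinuousOn (gradDot U V) Ω :=
  ((hU.continuousOn_fderiv_apply hΩ _).mul (hV.continuousOn_fderiv_apply hΩ _)).add
    ((hU.continuousOn_fderiv_apply hΩ _).mul (hV.continuousOn_fderiv_apply hΩ _))

lemma _root_.ContDiffOn.contDiffOn_fderiv_apply {V : ℂ → ℝ} {Ω : Set ℂ} (hΩ : IsOpen Ω)
    (hV : ContDiffOn ℝ 2 V Ω) (v : ℂ) : ContDiffOn ℝ 1 (fun x => fderiv ℝ V x v) Ω :=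
  (hV.fderiv_of_isOpen hΩ (by norm_num)).clm_apply contDiffOn_const

lemma _root_.ContDiffOn.continuousOn_laplacian {V : ℂ → ℝ} {Ω : Set ℂ} (hΩ : IsOpen Ω)
    (hV : ContDiffOn ℝ 2 V Ω) : ContinuousOn (Δ V) Ω := by
  have h := ((hV.contDiffOn_fderiv_apply hΩ 1).continuousOn_fderiv_apply hΩ 1).add
    ((hV.contDiffOn_fderiv_apply hΩ Complex.I).continuousOn_fderiv_apply hΩ Complex.I)
  exact h.congr fun x hx => laplacian_eq_fderiv_fderiv (hV.contDiffAt (hΩ.mem_nhds hx))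

lemma continuous_mul_of_tsupport_subset {ξ g : ℂ → ℝ} {Ω : Set ℂ} (hΩ : IsOpen Ω)
    (hξ : Continuous ξ) (hs : tsupport ξ ⊆ Ω) (hg : ContinuousOn g Ω) :
    Continuous fun x => ξ x * g x := by
  apply continuous_of_tsupport
  intro x hx
  have hx' : x ∈ Ω := hs (closure_mono (fun y hy => left_ne_zero_of_mul hy) hx)
  exact hξ.continuousAt.mul (hg.continuousAt (hΩ.mem_nhds hx'))

lemma integrable_mul_of_tsupport_subset {ξ g : ℂ → ℝ} {Ω : Set ℂ} (hΩ : IsOpen Ω)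
    (hξ : Continuous ξ) (hc : HasCompactSupport ξ) (hs : tsupport ξ ⊆ Ω)
    (hg : ContinuousOn g Ω) : Integrable fun x => ξ x * g x :=
  (continuous_mul_of_tsupport_subset hΩ hξ hs hg).integrable_of_hasCompactSupport
    (hc.mul_right (f' := g))

/-- Integration by parts in the directions 1 and I. The function V is only known on Ω, but ξ
vanishes near the complement of Ω, so all products extend by zero to the plane. -/
lemma integral_gradDot_of_hasCompactSupport {ξ V : ℂ → ℝ} {Ω : Set ℂ} (hΩ : IsOpen Ω)
    (hξ : ContDiff ℝ 1 ξ) (hc : HasCompactSupport ξ) (hs : tsupport ξ ⊆ Ω)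
    (hV : ContDiffOn ℝ 2 V Ω) :
    ∫ x, gradDot ξ V x = - ∫ x, ξ x * Δ V x := by
  have hV1 : ContDiffOn ℝ 1 V Ω := hV.of_le (by norm_num)
  have hdξ : ∀ v : ℂ, Continuous fun x => fderiv ℝ ξ x v := fun v =>
    (hξ.continuous_fderiv one_ne_zero).clm_apply continuous_const
  have hcξ : ∀ v : ℂ, HasCompactSupport fun x => fderiv ℝ ξ x v := fun v =>
    hc.fderiv_apply (𝕜 := ℝ) v
  have hsξ : ∀ v : ℂ, tsupport (fun x => fderiv ℝ ξ x v) ⊆ Ω := fun v =>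
    (tsupport_fderiv_apply_subset ℝ v).trans hs
  have hi1 : ∀ v : ℂ, Integrable fun x => fderiv ℝ ξ x v * fderiv ℝ V x v := fun v =>
    integrable_mul_of_tsupport_subset hΩ (hdξ v) (hcξ v) (hsξ v)
      (hV1.continuousOn_fderiv_apply hΩ v)
  have hi2 : ∀ v : ℂ, Integrable fun x => ξ x * fderiv ℝ (fun y => fderiv ℝ V y v) x v :=
    fun v => integrable_mul_of_tsupport_subset hΩ hξ.continuous hc hs
      ((hV.contDiffOn_fderiv_apply hΩ v).continuousOn_fderiv_apply hΩ v)
  have hi3 : ∀ v : ℂ, Integrable fun x => ξ x * fderiv ℝ V x v := fun v =>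
    integrable_mul_of_tsupport_subset hΩ hξ.continuous hc hs (hV1.continuousOn_fderiv_apply hΩ v)
  have key : ∀ v : ℂ, ∫ x, ξ x * fderiv ℝ (fun y => fderiv ℝ V y v) x v
      = - ∫ x, fderiv ℝ ξ x v * fderiv ℝ V x v := fun v =>
    integral_mul_fderiv_eq_neg_fderiv_mul_of_integrable (hi1 v) (hi2 v) (hi3 v)
      (fun x _ => hξ.differentiable one_ne_zero x)
      (fun x hx => ((hV.contDiffOn_fderiv_apply hΩ v).contDiffAt
        (hΩ.mem_nhds (hs hx))).differentiableAt one_ne_zero)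
  have hL : ∀ x, ξ x * Δ V x = ξ x * fderiv ℝ (fun y => fderiv ℝ V y 1) x 1
      + ξ x * fderiv ℝ (fun y => fderiv ℝ V y Complex.I) x Complex.I := by
    intro x
    by_cases hx : x ∈ Ω
    · rw [laplacian_eq_fderiv_fderiv (hV.contDiffAt (hΩ.mem_nhds hx)), mul_add]
    · have : ξ x = 0 := image_eq_zero_of_notMem_tsupport fun h => hx (hs h)
      simp [this]
  simp_rw [hL, gradDot]
  rw [integral_add (hi1 _) (hi1 _), integral_add (hi2 _) (hi2 _), key, key]
  ring

/-! ### Green's first identity up to an arbitrary boundary, by truncation -/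

lemma measurableSet_inter_preimage_zero {U : ℂ → ℝ} {Ω : Set ℂ} (hΩ : IsOpen Ω)
    (hU : ContinuousOn U Ω) : MeasurableSet {x ∈ Ω | U x = 0} := by
  have h := hU.isOpen_inter_preimage hΩ (isOpen_compl_singleton (x := (0 : ℝ)))
  have : {x ∈ Ω | U x = 0} = Ω \ (Ω ∩ U ⁻¹' {0}ᶜ) := by
    ext x; simp only [mem_ofPred_eq, Set.mem_sdiff, mem_inter_iff, mem_preimage, mem_compl_iff,
      mem_singleton_iff]; tauto
  rw [this]
  exact hΩ.measurableSet.diff h.measurableSet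

/-- The gradient of a `C¹` function vanishes almost everywhere on its zero set. -/
lemma ae_fderiv_eq_zero_of_eq_zero {U : ℂ → ℝ} {Ω : Set ℂ} (hΩ : IsOpen Ω)
    (hU : ContDiffOn ℝ 1 U Ω) (v : ℂ) :
    ∀ᵐ x : ℂ, x ∈ Ω → U x = 0 → fderiv ℝ U x v = 0 := by
  have hcd := hU.continuousOn_fderiv_apply hΩ v
  have hs : MeasurableSet {x : ℂ | x ∈ Ω → U x = 0 → fderiv ℝ U x v = 0} := by
    have h1 := measurableSet_inter_preimage_zero hΩ hU.continuousOn
    have h2 := measurableSet_inter_preimage_zero hΩ hcd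
    have : {x : ℂ | x ∈ Ω → U x = 0 → fderiv ℝ U x v = 0}
        = {x ∈ Ω | U x = 0}ᶜ ∪ {x ∈ Ω | fderiv ℝ U x v = 0} := by
      ext x; simp only [mem_ofPred_eq, mem_union, mem_compl_iff]; tauto
    rw [this]; exact h1.compl.union h2
  -- By Fubini it suffices to look at every line in the direction v and to show that the exceptional
  -- parameters on it form a null set.
  refine ae_mem_of_ae_add_linearMap_mem
    ((ContinuousLinearMap.toSpanSingleton ℝ v : ℝ →L[ℝ] ℂ) : ℝ →ₗ[ℝ] ℂ) volume volume hs ?_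
  intro y
  set E : Set ℝ := {t | y + t • v ∈ Ω ∧ U (y + t • v) = 0 ∧ fderiv ℝ U (y + t • v) v ≠ 0}
  have hE : E.Countable := by
    -- A zero at which the derivative along the line is nonzero has no further zeros just to its
    -- right, and a subset of ℝ has only countably many points that are isolated from the right.
    refine (countable_setOfPred_isolated_right_within (s := E)).mono ?_
    rintro t ⟨h1, h2, h3⟩
    have hl : HasDerivAt (fun s : ℝ => y + s • v) v t := by
      simpa using ((hasDerivAt_id t).smul_const v).const_add y
    have hd : HasDerivAt (fun s : ℝ => U (y + s • v)) (fderiv ℝ U (y + t • v) v) t :=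
      (((hU.contDiffAt (hΩ.mem_nhds h1)).differentiableAt one_ne_zero).hasFDerivAt).comp_hasDerivAt
        t hl
    have hne := hd.eventually_ne (c := 0) h3
    have hgt : ∀ᶠ s in 𝓝[>] t, U (y + s • v) ≠ 0 :=
      hne.filter_mono (nhdsWithin_mono _ fun s (hs : t < s) => ne_of_gt hs)
    refine ⟨⟨h1, h2, h3⟩, ?_⟩
    rw [← empty_mem_iff_bot, inter_comm, nhdsWithin_inter']
    filter_upwards [mem_inf_of_left hgt, mem_inf_of_right (mem_principal_self E)] with s hs hs'
    exact hs hs'.2.1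
  filter_upwards [hE.ae_notMem volume] with t ht
  intro h1 h2
  by_contra h3
  exact ht ⟨by simpa using h1, by simpa using h2, by simpa using h3⟩

/-- A smooth function that vanishes near `0` and is the identity away from `0`. -/
def deadZone (s : ℝ) : ℝ := s * Real.smoothTransition (s ^ 2 - 1)

lemma contDiff_deadZone : ContDiff ℝ 1 deadZone :=
  contDiff_id.mul (Real.smoothTransition.contDiff.comp ((contDiff_id.pow 2).sub contDiff_const))

lemma deadZone_of_sq_le {s : ℝ} (hs : s ^ 2 ≤ 1) : deadZone s = 0 := by
  simp [deadZone, Real.smoothTransition.zero_of_nonpos (sub_nonpos.2 hs)]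

lemma deadZone_of_le_sq {s : ℝ} (hs : 2 ≤ s ^ 2) : deadZone s = s := by
  simp [deadZone, Real.smoothTransition.one_of_one_le (by linarith : (1 : ℝ) ≤ s ^ 2 - 1)]

lemma abs_deadZone_le (s : ℝ) : |deadZone s| ≤ |s| := by
  rw [deadZone, abs_mul, abs_of_nonneg (Real.smoothTransition.nonneg _)]
  exact mul_le_of_le_one_right (abs_nonneg _) (Real.smoothTransition.le_one _)

lemma deriv_deadZone_of_lt_sq {s : ℝ} (hs : 2 < s ^ 2) : deriv deadZone s = 1 := by
  have : deadZone =ᶠ[𝓝 s] id := by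
    have ho : IsOpen {t : ℝ | 2 < t ^ 2} := isOpen_lt continuous_const (continuous_pow 2)
    filter_upwards [ho.mem_nhds hs] with t (ht : 2 < t ^ 2)
    exact deadZone_of_le_sq ht.le
  rw [this.deriv_eq, deriv_id]

lemma exists_bound_deriv_deadZone : ∃ C, ∀ s, |deriv deadZone s| ≤ C := by
  have hc : Continuous (deriv deadZone) := contDiff_deadZone.continuous_deriv le_rfl
  obtain ⟨C, hC⟩ := (isCompact_Icc (a := (-2 : ℝ)) (b := 2)).exists_bound_of_continuousOn
    hc.continuousOn
  refine ⟨max C 1, fun s => ?_⟩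
  by_cases hs : s ∈ Icc (-2 : ℝ) 2
  · exact (hC s hs).trans (le_max_left _ _)
  · have : 2 < s ^ 2 := by
      rw [mem_Icc, not_and_or, not_le, not_le] at hs
      rcases hs with hs | hs <;> nlinarith
    rw [deriv_deadZone_of_lt_sq this]; simp

lemma eventually_two_lt_sq {s : ℝ} (hs : s ≠ 0) :
    ∀ᶠ n : ℕ in atTop, 2 < (((n : ℝ) + 1) * s) ^ 2 := by
  have h1 : Tendsto (fun n : ℕ => (((n : ℝ) + 1) * s) ^ 2) atTop atTop := by
    have h0 : Tendsto (fun n : ℕ => ((n : ℝ) + 1) ^ 2) atTop atTop :=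
      (tendsto_pow_atTop two_ne_zero).comp
        (tendsto_atTop_add_const_right _ _ tendsto_natCast_atTop_atTop)
    simp_rw [mul_pow]
    exact h0.atTop_mul_const (by positivity)
  exact h1.eventually_gt_atTop 2

lemma abs_gradDot_le {U V : ℂ → ℝ} {x : ℂ} {A B : ℝ} (hA : ‖fderiv ℝ U x‖ ≤ A)
    (hB : ‖fderiv ℝ V x‖ ≤ B) : |gradDot U V x| ≤ 2 * (A * B) := by
  have h : ∀ v : ℂ, ‖v‖ = 1 → |fderiv ℝ U x v * fderiv ℝ V x v| ≤ A * B := by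
    intro v hv
    rw [abs_mul]
    have h1 := (fderiv ℝ U x).le_opNorm v
    have h2 := (fderiv ℝ V x).le_opNorm v
    rw [hv, mul_one, Real.norm_eq_abs] at h1 h2
    exact mul_le_mul (h1.trans hA) (h2.trans hB) (abs_nonneg _) ((norm_nonneg _).trans hA)
  calc |gradDot U V x| ≤ _ := abs_add_le _ _
    _ ≤ A * B + A * B := add_le_add (h 1 (by simp)) (h Complex.I (by simp))
    _ = _ := by ring

/-- Green's first identity for a function `U` that vanishes on the boundary, without any
assumption on the boundary. -/
lemma integral_mul_laplacian_eq {Ω : Set ℂ} (hΩ : IsOpen Ω) (hb : Bornology.IsBounded Ω)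
    {U V : ℂ → ℝ} (hU : ContDiffOn ℝ 1 U Ω) (hUc : ContinuousOn U (closure Ω))
    (hU0 : ∀ x ∈ frontier Ω, U x = 0) (hV : ContDiffOn ℝ 2 V Ω)
    {A B C : ℝ} (hA : ∀ x ∈ Ω, ‖fderiv ℝ U x‖ ≤ A) (hB : ∀ x ∈ Ω, ‖fderiv ℝ V x‖ ≤ B)
    (hC : ∀ x ∈ Ω, |Δ V x| ≤ C) :
    ∫ x in Ω, U x * Δ V x = - ∫ x in Ω, gradDot U V x := by
  classical
  have hcpt : IsCompact (closure Ω) := hb.isCompact_closure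
  obtain ⟨M, hM⟩ := hcpt.exists_bound_of_continuousOn hUc
  obtain ⟨D, hD⟩ := exists_bound_deriv_deadZone
  have hD0 : 0 ≤ D := (abs_nonneg _).trans (hD 0)
  have : IsFiniteMeasure (volume.restrict Ω) := ⟨by
    simpa using (measure_mono subset_closure).trans_lt hcpt.measure_lt_top⟩
  let q : ℕ → ℝ := fun n => (n : ℝ) + 1
  have hq : ∀ n, 0 < q n := fun n => by positivity
  -- The truncation `H n` vanishes for |s| ≤ 1 / q n and is the identity for |s| ≥ √2 / q n. As U is
  -- continuous and vanishes on the frontier, `H n ∘ U` has compact support in Ω, and it tends to U.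
  let H : ℕ → ℝ → ℝ := fun n s => (q n)⁻¹ * deadZone (q n * s)
  have hHd : ∀ n, ContDiff ℝ 1 (H n) := fun n =>
    contDiff_const.mul (contDiff_deadZone.comp (contDiff_const.mul contDiff_id))
  have hHder : ∀ n s, HasDerivAt (H n) (deriv deadZone (q n * s)) s := by
    intro n s
    have h1 := (contDiff_deadZone.differentiable one_ne_zero (q n * s)).hasDerivAt
    have h2 : HasDerivAt (fun s => q n * s) (q n) s := by
      simpa using (hasDerivAt_id s).const_mul (q n)
    refine ((h1.comp s h2).const_mul (q n)⁻¹).congr_deriv ?_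
    have := (hq n).ne'
    field_simp
  have hHle : ∀ n s, |H n s| ≤ |s| := by
    intro n s
    have := abs_deadZone_le (q n * s)
    simp only [H, abs_mul, abs_inv] at this ⊢
    rwa [inv_mul_le_iff₀ (abs_pos.2 (hq n).ne')]
  let ξ : ℕ → ℂ → ℝ := fun n => Ω.indicator fun x => H n (U x)
  have hξΩ : ∀ n, ∀ x ∈ Ω, ξ n =ᶠ[𝓝 x] fun x => H n (U x) := fun n x hx => by
    filter_upwards [hΩ.mem_nhds hx] with y hy using indicator_of_mem hy _
  have hK : ∀ n, IsCompact {x ∈ closure Ω | (q n)⁻¹ ≤ |U x|} := fun n =>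
    hcpt.of_isClosed_subset
      (hUc.abs.preimage_isClosed_of_isClosed isClosed_closure isClosed_Ici) fun x hx => hx.1
  have hKΩ : ∀ n, {x ∈ closure Ω | (q n)⁻¹ ≤ |U x|} ⊆ Ω := by
    rintro n x ⟨hx, hx'⟩
    by_contra hxΩ
    rw [hU0 x (by rw [hΩ.frontier_eq]; exact ⟨hx, hxΩ⟩), abs_zero] at hx'
    exact absurd hx' (not_le.2 (inv_pos.2 (hq n)))
  have hts : ∀ n, tsupport (ξ n) ⊆ {x ∈ closure Ω | (q n)⁻¹ ≤ |U x|} := by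
    intro n
    refine closure_minimal (fun x hx => ?_) (hK n).isClosed
    have hxΩ : x ∈ Ω := by
      by_contra h; exact hx (indicator_of_notMem h _)
    refine ⟨subset_closure hxΩ, ?_⟩
    by_contra h
    apply hx
    rw [(hξΩ n x hxΩ).eq_of_nhds]
    have : deadZone (q n * U x) = 0 := by
      apply deadZone_of_sq_le
      rw [sq_le_one_iff_abs_le_one, abs_mul, abs_of_pos (hq n)]
      have h' : |U x| < (q n)⁻¹ := not_le.1 h
      have := mul_le_mul_of_nonneg_left h'.le (hq n).le
      rwa [mul_inv_cancel₀ (hq n).ne'] at this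
    simp [H, this]
  have hξc : ∀ n, HasCompactSupport (ξ n) := fun n =>
    (hK n).of_isClosed_subset (isClosed_tsupport _) (hts n)
  have hξs : ∀ n, tsupport (ξ n) ⊆ Ω := fun n => (hts n).trans (hKΩ n)
  have hξd : ∀ n, ContDiff ℝ 1 (ξ n) := by
    intro n
    refine contDiff_iff_contDiffAt.2 fun x => ?_
    by_cases hx : x ∈ tsupport (ξ n)
    swap
    · exact contDiffAt_const.congr_of_eventuallyEq (notMem_tsupport_iff_eventuallyEq.1 hx)
    have hx' := hξs n hx
    exact ((hHd n).contDiffAt.comp x (hU.contDiffAt (hΩ.mem_nhds hx'))).congr_of_eventuallyEq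
      (hξΩ n x hx')
  have hgrad : ∀ n, ∀ x ∈ Ω, gradDot (ξ n) V x
      = deriv deadZone (q n * U x) * gradDot U V x := by
    intro n x hx
    have hUx := (hU.contDiffAt (hΩ.mem_nhds hx)).differentiableAt one_ne_zero
    have : fderiv ℝ (ξ n) x = deriv deadZone (q n * U x) • fderiv ℝ U x := by
      rw [(hξΩ n x hx).fderiv_eq]
      exact ((hHder n (U x)).comp_hasFDerivAt x hUx.hasFDerivAt).fderiv
    simp only [gradDot, this, _root_.smul_apply, smul_eq_mul]
    ring
  have hid : ∀ n, ∫ x in Ω, deriv deadZone (q n * U x) * gradDot U V x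
      = - ∫ x in Ω, H n (U x) * Δ V x := by
    intro n
    have h := integral_gradDot_of_hasCompactSupport hΩ (hξd n) (hξc n) (hξs n) hV
    have e1 : ∫ x in Ω, gradDot (ξ n) V x = ∫ x, gradDot (ξ n) V x := by
      refine setIntegral_eq_integral_of_forall_compl_eq_zero fun x hx => ?_
      have : fderiv ℝ (ξ n) x = 0 := image_eq_zero_of_notMem_tsupport
        fun h => hx (hξs n (tsupport_fderiv_subset ℝ h))
      simp [gradDot, this]
    have e2 : ∫ x in Ω, ξ n x * Δ V x = ∫ x, ξ n x * Δ V x := by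
      refine setIntegral_eq_integral_of_forall_compl_eq_zero fun x hx => ?_
      simp only [ξ, indicator_of_notMem hx, zero_mul]
    rw [setIntegral_congr_fun hΩ.measurableSet (fun x hx => (hgrad n x hx).symm), e1, h, ← e2]
    congr 1
    refine setIntegral_congr_fun hΩ.measurableSet fun x hx => ?_
    simp only [ξ, indicator_of_mem hx]
  have hGc : AEStronglyMeasurable (gradDot U V) (volume.restrict Ω) :=
    (hU.continuousOn_gradDot hΩ (hV.of_le (by norm_num))).aestronglyMeasurable hΩ.measurableSet
  have hUm : AEStronglyMeasurable U (volume.restrict Ω) :=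
    hU.continuousOn.aestronglyMeasurable hΩ.measurableSet
  have lim1 : Tendsto (fun n => ∫ x in Ω, deriv deadZone (q n * U x) * gradDot U V x) atTop
      (𝓝 (∫ x in Ω, gradDot U V x)) := by
    refine tendsto_integral_of_dominated_convergence (fun _ => D * (2 * (A * B))) (fun n => ?_)
      (integrable_const _) (fun n => ?_) ?_
    · exact ((contDiff_deadZone.continuous_deriv le_rfl).comp_aestronglyMeasurable
        (hUm.const_mul (q n))).mul hGc
    · refine (ae_restrict_iff' hΩ.measurableSet).2 (Eventually.of_forall fun x hx => ?_)
      rw [norm_mul]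
      exact mul_le_mul (hD _) (abs_gradDot_le (hA x hx) (hB x hx)) (norm_nonneg _) hD0
    · rw [ae_restrict_iff' hΩ.measurableSet]
      filter_upwards [ae_fderiv_eq_zero_of_eq_zero hΩ hU 1,
        ae_fderiv_eq_zero_of_eq_zero hΩ hU Complex.I] with x h1 h2 hx
      -- The factor `deriv deadZone (q n * U x)` tends to 1 only where U ≠ 0. On the zero set of U
      -- this does no harm, since ∇U = 0 almost everywhere there.
      by_cases h0 : U x = 0
      · have : gradDot U V x = 0 := by simp [gradDot, h1 hx h0, h2 hx h0]
        simp [this]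
      · refine tendsto_const_nhds.congr' ?_
        filter_upwards [eventually_two_lt_sq h0] with n hn
        rw [deriv_deadZone_of_lt_sq hn, one_mul]
  have lim2 : Tendsto (fun n => - ∫ x in Ω, H n (U x) * Δ V x) atTop
      (𝓝 (- ∫ x in Ω, U x * Δ V x)) := by
    refine (tendsto_integral_of_dominated_convergence (fun _ => M * C) (fun n => ?_)
      (integrable_const _) (fun n => ?_) ?_).neg
    · exact ((hHd n).continuous.comp_aestronglyMeasurable hUm).mul
        ((hV.continuousOn_laplacian hΩ).aestronglyMeasurable hΩ.measurableSet)
    · refine (ae_restrict_iff' hΩ.measurableSet).2 (Eventually.of_forall fun x hx => ?_)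
      rw [norm_mul]
      have hMx := hM x (subset_closure hx)
      exact mul_le_mul ((hHle n _).trans hMx) (hC x hx) (norm_nonneg _)
        ((norm_nonneg _).trans hMx)
    · refine Eventually.of_forall fun x => ?_
      refine Tendsto.mul_const _ ?_
      by_cases h0 : U x = 0
      · simp [H, h0, deadZone]
      · refine tendsto_const_nhds.congr' ?_
        filter_upwards [eventually_two_lt_sq h0] with n hn
        simp only [H, deadZone_of_le_sq hn.le, q]
        field_simp
  rw [← neg_eq_iff_eq_neg]
  exact tendsto_nhds_unique (lim2.congr fun n => (hid n).symm) lim1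

/-! ### Tubular neighbourhoods of closed curves -/

/-- A regular simple closed curve of class `C²`, with a `1`-periodic parametrization. -/
structure IsRegularLoop (c : ℝ → ℂ) : Prop where
  contDiff : ContDiff ℝ 2 c
  periodic : Function.Periodic c 1
  injective : ∀ s s', c s = c s' → ∃ n : ℤ, s' = s + n
  regular : ∀ s, deriv c s ≠ 0

lemma IsRegularLoop.of_injOn {c : ℝ → ℂ} (h1 : ContDiff ℝ 2 c) (h2 : Function.Periodic c 1)
    (h3 : InjOn c (Ico 0 1)) (h4 : ∀ s, deriv c s ≠ 0) : IsRegularLoop c := by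
  refine ⟨h1, h2, fun s s' h => ⟨⌊s'⌋ - ⌊s⌋, ?_⟩, h4⟩
  have hf : ∀ s : ℝ, c (Int.fract s) = c s := fun s => by
    simpa using h2.sub_zsmul_eq (x := s) ⌊s⌋
  have := h3 ⟨Int.fract_nonneg s, Int.fract_lt_one s⟩ ⟨Int.fract_nonneg s', Int.fract_lt_one s'⟩
    (by rw [hf, hf, h])
  rw [Int.fract, Int.fract] at this
  push_cast; linarith

lemma periodic_deriv {c : ℝ → ℂ} (h : Function.Periodic c 1) : Function.Periodic (deriv c) 1 := by
  intro s
  rw [← deriv_comp_add_const]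
  exact congrArg (fun f => deriv f s) (funext h)

/-- The point at the signed distance `t ‖c' s‖` from `c s` on the left normal of the curve. -/
def normalPush (c : ℝ → ℂ) (s t : ℝ) : ℂ := c s + t * (Complex.I * deriv c s)

/-- The partial derivative of `normalPush` with respect to `s`. -/
def pushTangent (c : ℝ → ℂ) (s t : ℝ) : ℂ := deriv c s + t * (Complex.I * deriv (deriv c) s)

/-- `normalPush` as a self-map of the plane. -/
def tube (c : ℝ → ℂ) (z : ℂ) : ℂ := normalPush c z.re z.im

/-- The Jacobian of `tube`. -/
def tubeJac (c : ℝ → ℂ) (s t : ℝ) : ℝ :=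
  (pushTangent c s t).re * (Complex.I * deriv c s).im
    - (Complex.I * deriv c s).re * (pushTangent c s t).im

namespace IsRegularLoop

variable {c : ℝ → ℂ}

lemma contDiff_deriv (hc : IsRegularLoop c) : ContDiff ℝ 1 (deriv c) :=
  (contDiff_succ_iff_deriv (n := 1)).1 (by rw [one_add_one_eq_two]; exact hc.contDiff) |>.2.2

lemma hasDerivAt (hc : IsRegularLoop c) (s : ℝ) : HasDerivAt c (deriv c s) s :=
  (hc.contDiff.differentiable two_ne_zero s).hasDerivAt

lemma hasDerivAt_deriv (hc : IsRegularLoop c) (s : ℝ) : HasDerivAt (deriv c) (deriv (deriv c) s) s :=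
  (hc.contDiff_deriv.differentiable one_ne_zero s).hasDerivAt

lemma continuous_deriv_deriv (hc : IsRegularLoop c) : Continuous (deriv (deriv c)) :=
  hc.contDiff_deriv.continuous_deriv le_rfl

lemma hasDerivAt_normalPush_left (hc : IsRegularLoop c) (s t : ℝ) :
    HasDerivAt (fun s => normalPush c s t) (pushTangent c s t) s :=
  (hc.hasDerivAt s).add (((hc.hasDerivAt_deriv s).const_mul _).const_mul _)

lemma hasDerivAt_normalPush_right (s t : ℝ) :
    HasDerivAt (fun t => normalPush c s t) (Complex.I * deriv c s) t := by
  have := ((Complex.ofRealCLM.hasDerivAt (x := t)).mul_const (Complex.I * deriv c s)).const_add (c s)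
  simpa [normalPush] using this

lemma hasDerivAt_pushTangent_right (s t : ℝ) :
    HasDerivAt (fun t => pushTangent c s t) (Complex.I * deriv (deriv c) s) t := by
  have := ((Complex.ofRealCLM.hasDerivAt (x := t)).mul_const
    (Complex.I * deriv (deriv c) s)).const_add (deriv c s)
  simpa [pushTangent] using this

lemma contDiff_tube (hc : IsRegularLoop c) : ContDiff ℝ 1 (tube c) := by
  have h1 : ContDiff ℝ 1 fun z : ℂ => c z.re :=
    (hc.contDiff.of_le (by norm_num)).comp Complex.reCLM.contDiff
  have h2 : ContDiff ℝ 1 fun z : ℂ => deriv c z.re := hc.contDiff_deriv.comp Complex.reCLM.contDiff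
  have h3 : ContDiff ℝ 1 fun z : ℂ => (z.im : ℂ) :=
    Complex.ofRealCLM.contDiff.comp Complex.imCLM.contDiff
  exact h1.add (h3.mul (contDiff_const.mul h2))

lemma hasFDerivAt_tube (hc : IsRegularLoop c) (z : ℂ) :
    HasFDerivAt (tube c) (Complex.reCLM.smulRight (pushTangent c z.re z.im)
      + Complex.imCLM.smulRight (Complex.I * deriv c z.re)) z := by
  have h1 := (hc.hasDerivAt z.re).hasFDerivAt.comp z Complex.reCLM.hasFDerivAt
  have h2 := (hc.hasDerivAt_deriv z.re).hasFDerivAt.comp z Complex.reCLM.hasFDerivAt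
  have h3 : HasFDerivAt (fun z : ℂ => (z.im : ℂ)) (Complex.ofRealCLM.comp Complex.imCLM) z :=
    (Complex.ofRealCLM.comp Complex.imCLM).hasFDerivAt
  refine (h1.add (h3.mul (h2.const_mul Complex.I))).congr_fderiv ?_
  ext v
  simp only [pushTangent]
  simp
  ring

lemma det_smulRight_add (a b : ℂ) :
    (Complex.reCLM.smulRight a + Complex.imCLM.smulRight b : ℂ →L[ℝ] ℂ).det
      = a.re * b.im - b.re * a.im := by
  rw [ContinuousLinearMap.det, ← LinearMap.det_toMatrix Complex.basisOneI, Matrix.det_fin_two]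
  simp [LinearMap.toMatrix_apply]

lemma hasStrictFDerivAt_tube (hc : IsRegularLoop c) (z : ℂ) :
    HasStrictFDerivAt (tube c) (Complex.reCLM.smulRight (pushTangent c z.re z.im)
      + Complex.imCLM.smulRight (Complex.I * deriv c z.re)) z :=
  hc.contDiff_tube.contDiffAt.hasStrictFDerivAt' (hc.hasFDerivAt_tube z) one_ne_zero

lemma tubeJac_zero (s : ℝ) : tubeJac c s 0 = ‖deriv c s‖ ^ 2 := by
  rw [← Complex.normSq_eq_norm_sq, Complex.normSq_apply]
  simp [tubeJac, pushTangent]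

lemma tubeJac_zero_pos (hc : IsRegularLoop c) (s : ℝ) : 0 < tubeJac c s 0 := by
  rw [tubeJac_zero]; have := norm_pos_iff.2 (hc.regular s); positivity

lemma continuous_tubeJac (hc : IsRegularLoop c) : Continuous fun z : ℂ => tubeJac c z.re z.im := by
  have h1 := hc.contDiff_deriv.continuous
  have h2 := hc.continuous_deriv_deriv
  unfold tubeJac pushTangent
  fun_prop

lemma tubeJac_add_int (hc : IsRegularLoop c) (s t : ℝ) (n : ℤ) : tubeJac c (s + n) t = tubeJac c s t := by
  have h1 : ∀ s, deriv c (s + n) = deriv c s := fun s => by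
    simpa using (periodic_deriv hc.periodic).int_mul n s
  have h2 : ∀ s, deriv (deriv c) (s + n) = deriv (deriv c) s := fun s => by
    simpa using (periodic_deriv (periodic_deriv hc.periodic)).int_mul n s
  simp [tubeJac, pushTangent, h1, h2]

lemma normalPush_add_int (hc : IsRegularLoop c) (s t : ℝ) (n : ℤ) : normalPush c (s + n) t = normalPush c s t := by
  have h0 : c (s + n) = c s := by simpa using hc.periodic.int_mul n s
  have h1 : deriv c (s + n) = deriv c s := by
    simpa using (periodic_deriv hc.periodic).int_mul n s
  simp [normalPush, h0, h1]

lemma tube_add_int (hc : IsRegularLoop c) (z : ℂ) (n : ℤ) : tube c (z + n) = tube c z := by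
  have := hc.normalPush_add_int z.re z.im n
  simpa [tube] using this

/-- The inverse function theorem at a point where the Jacobian does not vanish. -/
lemma map_nhds_tube (hc : IsRegularLoop c) {z : ℂ} (hz : tubeJac c z.re z.im ≠ 0) :
    map (tube c) (𝓝 z) = 𝓝 (tube c z) ∧ ∃ s ∈ 𝓝 z, InjOn (tube c) s := by
  have hd := hc.hasStrictFDerivAt_tube z
  set L := (Complex.reCLM.smulRight (pushTangent c z.re z.im)
      + Complex.imCLM.smulRight (Complex.I * deriv c z.re) : ℂ →L[ℝ] ℂ)
  have hL : L.det ≠ 0 := by rw [det_smulRight_add]; exact hz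
  have hd' : HasStrictFDerivAt (tube c)
      ((L.toContinuousLinearEquivOfDetNeZero hL : ℂ ≃L[ℝ] ℂ) : ℂ →L[ℝ] ℂ) z := by
    simpa using hd
  exact ⟨hd'.map_nhds_eq_of_equiv, (hd'.toOpenPartialHomeomorph (tube c)).source,
    (hd'.toOpenPartialHomeomorph (tube c)).open_source.mem_nhds
      hd'.mem_toOpenPartialHomeomorph_source, (hd'.toOpenPartialHomeomorph (tube c)).injOn⟩

lemma isOpen_image_tube (hc : IsRegularLoop c) {Q : Set ℂ} (hQ : IsOpen Q) (hJ : ∀ z ∈ Q, tubeJac c z.re z.im ≠ 0) :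
    IsOpen (tube c '' Q) := by
  rw [isOpen_iff_mem_nhds]
  rintro _ ⟨z, hz, rfl⟩
  rw [← (hc.map_nhds_tube (hJ z hz)).1]
  exact image_mem_map (hQ.mem_nhds hz)

/-- One period of the real axis is compact, so some thickening of it stays in Q; translation by
integers spreads it to a strip. -/
lemma exists_strip_subset {Q : Set ℂ} (hQ : IsOpen Q) (hper : ∀ (z : ℂ) (n : ℤ), z + n ∈ Q → z ∈ Q)
    (hR : ∀ s : ℝ, (s : ℂ) ∈ Q) : ∃ δ > 0, ∀ z : ℂ, |z.im| < δ → z ∈ Q := by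
  have hcpt : IsCompact ((fun s : ℝ => (s : ℂ)) '' Icc 0 1) :=
    isCompact_Icc.image Complex.continuous_ofReal
  obtain ⟨δ, hδ, h⟩ := hcpt.exists_thickening_subset_open hQ (by rintro _ ⟨s, _, rfl⟩; exact hR s)
  refine ⟨δ, hδ, fun z hz => hper z (-⌊z.re⌋) (h ?_)⟩
  rw [Metric.mem_thickening_iff]
  refine ⟨_, ⟨Int.fract z.re, ⟨Int.fract_nonneg _, (Int.fract_lt_one _).le⟩, rfl⟩, ?_⟩
  have : z + ((-⌊z.re⌋ : ℤ) : ℂ) - ((Int.fract z.re : ℝ) : ℂ) = z.im * Complex.I := by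
    apply Complex.ext <;> simp [← Int.self_sub_floor]
  rw [dist_eq_norm, this]
  simpa using hz

/-- Otherwise there are pairs with equal images, not differing by an integer, whose imaginary parts
tend to 0. Reduced to one period, they converge along a subsequence to two real points with the same
image; these differ by an integer m because the curve is simple. After a shift by m both sequences
enter a neighbourhood on which `tube` is injective, which is a contradiction. -/
lemma exists_injective_strip (hc : IsRegularLoop c) : ∃ δ > 0, ∀ z w : ℂ, |z.im| < δ → |w.im| < δ → tube c z = tube c w →
    ∃ n : ℤ, w = z + n := by
  by_contra! hcon
  have hpos : ∀ n : ℕ, (0 : ℝ) < 1 / ((n : ℝ) + 1) := fun n => by positivity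
  choose z w hz hw hzw hne using fun n : ℕ => hcon (1 / ((n : ℝ) + 1)) (hpos n)
  let z' : ℕ → ℂ := fun n => z n + ((-⌊(z n).re⌋ : ℤ) : ℂ)
  let w' : ℕ → ℂ := fun n => w n + ((-⌊(w n).re⌋ : ℤ) : ℂ)
  have hle : ∀ n : ℕ, 1 / ((n : ℝ) + 1) ≤ 1 := fun n => by
    rw [div_le_one (by positivity)]; linarith [n.cast_nonneg (α := ℝ)]
  have hK : IsCompact ((Icc (0 : ℝ) 1 ×ℂ Icc (-1 : ℝ) 1)) := isCompact_Icc.reProdIm isCompact_Icc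
  have hmem : ∀ (u : ℂ) (n : ℕ), |u.im| < 1 / ((n : ℝ) + 1) →
      u + ((-⌊u.re⌋ : ℤ) : ℂ) ∈ (Icc (0 : ℝ) 1 ×ℂ Icc (-1 : ℝ) 1) := by
    intro u n hu
    have h2 := (Int.fract_lt_one u.re).le
    have h3 := abs_le.1 (hu.le.trans (hle n))
    rw [Complex.mem_reProdIm]
    rw [← Int.self_sub_floor] at h2
    refine ⟨⟨?_, ?_⟩, ?_⟩
    · simpa using Int.floor_le u.re
    · simpa [sub_eq_add_neg] using h2
    · simpa using h3
  obtain ⟨p, -, φ, hφ, hlim⟩ := (hK.prod hK).tendsto_subseq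
    (x := fun n => (z' n, w' n)) (fun n => ⟨hmem _ n (hz n), hmem _ n (hw n)⟩)
  have hlz : Tendsto (z' ∘ φ) atTop (𝓝 p.1) := (continuous_fst.tendsto p).comp hlim
  have hlw : Tendsto (w' ∘ φ) atTop (𝓝 p.2) := (continuous_snd.tendsto p).comp hlim
  have h0 : Tendsto (fun n => 1 / ((φ n : ℝ) + 1)) atTop (𝓝 0) :=
    tendsto_one_div_add_atTop_nhds_zero_nat.comp hφ.tendsto_atTop
  have him : ∀ (u : ℕ → ℂ) (q : ℂ), (∀ n, |(u n).im| < 1 / ((n : ℝ) + 1)) →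
      Tendsto (u ∘ φ) atTop (𝓝 q) → q.im = 0 := by
    intro u q hu hq
    have h1 : Tendsto (fun n => |(u (φ n)).im|) atTop (𝓝 |q.im|) :=
      (Complex.continuous_im.abs.tendsto q).comp hq
    have h2 := squeeze_zero (fun n => abs_nonneg _) (fun n => (hu (φ n)).le) h0
    exact abs_eq_zero.1 (tendsto_nhds_unique h1 h2)
  have hp1 : p.1.im = 0 := him z' _ (fun n => by simpa [z'] using hz n) hlz
  have hp2 : p.2.im = 0 := him w' _ (fun n => by simpa [w'] using hw n) hlw
  have htz : ∀ n, tube c (z' n) = tube c (w' n) := fun n => by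
    simp only [z', w']; rw [hc.tube_add_int, hc.tube_add_int, hzw]
  have hlim' : tube c p.1 = tube c p.2 :=
    tendsto_nhds_unique ((hc.contDiff_tube.continuous.tendsto _).comp hlz)
      (((hc.contDiff_tube.continuous.tendsto _).comp hlw).congr fun n => (htz (φ n)).symm)
  obtain ⟨m, hm⟩ := hc.injective p.1.re p.2.re (by simpa [tube, normalPush, hp1, hp2] using hlim')
  have hm' : p.2 + ((-m : ℤ) : ℂ) = p.1 := by
    apply Complex.ext <;> simp [hp1, hp2, hm]
  obtain ⟨s, hs, hinj⟩ := (hc.map_nhds_tube (z := p.1) (by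
    rw [hp1]; exact (hc.tubeJac_zero_pos _).ne')).2
  have hlw' : Tendsto (fun n => w' (φ n) + ((-m : ℤ) : ℂ)) atTop (𝓝 p.1) := by
    rw [← hm']; exact hlw.add_const _
  obtain ⟨n, hn1, hn2⟩ := ((hlz.eventually_mem hs).and (hlw'.eventually_mem hs)).exists
  have := hinj hn1 hn2 (by rw [hc.tube_add_int]; exact htz _)
  refine hne (φ n) (⌊(w (φ n)).re⌋ - ⌊(z (φ n)).re⌋ + m) ?_
  simp only [Function.comp, z', w'] at this
  push_cast at this ⊢
  linear_combination -this

/-- A tubular neighbourhood of the curve in a given open set. -/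
lemma exists_tube (hc : IsRegularLoop c) {O : Set ℂ} (hO : IsOpen O) (hcO : range c ⊆ O) :
    ∃ δ > 0, (∀ z w : ℂ, |z.im| < δ → |w.im| < δ → tube c z = tube c w → ∃ n : ℤ, w = z + n) ∧
      ∀ z : ℂ, |z.im| < δ → tube c z ∈ O ∧ 0 < tubeJac c z.re z.im := by
  obtain ⟨δ₁, hδ₁, h1⟩ := hc.exists_injective_strip
  obtain ⟨δ₂, hδ₂, h2⟩ := exists_strip_subset
    (Q := tube c ⁻¹' O ∩ {z : ℂ | 0 < tubeJac c z.re z.im})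
    ((hO.preimage hc.contDiff_tube.continuous).inter
      (isOpen_lt continuous_const hc.continuous_tubeJac))
    (fun z n hz => by
      refine ⟨by simpa [hc.tube_add_int] using hz.1, ?_⟩
      have h := hz.2
      simp only [mem_ofPred_eq, Complex.add_re, Complex.add_im, Complex.intCast_re,
        Complex.intCast_im, add_zero, hc.tubeJac_add_int] at h
      exact h)
    (fun s => ⟨hcO ⟨s, by simp [tube, normalPush]⟩, by simpa using hc.tubeJac_zero_pos s⟩)
  refine ⟨min δ₁ δ₂, lt_min hδ₁ hδ₂, fun z w hz hw => h1 z w (hz.trans_le (min_le_left _ _))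
    (hw.trans_le (min_le_left _ _)), fun z hz => h2 z (hz.trans_le (min_le_right _ _))⟩

end IsRegularLoop

/-! ### The flux of a harmonic gradient through a boundary curve -/

/-- The conjugate `∂₁V - i ∂₂V` of the complex gradient, which is holomorphic if `V` is harmonic. -/
def conjGrad (V : ℂ → ℝ) (x : ℂ) : ℂ :=
  (fderiv ℝ V x 1 : ℂ) - Complex.I * (fderiv ℝ V x Complex.I : ℂ)

lemma norm_conjGrad_le (V : ℂ → ℝ) (x : ℂ) : ‖conjGrad V x‖ ≤ 2 * ‖fderiv ℝ V x‖ := by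
  have h1 := (fderiv ℝ V x).le_opNorm 1
  have h2 := (fderiv ℝ V x).le_opNorm Complex.I
  calc ‖conjGrad V x‖ ≤ _ := norm_sub_le _ _
    _ ≤ 2 * ‖fderiv ℝ V x‖ := by
      simp only [norm_mul, Complex.norm_I, Complex.norm_real, norm_one, mul_one, one_mul] at *
      linarith

lemma fderiv_apply_eq (χ : ℂ → ℝ) (x a : ℂ) :
    fderiv ℝ χ x a = a.re * fderiv ℝ χ x 1 + a.im * fderiv ℝ χ x Complex.I := by
  conv_lhs => rw [← Complex.re_add_im a]
  have h1 : (a.re : ℂ) + a.im * Complex.I = a.re • (1 : ℂ) + a.im • Complex.I := by simp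
  rw [h1, map_add, map_smul, map_smul, smul_eq_mul, smul_eq_mul]

/-- With g = `conjGrad V`, the form g dz is dV + i ⋆dV. The left side is the imaginary part of dχ ∧
g dz on the pair (a, b), that is dχ ∧ ⋆dV = ∇χ · ∇V dA. -/
lemma im_fderiv_conjGrad (χ V : ℂ → ℝ) (x a b : ℂ) :
    ((fderiv ℝ χ x a : ℂ) * conjGrad V x * b - (fderiv ℝ χ x b : ℂ) * conjGrad V x * a).im
      = (a.re * b.im - b.re * a.im) * gradDot χ V x := by
  rw [fderiv_apply_eq χ x a, fderiv_apply_eq χ x b, gradDot, conjGrad]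
  simp
  ring

lemma intervalIntegral_swap_of_continuousOn {f : ℝ → ℝ → ℝ} {a b a' b' : ℝ} (h : a ≤ b)
    (h' : a' ≤ b') (hf : ContinuousOn (fun p : ℝ × ℝ => f p.1 p.2) (Icc a b ×ˢ Icc a' b')) :
    ∫ x in a..b, ∫ y in a'..b', f x y = ∫ y in a'..b', ∫ x in a..b, f x y := by
  simp_rw [intervalIntegral.integral_of_le h, intervalIntegral.integral_of_le h']
  refine integral_integral_swap ?_
  rw [Measure.prod_restrict]
  exact (hf.integrableOn_compact (isCompact_Icc.prod isCompact_Icc)).mono_set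
    (prod_mono Ioc_subset_Icc_self Ioc_subset_Icc_self)

namespace IsRegularLoop

variable {c : ℝ → ℂ}

lemma continuous_normalPush (hc : IsRegularLoop c) :
    Continuous fun p : ℝ × ℝ => normalPush c p.1 p.2 := by
  have h0 := hc.contDiff.continuous
  have h1 := hc.contDiff_deriv.continuous
  unfold normalPush
  fun_prop

lemma continuous_pushTangent (hc : IsRegularLoop c) :
    Continuous fun p : ℝ × ℝ => pushTangent c p.1 p.2 := by
  have h0 := hc.contDiff_deriv.continuous
  have h1 := hc.continuous_deriv_deriv
  unfold pushTangent
  fun_prop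

/-- The weight `∇χ · ∇V` integrates over a part of the collar to a boundary integral. -/
lemma integral_collar_eq (hc : IsRegularLoop c) {D : Set ℂ} {V χ : ℂ → ℝ}
    (hV : HarmonicOnNhd V D) (hχ : ContDiff ℝ 1 χ) {ε η : ℝ} (hεη : ε ≤ η)
    (hmem : ∀ s, ∀ t ∈ Icc ε η, normalPush c s t ∈ D) (hχ0 : ∀ s, χ (normalPush c s η) = 0) :
    ∫ t in ε..η, ∫ s in (0 : ℝ)..1, tubeJac c s t * gradDot χ V (normalPush c s t)
      = ∫ s in (0 : ℝ)..1,
        (χ (normalPush c s ε) * conjGrad V (normalPush c s ε) * pushTangent c s ε).im := by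
  set Φ := normalPush c
  set A := pushTangent c
  have hΦc : Continuous fun p : ℝ × ℝ => Φ p.1 p.2 := hc.continuous_normalPush
  have hAc : Continuous fun p : ℝ × ℝ => A p.1 p.2 := hc.continuous_pushTangent
  have hc1 := hc.contDiff_deriv.continuous
  have hc2 := hc.continuous_deriv_deriv
  have hhol : ∀ x ∈ D, DifferentiableAt ℂ (conjGrad V) x := fun x hx =>
    HarmonicAt.differentiableAt_complex_partial (hV x hx)
  have hhan : AnalyticOnNhd ℂ (conjGrad V) D := fun x hx => HarmonicAt.analyticAt_complex_partial (hV x hx)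
  have hχd : ∀ x, HasFDerivAt χ (fderiv ℝ χ x) x := fun x =>
    (hχ.differentiable one_ne_zero x).hasFDerivAt
  have chain : ∀ (f : ℝ → ℂ) (f' : ℂ) (r : ℝ), HasDerivAt f f' r → f r ∈ D →
      HasDerivAt (fun r => (χ (f r) : ℂ) * conjGrad V (f r))
        (fderiv ℝ χ (f r) f' * conjGrad V (f r) + χ (f r) * (deriv (conjGrad V) (f r) * f')) r := by
    intro f f' r hf hr
    have h1 := ((hχd (f r)).comp_hasDerivAt r hf).ofReal_comp
    have h2 := ((hhol _ hr).hasDerivAt.hasFDerivAt.restrictScalars ℝ).comp_hasDerivAt r hf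
    refine (h1.mul h2).congr_deriv ?_
    simp [mul_comm]
  have hd1 : ∀ s, ∀ t ∈ Icc ε η, HasDerivAt
      (fun s => (χ (Φ s t) : ℂ) * conjGrad V (Φ s t) * (Complex.I * deriv c s))
      ((fderiv ℝ χ (Φ s t) (A s t) * conjGrad V (Φ s t)
        + χ (Φ s t) * (deriv (conjGrad V) (Φ s t) * A s t)) * (Complex.I * deriv c s)
        + χ (Φ s t) * conjGrad V (Φ s t) * (Complex.I * deriv (deriv c) s)) s := fun s t ht =>
    (chain _ _ s (hc.hasDerivAt_normalPush_left s t) (hmem s t ht)).mul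
      ((hc.hasDerivAt_deriv s).const_mul _)
  have hd2 : ∀ s, ∀ t ∈ Icc ε η, HasDerivAt
      (fun t => (χ (Φ s t) : ℂ) * conjGrad V (Φ s t) * A s t)
      ((fderiv ℝ χ (Φ s t) (Complex.I * deriv c s) * conjGrad V (Φ s t)
        + χ (Φ s t) * (deriv (conjGrad V) (Φ s t) * (Complex.I * deriv c s))) * A s t
        + χ (Φ s t) * conjGrad V (Φ s t) * (Complex.I * deriv (deriv c) s)) t := fun s t ht =>
    (chain _ _ t (hasDerivAt_normalPush_right s t) (hmem s t ht)).mul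
      (hasDerivAt_pushTangent_right s t)
  set D1 : ℝ → ℝ → ℂ := fun s t => (fderiv ℝ χ (Φ s t) (A s t) * conjGrad V (Φ s t)
        + χ (Φ s t) * (deriv (conjGrad V) (Φ s t) * A s t)) * (Complex.I * deriv c s)
        + χ (Φ s t) * conjGrad V (Φ s t) * (Complex.I * deriv (deriv c) s)
  set D2 : ℝ → ℝ → ℂ := fun s t =>
      (fderiv ℝ χ (Φ s t) (Complex.I * deriv c s) * conjGrad V (Φ s t)
        + χ (Φ s t) * (deriv (conjGrad V) (Φ s t) * (Complex.I * deriv c s))) * A s t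
        + χ (Φ s t) * conjGrad V (Φ s t) * (Complex.I * deriv (deriv c) s)
  -- With g = `conjGrad V`, `D1` is the s-derivative of χ g ∂_tΦ and `D2` the t-derivative of χ g
  -- ∂_sΦ. In the difference the terms with g' cancel because g is holomorphic, and the terms with
  -- second derivatives of Φ because they are the same mixed derivative; only dχ ∧ g dz is left.
  have him : ∀ s t, (D1 s t - D2 s t).im = tubeJac c s t * gradDot χ V (Φ s t) := by
    intro s t
    rw [tubeJac, ← im_fderiv_conjGrad]
    congr 1
    simp only [D1, D2]
    ring
  have hmaps : MapsTo (fun p : ℝ × ℝ => Φ p.2 p.1) (Icc ε η ×ˢ univ) D := fun p hp =>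
    hmem p.2 p.1 hp.1
  have hΦc' : Continuous fun p : ℝ × ℝ => Φ p.2 p.1 := hΦc.comp continuous_swap
  have hAc' : Continuous fun p : ℝ × ℝ => A p.2 p.1 := hAc.comp continuous_swap
  have hgc : ContinuousOn (fun p : ℝ × ℝ => conjGrad V (Φ p.2 p.1)) (Icc ε η ×ˢ univ) :=
    (hhan.continuousOn).comp hΦc'.continuousOn hmaps
  have hgc' : ContinuousOn (fun p : ℝ × ℝ => deriv (conjGrad V) (Φ p.2 p.1)) (Icc ε η ×ˢ univ) :=
    (hhan.deriv.continuousOn).comp hΦc'.continuousOn hmaps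
  have hχc : Continuous fun p : ℝ × ℝ => (χ (Φ p.2 p.1) : ℂ) :=
    Complex.continuous_ofReal.comp (hχ.continuous.comp hΦc')
  have hχ1 : Continuous fun p : ℝ × ℝ => (fderiv ℝ χ (Φ p.2 p.1) (A p.2 p.1) : ℂ) :=
    Complex.continuous_ofReal.comp
      (((hχ.continuous_fderiv one_ne_zero).comp hΦc').clm_apply hAc')
  have hBc : Continuous fun p : ℝ × ℝ => Complex.I * deriv c p.2 := by fun_prop
  have hχ2 : Continuous fun p : ℝ × ℝ => (fderiv ℝ χ (Φ p.2 p.1) (Complex.I * deriv c p.2) : ℂ) :=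
    Complex.continuous_ofReal.comp
      (((hχ.continuous_fderiv one_ne_zero).comp hΦc').clm_apply hBc)
  have hB'c : Continuous fun p : ℝ × ℝ => Complex.I * deriv (deriv c) p.2 := by fun_prop
  have hD1c : ContinuousOn (fun p : ℝ × ℝ => D1 p.2 p.1) (Icc ε η ×ˢ univ) :=
    (((hχ1.continuousOn.mul hgc).add (hχc.continuousOn.mul (hgc'.mul hAc'.continuousOn))).mul
      hBc.continuousOn).add ((hχc.continuousOn.mul hgc).mul hB'c.continuousOn)
  have hD2c : ContinuousOn (fun p : ℝ × ℝ => D2 p.2 p.1) (Icc ε η ×ˢ univ) :=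
    (((hχ2.continuousOn.mul hgc).add (hχc.continuousOn.mul (hgc'.mul hBc.continuousOn))).mul
      hAc'.continuousOn).add ((hχc.continuousOn.mul hgc).mul hB'c.continuousOn)
  have slice : ∀ {E : ℝ → ℝ → ℂ}, ContinuousOn (fun p : ℝ × ℝ => E p.2 p.1) (Icc ε η ×ˢ univ) →
      (∀ t ∈ Icc ε η, Continuous fun s => E s t) ∧
        (∀ s, ContinuousOn (fun t => E s t) (Icc ε η)) := by
    intro E hE
    refine ⟨fun t ht => ?_, fun s => ?_⟩
    · rw [← continuousOn_univ]
      exact hE.comp (f := fun s : ℝ => (t, s)) (by fun_prop) fun s _ => ⟨ht, mem_univ _⟩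
    · exact hE.comp (f := fun t : ℝ => (t, s)) (by fun_prop) fun t ht => ⟨ht, mem_univ _⟩
  -- `D1` is the derivative of a periodic function, so it integrates to zero over a period. `D2`
  -- leaves only the boundary term at t = ε, since χ vanishes at t = η.
  have hI1 : ∀ t ∈ Icc ε η, ∫ s in (0 : ℝ)..1, D1 s t = 0 := by
    intro t ht
    rw [intervalIntegral.integral_eq_sub_of_hasDerivAt (fun s _ => hd1 s t ht)
      (((slice hD1c).1 t ht).intervalIntegrable _ _)]
    have h1 : Φ 1 t = Φ 0 t := by simpa using hc.normalPush_add_int 0 t 1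
    have h2 : deriv c 1 = deriv c 0 := by simpa using periodic_deriv hc.periodic 0
    rw [h1, h2, sub_self]
  have hI2 : ∀ s, ∫ t in ε..η, (D2 s t).im
      = - ((χ (Φ s ε) : ℂ) * conjGrad V (Φ s ε) * A s ε).im := by
    intro s
    have hi := ((slice hD2c).2 s).intervalIntegrable_of_Icc (μ := volume) hεη
    have h : ∫ t in ε..η, (D2 s t).im = (∫ t in ε..η, D2 s t).im :=
      Complex.imCLM.intervalIntegral_comp_comm hi
    rw [h, intervalIntegral.integral_eq_sub_of_hasDerivAt
      (fun t ht => hd2 s t (by rwa [uIcc_of_le hεη] at ht)) hi]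
    simp [hχ0 s]
  have step : ∀ t ∈ Icc ε η, ∫ s in (0 : ℝ)..1, tubeJac c s t * gradDot χ V (Φ s t)
      = - ∫ s in (0 : ℝ)..1, (D2 s t).im := by
    intro t ht
    have i1 := ((slice hD1c).1 t ht).intervalIntegrable (μ := volume) 0 1
    have i2 := ((slice hD2c).1 t ht).intervalIntegrable (μ := volume) 0 1
    have h1 : ∫ s in (0 : ℝ)..1, (D1 s t - D2 s t).im
        = (∫ s in (0 : ℝ)..1, (D1 s t - D2 s t)).im :=
      Complex.imCLM.intervalIntegral_comp_comm (i1.sub i2)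
    have h2 : ∫ s in (0 : ℝ)..1, (D2 s t).im = (∫ s in (0 : ℝ)..1, D2 s t).im :=
      Complex.imCLM.intervalIntegral_comp_comm i2
    simp_rw [← him]
    rw [h1, h2, intervalIntegral.integral_sub i1 i2, hI1 t ht, zero_sub, Complex.neg_im]
  have hswap := intervalIntegral_swap_of_continuousOn (f := fun t s => (D2 s t).im) hεη zero_le_one
    (Complex.continuous_im.comp_continuousOn (hD2c.mono (prod_mono_right (subset_univ _))))
  calc _ = ∫ t in ε..η, - ∫ s in (0 : ℝ)..1, (D2 s t).im :=
        intervalIntegral.integral_congr fun t ht => step t (by rwa [uIcc_of_le hεη] at ht)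
    _ = _ := by
        rw [intervalIntegral.integral_neg, hswap]
        simp_rw [hI2]
        rw [intervalIntegral.integral_neg, neg_neg]

/-- If the flux of `∇V` through the curve vanishes, then `∇χ · ∇V` has integral zero over the
left half of a tubular neighbourhood. -/
lemma setIntegral_halfTube_eq_zero (hc : IsRegularLoop c) {D : Set ℂ} (hD : IsOpen D)
    {V χ : ℂ → ℝ} (hV : HarmonicOnNhd V D) (hχ : ContDiff ℝ 1 χ) (hχc : HasCompactSupport χ)
    {B : ℝ} (hB : ∀ x ∈ D, ‖fderiv ℝ V x‖ ≤ B) {δ η : ℝ} (hη : 0 < η) (hηδ : η < δ)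
    (hinj : ∀ z w : ℂ, |z.im| < δ → |w.im| < δ → tube c z = tube c w → ∃ n : ℤ, w = z + n)
    (hJ : ∀ z : ℂ, |z.im| < δ → 0 < tubeJac c z.re z.im)
    (hmem : ∀ s t, 0 < t → t < δ → normalPush c s t ∈ D)
    (hχ0 : ∀ s, χ (normalPush c s η) = 0) (hχ1 : ∀ s, χ (c s) = 1) {w : ℝ → ℂ}
    (hw : ∀ s, Tendsto (conjGrad V) (𝓝[D] (c s)) (𝓝 (w s)))
    (hflux : ∫ s in (0 : ℝ)..1, (w s * deriv c s).im = 0) :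
    ∫ x in tube c '' {z | 0 < z.im ∧ z.im < η}, gradDot χ V x = 0 := by
  have hδ : 0 < δ := hη.trans hηδ
  set J : ℝ → ℝ → ℝ := fun s t => tubeJac c s t * gradDot χ V (normalPush c s t)
  have habs : ∀ t : ℝ, 0 < t → t < η → |t| < δ := fun t h1 h2 => by
    rw [abs_of_pos h1]; exact h2.trans hηδ
  set S : Set ℂ := Ico (0 : ℝ) 1 ×ℂ Ioo 0 η
  have hSm : MeasurableSet S :=
    (measurableSet_Ico.preimage Complex.measurable_re).inter
      (measurableSet_Ioo.preimage Complex.measurable_im)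
  -- One half-open period already covers the half tube, and `tube` is injective on it, so the change
  -- of variables applies.
  have himg : tube c '' {z | 0 < z.im ∧ z.im < η} = tube c '' S := by
    apply Subset.antisymm
    · rintro _ ⟨z, hz, rfl⟩
      refine ⟨z + ((-⌊z.re⌋ : ℤ) : ℂ), ⟨⟨?_, ?_⟩, ?_⟩, hc.tube_add_int z _⟩
      · simpa using Int.floor_le z.re
      · have := Int.fract_lt_one z.re
        rw [← Int.self_sub_floor] at this
        simpa [sub_eq_add_neg] using this
      · simpa using hz
    · exact image_mono fun z hz => hz.2
  have hinjS : InjOn (tube c) S := by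
    intro z hz z' hz' h
    obtain ⟨n, hn⟩ := hinj z z' (habs _ hz.2.1 hz.2.2) (habs _ hz'.2.1 hz'.2.2) h
    have hre : z'.re = z.re + n := by simp [hn]
    have h1 := hz.1.1; have h2 := hz.1.2; have h3 := hz'.1.1; have h4 := hz'.1.2
    have hn0 : n = 0 := by
      have h5 : (n : ℝ) < 1 := by linarith
      have h6 : (-1 : ℝ) < n := by linarith
      have h5' : n < 1 := by exact_mod_cast h5
      have h6' : -1 < n := by exact_mod_cast h6
      omega
    simp [hn, hn0]
  have hcv : ∫ x in tube c '' S, gradDot χ V x = ∫ z in S, J z.re z.im := by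
    rw [integral_image_eq_integral_abs_det_fderiv_smul volume hSm
      (fun z _ => (hc.hasFDerivAt_tube z).hasFDerivWithinAt) hinjS]
    refine setIntegral_congr_fun hSm fun z hz => ?_
    simp only [det_smulRight_add, smul_eq_mul]
    have := hJ z (habs _ hz.2.1 hz.2.2)
    rw [tubeJac] at this
    rw [abs_of_pos this]
    rfl
  have hprod : ∫ z in S, J z.re z.im
      = ∫ p in Ico (0 : ℝ) 1 ×ˢ Ioo 0 η, J p.1 p.2 := by
    have h := (Complex.volume_preserving_equiv_real_prod).setIntegral_preimage_emb
      Complex.measurableEquivRealProd.measurableEmbedding (fun p : ℝ × ℝ => J p.1 p.2)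
      (Ico (0 : ℝ) 1 ×ˢ Ioo 0 η)
    exact h
  -- integrability
  obtain ⟨C, hC⟩ : ∃ C, ∀ x, ‖fderiv ℝ χ x‖ ≤ C :=
    (hχ.continuous_fderiv one_ne_zero).bounded_above_of_compact_support (hχc.fderiv ℝ)
  have hJc : Continuous fun p : ℝ × ℝ => tubeJac c p.1 p.2 := by
    have := hc.continuous_tubeJac.comp Complex.equivRealProdCLM.symm.continuous
    exact this.congr fun p => by simp
  obtain ⟨M, hM⟩ := (isCompact_Icc.prod isCompact_Icc).exists_bound_of_continuousOn
    (s := Icc (0 : ℝ) 1 ×ˢ Icc (0 : ℝ) η) hJc.continuousOn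
  have hχ2 : ContDiffOn ℝ 1 χ D := hχ.contDiffOn
  have hV2 : ContDiffOn ℝ 2 V D := fun x hx => (hV x hx).1.contDiffWithinAt
  have hJcont : ContinuousOn (fun p : ℝ × ℝ => J p.1 p.2) (univ ×ˢ Ioo 0 δ) :=
    hJc.continuousOn.mul ((hχ2.continuousOn_gradDot hD (hV2.of_le (by norm_num))).comp
      hc.continuous_normalPush.continuousOn fun p hp => hmem p.1 p.2 hp.2.1 hp.2.2)
  have hint : IntegrableOn (fun p : ℝ × ℝ => J p.1 p.2) (Ico (0 : ℝ) 1 ×ˢ Ioo 0 η) := by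
    refine IntegrableOn.of_bound (C := M * (2 * (C * B))) ?_ ?_ ?_
    · rw [Measure.volume_eq_prod, Measure.prod_prod]
      simp
    · exact (hJcont.mono (prod_mono (subset_univ _)
        (Ioo_subset_Ioo_right hηδ.le))).aestronglyMeasurable
        (measurableSet_Ico.prod measurableSet_Ioo)
    · refine (ae_restrict_iff' (measurableSet_Ico.prod measurableSet_Ioo)).2
        (Eventually.of_forall fun p hp => ?_)
      have h1 := hM p ⟨Ico_subset_Icc_self hp.1, Ioo_subset_Icc_self hp.2⟩
      rw [norm_mul]
      exact mul_le_mul h1 (abs_gradDot_le (hC _)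
        (hB _ (hmem p.1 p.2 hp.2.1 (hp.2.2.trans hηδ)))) (norm_nonneg _) ((norm_nonneg _).trans h1)
  rw [himg, hcv, hprod]
  set K : ℝ → ℝ := fun t => ∫ s in (0 : ℝ)..1, J s t
  have hKeq : ∀ t, K t = ∫ s in Ico (0 : ℝ) 1, J s t := fun t => by
    rw [integral_Ico_eq_integral_Ioc, ← intervalIntegral.integral_of_le zero_le_one]
  have hint' : Integrable (fun p : ℝ × ℝ => J p.1 p.2)
      ((volume.restrict (Ico (0 : ℝ) 1)).prod (volume.restrict (Ioo 0 η))) := by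
    rw [Measure.prod_restrict]; exact hint
  have hfub : ∫ p in Ico (0 : ℝ) 1 ×ˢ Ioo 0 η, J p.1 p.2 = ∫ t in (0 : ℝ)..η, K t := by
    rw [intervalIntegral.integral_of_le hη.le, integral_Ioc_eq_integral_Ioo]
    simp_rw [hKeq]
    rw [Measure.volume_eq_prod, ← Measure.prod_restrict, integral_prod_symm _ hint']
  have hKint : IntegrableOn K (Ioo 0 η) := by
    have := hint'.integral_prod_right
    exact this.congr (Eventually.of_forall fun t => (hKeq t).symm)
  rw [hfub]
  -- V is harmonic only inside D, so the collar identity is applied above the height ε > 0, and then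
  -- ε → 0. The collar integrals converge by integrability; the boundary integrals tend to the flux
  -- by dominated convergence, because χ = 1 on the curve.
  set G : ℝ → ℝ := fun ε => ∫ s in (0 : ℝ)..1,
    (χ (normalPush c s ε) * conjGrad V (normalPush c s ε) * pushTangent c s ε).im
  have hKG : ∀ᶠ ε in 𝓝[>] (0 : ℝ), ∫ t in ε..η, K t = G ε := by
    filter_upwards [Ioo_mem_nhdsGT hη] with ε hε
    exact hc.integral_collar_eq hV hχ hε.2.le
      (fun s t ht => hmem s t (hε.1.trans_le ht.1) (ht.2.trans_lt hηδ)) hχ0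
  have hIcc : IntegrableOn K (Icc 0 η) := by
    rw [integrableOn_Icc_iff_integrableOn_Ioo]; exact hKint
  have hlim1 : Tendsto (fun ε => ∫ t in ε..η, K t) (𝓝[>] 0) (𝓝 (∫ t in (0 : ℝ)..η, K t)) := by
    have hcont := intervalIntegral.continuousOn_primitive_interval (a := 0) (b := η) (f := K)
      (μ := volume) (by rwa [uIcc_of_le hη.le])
    rw [uIcc_of_le hη.le] at hcont
    have h0 := (hcont 0 (left_mem_Icc.2 hη.le)).tendsto
    simp only [intervalIntegral.integral_same] at h0
    have h1 : Tendsto (fun ε => (∫ t in (0 : ℝ)..η, K t) - ∫ t in (0 : ℝ)..ε, K t) (𝓝[>] 0)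
        (𝓝 ((∫ t in (0 : ℝ)..η, K t) - 0)) :=
      (tendsto_const_nhds.sub h0).mono_left (by
        rw [← nhdsWithin_Ioo_eq_nhdsGT hη]
        exact nhdsWithin_mono _ Ioo_subset_Icc_self)
    rw [sub_zero] at h1
    refine h1.congr' ?_
    filter_upwards [Ioo_mem_nhdsGT hη] with ε hε
    have i1 : IntervalIntegrable K volume 0 η :=
      (intervalIntegrable_iff_integrableOn_Icc_of_le hη.le).2 hIcc
    have i2 : IntervalIntegrable K volume 0 ε :=
      (intervalIntegrable_iff_integrableOn_Icc_of_le hε.1.le).2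
        (hIcc.mono_set (Icc_subset_Icc_right hε.2.le))
    exact intervalIntegral.integral_interval_sub_left i1 i2
  have hlim2 : Tendsto G (𝓝[>] 0) (𝓝 0) := by
    suffices Tendsto G (𝓝[>] 0) (𝓝 (∫ s in (0 : ℝ)..1, (w s * deriv c s).im)) by
      rwa [hflux] at this
    obtain ⟨M1, hM1⟩ : ∃ C, ∀ x, ‖χ x‖ ≤ C := hχ.continuous.bounded_above_of_compact_support hχc
    obtain ⟨M2, hM2⟩ := (isCompact_Icc.prod isCompact_Icc).exists_bound_of_continuousOn
      (s := Icc (0 : ℝ) 1 ×ˢ Icc (0 : ℝ) η) hc.continuous_pushTangent.continuousOn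
    refine intervalIntegral.tendsto_integral_filter_of_dominated_convergence
      (fun _ => M1 * (2 * B) * M2) ?_ ?_ intervalIntegrable_const ?_
    · filter_upwards [Ioo_mem_nhdsGT hη] with ε hε
      have hpc : Continuous fun s : ℝ => normalPush c s ε :=
        hc.continuous_normalPush.comp (by fun_prop : Continuous fun s : ℝ => (s, ε))
      have hgc : Continuous fun s : ℝ => conjGrad V (normalPush c s ε) := by
        rw [← continuousOn_univ]
        exact (ContinuousOn.comp (t := D) (fun x hx =>
          (HarmonicAt.analyticAt_complex_partial (hV x hx)).continuousAt.continuousWithinAt)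
          hpc.continuousOn fun s _ => hmem s ε hε.1 (hε.2.trans hηδ))
      have htc : Continuous fun s : ℝ => pushTangent c s ε :=
        hc.continuous_pushTangent.comp (by fun_prop : Continuous fun s : ℝ => (s, ε))
      exact (Complex.continuous_im.comp (((Complex.continuous_ofReal.comp
        (hχ.continuous.comp hpc)).mul hgc).mul htc)).aestronglyMeasurable
    · filter_upwards [Ioo_mem_nhdsGT hη] with ε hε
      refine Eventually.of_forall fun s hs => ?_
      rw [uIoc_of_le zero_le_one] at hs
      refine (Complex.abs_im_le_norm _).trans ?_
      rw [norm_mul, norm_mul, Complex.norm_real]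
      have hm := hmem s ε hε.1 (hε.2.trans hηδ)
      have hB0 : 0 ≤ B := (norm_nonneg _).trans (hB _ hm)
      have hM10 : 0 ≤ M1 := (norm_nonneg _).trans (hM1 0)
      have h2 := hM2 (s, ε) ⟨Ioc_subset_Icc_self hs, Ioo_subset_Icc_self hε⟩
      have h3 : ‖conjGrad V (normalPush c s ε)‖ ≤ 2 * B :=
        (norm_conjGrad_le _ _).trans (mul_le_mul_of_nonneg_left (hB _ hm) zero_le_two)
      exact mul_le_mul (mul_le_mul (hM1 _) h3 (norm_nonneg _) hM10) h2 (norm_nonneg _)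
        (by positivity)
    · refine Eventually.of_forall fun s _ => ?_
      have hp : Tendsto (fun ε => normalPush c s ε) (𝓝[>] 0) (𝓝 (c s)) := by
        have : Continuous fun ε : ℝ => normalPush c s ε :=
          hc.continuous_normalPush.comp (by fun_prop : Continuous fun ε : ℝ => (s, ε))
        have h := this.tendsto 0
        simp only [normalPush, Complex.ofReal_zero, zero_mul, add_zero] at h
        exact h.mono_left nhdsWithin_le_nhds
      have ht : Tendsto (fun ε => pushTangent c s ε) (𝓝[>] 0) (𝓝 (deriv c s)) := by
        have : Continuous fun ε : ℝ => pushTangent c s ε :=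
          hc.continuous_pushTangent.comp (by fun_prop : Continuous fun ε : ℝ => (s, ε))
        have h := this.tendsto 0
        simp only [pushTangent, Complex.ofReal_zero, zero_mul, add_zero] at h
        exact h.mono_left nhdsWithin_le_nhds
      have hp' : Tendsto (fun ε => normalPush c s ε) (𝓝[>] 0) (𝓝[D] (c s)) := by
        refine tendsto_nhdsWithin_iff.2 ⟨hp, ?_⟩
        filter_upwards [Ioo_mem_nhdsGT hδ] with ε hε using hmem s ε hε.1 hε.2
      have hx : Tendsto (fun ε => (χ (normalPush c s ε) : ℂ)) (𝓝[>] 0) (𝓝 1) := by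
        have := (Complex.continuous_ofReal.tendsto _).comp
          ((hχ.continuous.tendsto (c s)).comp hp)
        rw [hχ1 s, Complex.ofReal_one] at this
        exact this
      have := (Complex.continuous_im.tendsto _).comp ((hx.mul ((hw s).comp hp')).mul ht)
      rw [one_mul] at this
      exact this
  exact tendsto_nhds_unique (hlim1.congr' hKG) hlim2

end IsRegularLoop

/-! ### Cutoff functions around a boundary curve -/

namespace IsRegularLoop

variable {c : ℝ → ℂ}

lemma deriv_comp_neg_apply (c : ℝ → ℂ) (s : ℝ) : deriv (fun r => c (-r)) s = -deriv c (-s) :=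
  deriv_comp_neg c s

/-- Reversing the parametrization exchanges the two sides, so results about the left half of a tube
also serve for the right half. -/
lemma reverse (hc : IsRegularLoop c) : IsRegularLoop fun s => c (-s) := by
  refine ⟨hc.contDiff.comp contDiff_neg, fun s => ?_, fun s s' h => ?_, fun s => ?_⟩
  · have := hc.periodic (-(s + 1))
    simp only [neg_add_rev, neg_add_cancel_comm] at this ⊢
    rw [← this]
  · obtain ⟨n, hn⟩ := hc.injective _ _ h
    exact ⟨-n, by push_cast; linarith⟩
  · rw [deriv_comp_neg_apply]
    exact neg_ne_zero.2 (hc.regular _)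

lemma normalPush_reverse (s t : ℝ) :
    normalPush (fun s => c (-s)) s t = normalPush c (-s) (-t) := by
  simp [normalPush, deriv_comp_neg_apply]

lemma tube_reverse (z : ℂ) : tube (fun s => c (-s)) z = tube c (-z) := by
  simp [tube, normalPush_reverse]

lemma tubeJac_reverse (s t : ℝ) : tubeJac (fun s => c (-s)) s t = tubeJac c (-s) (-t) := by
  have h : deriv (deriv fun s => c (-s)) s = deriv (deriv c) (-s) := by
    have : (deriv fun s => c (-s)) = fun s => -deriv c (-s) := funext (deriv_comp_neg_apply c)
    rw [this, deriv.fun_neg, deriv_comp_neg_apply, neg_neg]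
  simp only [tubeJac, pushTangent, deriv_comp_neg_apply, h]
  simp
  ring

/-- A cutoff function of a boundary curve with the following property: if the flux of the harmonic
gradient `∇V` through the curve vanishes, then `∇χ` is orthogonal to `∇V` in `L²(Ω)`. -/
lemma exists_cutoff (hc : IsRegularLoop c) {Ω O : Set ℂ} (hΩ : IsOpen Ω) (hO : IsOpen O)
    (hcO : range c ⊆ O) (hcΩ : range c ⊆ frontier Ω) (hfr : O ∩ frontier Ω ⊆ range c)
    (hleft : ∀ s, ∀ᶠ ε : ℝ in 𝓝[>] 0, normalPush c s ε ∈ Ω) :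
    ∃ χ : ℂ → ℝ, ContDiff ℝ 2 χ ∧ HasCompactSupport χ ∧ tsupport χ ⊆ O ∧ (∀ s, χ (c s) = 1) ∧
      ∀ (V : ℂ → ℝ) (w : ℂ → ℂ) (B : ℝ), HarmonicOnNhd V (Ω ∩ O) →
        (∀ x ∈ Ω ∩ O, ‖fderiv ℝ V x‖ ≤ B) →
        (∀ s, Tendsto (conjGrad V) (𝓝[Ω] (c s)) (𝓝 (w (c s)))) →
        ∫ s in (0 : ℝ)..1, (w (c s) * deriv c s).im = 0 →
        ∫ x in Ω, gradDot χ V x = 0 := by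
  obtain ⟨δ, hδ, hinj, htube⟩ := hc.exists_tube hO hcO
  set η := δ / 2
  have hη : 0 < η := half_pos hδ
  have hηδ : η < δ := half_lt_self hδ
  have htreal : ∀ s : ℝ, tube c s = c s := fun s => by simp [tube, normalPush]
  have himz : ∀ (z : ℂ) (s : ℝ), |z.im| < δ → tube c z = c s → z.im = 0 := by
    intro z s hz h
    obtain ⟨n, hn⟩ := hinj s z (by simpa using hδ) hz (by rw [htreal, h])
    simp [hn]
  set W := tube c '' {z | |z.im| < η}
  have hWo : IsOpen W :=
    hc.isOpen_image_tube (isOpen_lt Complex.continuous_im.abs continuous_const)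
      fun z hz => (htube z ((mem_ofPred_eq.mp hz).trans hηδ)).2.ne'
  have hcW : range c ⊆ W := by
    rintro _ ⟨s, rfl⟩
    exact ⟨s, by simpa using hη, htreal s⟩
  have hcc : IsClosed (range c) := by
    have : range c = c '' Icc 0 1 := (hc.periodic.image_Icc one_pos 0 |>.symm ▸ by simp)
    rw [this]
    exact (isCompact_Icc.image hc.contDiff.continuous).isClosed
  obtain ⟨χ, hχs, hχr, hχW, hχ1⟩ :=
    exists_contMDiff_support_eq_eq_one_iff (n := 2) (modelWithCornersSelf ℝ ℂ) hWo hcc hcW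
  have hχd : ContDiff ℝ 2 χ := contMDiff_iff_contDiff.1 hχs
  have hWclos : closure W ⊆ tube c '' (Icc (0 : ℝ) 1 ×ℂ Icc (-η) η) := by
    refine closure_minimal ?_ (((isCompact_Icc.reProdIm isCompact_Icc).image
      hc.contDiff_tube.continuous).isClosed)
    rintro _ ⟨z, hz, rfl⟩
    refine ⟨z + ((-⌊z.re⌋ : ℤ) : ℂ), ⟨⟨?_, ?_⟩, ?_⟩, hc.tube_add_int z _⟩
    · simpa using Int.floor_le z.re
    · have := (Int.fract_lt_one z.re).le
      rw [← Int.self_sub_floor] at this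
      simpa [sub_eq_add_neg] using this
    · simpa using abs_le.1 (mem_ofPred_eq.mp hz).le
  have hts : tsupport χ ⊆ tube c '' (Icc (0 : ℝ) 1 ×ℂ Icc (-η) η) := by
    rw [tsupport, hχW]; exact hWclos
  have hχc : HasCompactSupport χ :=
    ((isCompact_Icc.reProdIm isCompact_Icc).image hc.contDiff_tube.continuous).of_isClosed_subset
      (isClosed_tsupport _) hts
  have hχO : tsupport χ ⊆ O := by
    refine hts.trans ?_
    rintro _ ⟨z, hz, rfl⟩
    exact (htube z ((abs_le.2 hz.2).trans_lt hηδ)).1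
  have hχzero : ∀ x, x ∉ W → χ x = 0 := fun x hx => by
    rw [← hχW] at hx; exact Function.notMem_support.1 hx
  have hχbd : ∀ z : ℂ, |z.im| < δ → η ≤ |z.im| → χ (tube c z) = 0 := by
    intro z hz hz'
    apply hχzero
    rintro ⟨z', hz1, hz2⟩
    obtain ⟨n, hn⟩ := hinj z' z ((mem_ofPred_eq.mp hz1).trans hηδ) hz hz2
    rw [hn] at hz'
    simp only [Complex.add_im, Complex.intCast_im, add_zero] at hz'
    exact absurd hz' (not_le.2 hz1)
  have hχone : ∀ s, χ (c s) = 1 := fun s => (hχ1 _).1 ⟨s, rfl⟩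
  refine ⟨χ, hχd, hχc, hχO, hχone, ?_⟩
  intro V w B hV hB hw hflux
  -- the two sides of the curve
  have side : ∀ Q : Set ℂ, Convex ℝ Q → (∀ z ∈ Q, |z.im| < δ ∧ z.im ≠ 0) →
      (tube c '' Q ∩ Ω).Nonempty → tube c '' Q ⊆ Ω := by
    intro Q hQ hQ' hne
    -- The image of Q is connected and, lying in the tube but off the curve, misses the frontier of
    -- Ω. Hence it lies either in Ω or outside the closure.
    refine (hQ.isPreconnected.image _
      hc.contDiff_tube.continuous.continuousOn).subset_left_of_subset_union hΩ
      isClosed_closure.isOpen_compl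
      (disjoint_left.2 fun x hx hx' => hx' (subset_closure hx)) ?_ hne
    rintro _ ⟨z, hz, rfl⟩
    by_cases hcl : tube c z ∈ closure Ω
    · refine Or.inl (by_contra fun h => ?_)
      obtain ⟨s, hs⟩ := hfr ⟨(htube z (hQ' z hz).1).1, by rw [hΩ.frontier_eq]; exact ⟨hcl, h⟩⟩
      exact (hQ' z hz).2 (himz z s (hQ' z hz).1 hs.symm)
    · exact Or.inr hcl
  have hconv : ∀ a b : ℝ, Convex ℝ {z : ℂ | a < z.im ∧ z.im < b} := fun a b =>
    (convex_halfSpace_im_gt a).inter (convex_halfSpace_im_lt b)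
  have hup : tube c '' {z | 0 < z.im ∧ z.im < δ} ⊆ Ω := by
    refine side _ (hconv 0 δ) (fun z hz => ⟨by rw [abs_of_pos hz.1]; exact hz.2, hz.1.ne'⟩) ?_
    obtain ⟨ε, hε1, hε2⟩ := ((hleft 0).and (Ioo_mem_nhdsGT hδ)).exists
    refine ⟨normalPush c 0 ε, ⟨⟨0, ε⟩, hε2, rfl⟩, hε1⟩
  have hmono : ∀ x, 𝓝[Ω ∩ O] x ≤ 𝓝[Ω] x := fun x => nhdsWithin_mono _ inter_subset_left
  have hχd1 : ContDiff ℝ 1 χ := hχd.of_le (by norm_num)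
  have hP : ∫ x in tube c '' {z | 0 < z.im ∧ z.im < η}, gradDot χ V x = 0 := by
    refine hc.setIntegral_halfTube_eq_zero (hΩ.inter hO) hV hχd1 hχc hB hη hηδ hinj
      (fun z hz => (htube z hz).2) (fun s t h1 h2 => ?_) (fun s => ?_) hχone
      (w := fun s => w (c s)) (fun s => (hw s).mono_left (hmono _)) hflux
    · exact ⟨hup ⟨⟨s, t⟩, ⟨h1, h2⟩, rfl⟩,
        (htube ⟨s, t⟩ (by simpa [abs_of_pos h1] using h2)).1⟩
    · exact hχbd ⟨s, η⟩ (by simpa [abs_of_pos hη] using hηδ) (by simp [abs_of_pos hη])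
  -- Ω is not assumed to lie on one side of the curve only, which avoids the Jordan curve theorem.
  -- If the right half of the tube belongs to Ω, it is treated as the left half for the reversed
  -- curve, whose flux also vanishes.
  have hN : tube c '' {z | -η < z.im ∧ z.im < 0} ⊆ Ω →
      ∫ x in tube c '' {z | -η < z.im ∧ z.im < 0}, gradDot χ V x = 0 := by
    intro hNΩ
    have hdown : tube c '' {z | -δ < z.im ∧ z.im < 0} ⊆ Ω := by
      refine side _ (hconv _ _) (fun z hz => ⟨by rw [abs_of_neg hz.2]; linarith [hz.1], hz.2.ne⟩) ?_
      have hz : (⟨0, -(η / 2)⟩ : ℂ) ∈ {z : ℂ | -η < z.im ∧ z.im < 0} := by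
        constructor <;> simp <;> linarith
      exact ⟨_, ⟨_, ⟨by linarith [hz.1], hz.2⟩, rfl⟩, hNΩ ⟨_, hz, rfl⟩⟩
    have himg : tube c '' {z | -η < z.im ∧ z.im < 0}
        = tube (fun s => c (-s)) '' {z | 0 < z.im ∧ z.im < η} := by
      ext x
      constructor
      · rintro ⟨z, hz, rfl⟩
        refine ⟨-z, ⟨by simpa using hz.2, by simpa using neg_lt.1 hz.1⟩, ?_⟩
        rw [tube_reverse, neg_neg]
      · rintro ⟨z, hz, rfl⟩
        exact ⟨-z, ⟨by simpa using hz.2, by simpa using hz.1⟩, (tube_reverse z).symm⟩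
    rw [himg]
    refine hc.reverse.setIntegral_halfTube_eq_zero (hΩ.inter hO) hV hχd1 hχc hB hη hηδ
      (fun z z' hz hz' h => ?_) (fun z hz => ?_) (fun s t h1 h2 => ?_) (fun s => ?_)
      (fun s => hχone _) (w := fun s => w (c (-s))) (fun s => (hw (-s)).mono_left (hmono _)) ?_
    · rw [tube_reverse, tube_reverse] at h
      obtain ⟨n, hn⟩ := hinj _ _ (by simpa using hz) (by simpa using hz') h
      exact ⟨-n, by push_cast; linear_combination -hn⟩
    · rw [tubeJac_reverse]
      simpa using (htube (-z) (by simpa using hz)).2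
    · rw [normalPush_reverse]
      exact ⟨hdown ⟨⟨-s, -t⟩, ⟨by simpa using h2, by simpa using h1⟩, rfl⟩,
        (htube ⟨-s, -t⟩ (by simpa [abs_of_pos h1] using h2)).1⟩
    · rw [normalPush_reverse]
      exact hχbd ⟨-s, -η⟩ (by simpa [abs_of_pos hη] using hηδ) (by simp [abs_of_pos hη])
    · simp_rw [deriv_comp_neg_apply, mul_neg, Complex.neg_im]
      rw [intervalIntegral.integral_neg,
        intervalIntegral.integral_comp_neg fun s => (w (c s) * deriv c s).im]
      have hper : Function.Periodic (fun s => (w (c s) * deriv c s).im) 1 := fun s => by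
        simp only [hc.periodic s, periodic_deriv hc.periodic s]
      have := hper.intervalIntegral_add_eq (-1) 0
      simp only [neg_add_cancel, zero_add] at this
      rw [neg_zero, this, hflux, neg_zero]
  have hVc : ContDiffOn ℝ 1 V (Ω ∩ O) := fun x hx =>
    ((hV x hx).1.of_le (by norm_num)).contDiffWithinAt
  obtain ⟨C, hC⟩ : ∃ C, ∀ x, ‖fderiv ℝ χ x‖ ≤ C :=
    (hχd.continuous_fderiv two_ne_zero).bounded_above_of_compact_support (hχc.fderiv ℝ)
  have hWΩ : ∀ x, x ∉ W → gradDot χ V x = 0 := by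
    intro x hx
    have : fderiv ℝ χ x = 0 := by
      -- The cutoff takes values in [0, 1], so it attains its minimum wherever it is 0, boundary
      -- points of W included.
      refine IsLocalMin.fderiv_eq_zero (Eventually.of_forall fun y => ?_)
      rw [hχzero x hx]; exact (hχr ⟨y, rfl⟩).1
    simp [gradDot, this]
  have hWO : W ⊆ O := by
    rintro _ ⟨z, hz, rfl⟩; exact (htube z ((mem_ofPred_eq.mp hz).trans hηδ)).1
  have hWfin : volume W < ⊤ := by
    refine (measure_mono (subset_closure.trans hWclos)).trans_lt ?_
    exact ((isCompact_Icc.reProdIm isCompact_Icc).image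
      hc.contDiff_tube.continuous).measure_lt_top
  have hstrip : ∀ a b : ℝ, -η ≤ a → b ≤ η → IsOpen (tube c '' {z | a < z.im ∧ z.im < b}) := by
    intro a b ha hb
    refine hc.isOpen_image_tube ((isOpen_lt continuous_const Complex.continuous_im).inter
      (isOpen_lt Complex.continuous_im continuous_const)) fun z hz => (htube z ?_).2.ne'
    have hz' : |z.im| < η := abs_lt.2 ⟨lt_of_le_of_lt ha hz.1, lt_of_lt_of_le hz.2 hb⟩
    exact hz'.trans hηδ
  have hPo := hstrip 0 η (by linarith) le_rfl
  have hNo := hstrip (-η) 0 le_rfl hη.le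
  set P := tube c '' {z | 0 < z.im ∧ z.im < η}
  set N := tube c '' {z | -η < z.im ∧ z.im < 0}
  have hPΩ : P ⊆ Ω := by
    rintro _ ⟨z, hz, rfl⟩
    exact hup ⟨z, ⟨hz.1, hz.2.trans hηδ⟩, rfl⟩
  have hPW : P ⊆ W := image_mono fun z hz => by
    rw [mem_ofPred_eq, abs_of_pos hz.1]; exact hz.2
  have hNW : N ⊆ W := image_mono fun z hz => by
    rw [mem_ofPred_eq, abs_of_neg hz.2]; linarith [hz.1]
  have hint : IntegrableOn (gradDot χ V) (Ω ∩ W) := by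
    refine IntegrableOn.of_bound (C := 2 * (C * B))
      ((measure_mono inter_subset_right).trans_lt hWfin) ?_ ?_
    · exact ((hχd1.contDiffOn.continuousOn_gradDot (hΩ.inter hO) hVc).mono
        (inter_subset_inter_right _ hWO)).aestronglyMeasurable (hΩ.inter hWo).measurableSet
    · exact (ae_restrict_iff' (hΩ.inter hWo).measurableSet).2 (Eventually.of_forall fun x hx =>
        abs_gradDot_le (hC x) (hB x ⟨hx.1, hWO hx.2⟩))
  have hsplit : Ω ∩ W = P ∪ (N ∩ Ω) := by
    ext x
    constructor
    · rintro ⟨hxΩ, z, hz, rfl⟩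
      have hz' := abs_lt.1 (mem_ofPred_eq.mp hz)
      rcases lt_trichotomy z.im 0 with h | h | h
      · exact Or.inr ⟨⟨z, ⟨hz'.1, h⟩, rfl⟩, hxΩ⟩
      · have h1 : tube c z = c z.re := by simp [tube, normalPush, h]
        have h2 : tube c z ∈ frontier Ω := hcΩ (h1 ▸ mem_range_self _)
        exact absurd hxΩ (disjoint_left.1 (disjoint_frontier_iff_isOpen.2 hΩ).symm · |>.elim h2)
      · exact Or.inl ⟨z, ⟨h, hz'.2⟩, rfl⟩
    · rintro (h | h)
      · exact ⟨hPΩ h, hPW h⟩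
      · exact ⟨h.2, hNW h.1⟩
  have hdisj : Disjoint P (N ∩ Ω) := by
    rw [disjoint_left]
    rintro _ ⟨z, hz, rfl⟩ ⟨⟨z', hz', h⟩, -⟩
    obtain ⟨n, hn⟩ := hinj z z' (by rw [abs_of_pos hz.1]; exact hz.2.trans hηδ)
      (by rw [abs_of_neg hz'.2]; linarith [hz'.1]) h.symm
    have : z'.im = z.im := by simp [hn]
    linarith [hz.1, hz'.2]
  have hΩW : ∫ x in Ω ∩ W, gradDot χ V x = ∫ x in Ω, gradDot χ V x := by
    refine (setIntegral_eq_of_subset_of_forall_sdiff_eq_zero hΩ.measurableSet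
      inter_subset_left ?_).symm
    rintro x ⟨h1, h2⟩
    exact hWΩ x fun h => h2 ⟨h1, h⟩
  rw [← hΩW, hsplit]
  rw [hsplit] at hint
  rw [setIntegral_union hdisj (hNo.inter hΩ).measurableSet (hint.mono_set subset_union_left)
    (hint.mono_set subset_union_right), hP, zero_add]
  by_cases hne : (N ∩ Ω).Nonempty
  · have hNΩ : N ⊆ Ω := side _ (hconv _ _) (fun z hz =>
      ⟨by rw [abs_of_neg hz.2]; linarith [hz.1], hz.2.ne⟩) hne
    rw [inter_eq_self_of_subset_left hNΩ]
    exact hN hNΩ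
  · rw [not_nonempty_iff_eq_empty.1 hne, setIntegral_empty]

end IsRegularLoop

/-! ### A smoothed logarithmic potential -/

/-- In the variable s = ‖x - a‖², the Laplacian of m(s) is 4 (m' + s m''). Keeping it as an exact
derivative makes the total mass computable by the fundamental theorem of calculus. -/
lemma laplacian_radial {m : ℝ → ℝ} (hm : ContDiff ℝ 2 m) (a x : ℂ) :
    Δ (fun x => m (‖x - a‖ ^ 2)) x = 4 * deriv (fun s => s * deriv m s) (‖x - a‖ ^ 2) := by
  have hN : ∀ x : ℂ, ‖x - a‖ ^ 2 = (x.re - a.re) ^ 2 + (x.im - a.im) ^ 2 := fun x => by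
    rw [← Complex.normSq_eq_norm_sq, Complex.normSq_apply]; simp; ring
  have hNd : ∀ x : ℂ, HasFDerivAt (fun x : ℂ => ‖x - a‖ ^ 2)
      ((2 * (x.re - a.re)) • Complex.reCLM + (2 * (x.im - a.im)) • Complex.imCLM) x := by
    intro x
    simp_rw [hN]
    refine ((((Complex.reCLM.hasFDerivAt (x := x)).sub_const a.re).pow 2).add
      (((Complex.imCLM.hasFDerivAt (x := x)).sub_const a.im).pow 2)).congr_fderiv ?_
    ext v
    simp
  have hm1 : ContDiff ℝ 1 (deriv m) :=
    (contDiff_succ_iff_deriv (n := 1)).1 (by rw [one_add_one_eq_two]; exact hm) |>.2.2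
  have hmd : ∀ s, HasDerivAt m (deriv m s) s := fun s =>
    (hm.differentiable two_ne_zero s).hasDerivAt
  have hmdd : ∀ s, HasDerivAt (deriv m) (deriv (deriv m) s) s := fun s =>
    (hm1.differentiable one_ne_zero s).hasDerivAt
  have hMc : ContDiff ℝ 2 fun x : ℂ => m (‖x - a‖ ^ 2) :=
    hm.comp ((contDiff_norm_sq ℝ).comp (contDiff_id.sub contDiff_const))
  have hfd : ∀ y : ℂ, HasFDerivAt (fun x => m (‖x - a‖ ^ 2)) (deriv m (‖y - a‖ ^ 2) •
      ((2 * (y.re - a.re)) • Complex.reCLM + (2 * (y.im - a.im)) • Complex.imCLM)) y := fun y =>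
    (hmd _).comp_hasFDerivAt y (hNd y)
  have hdd : ∀ y : ℂ, HasFDerivAt (fun x => deriv m (‖x - a‖ ^ 2)) (deriv (deriv m) (‖y - a‖ ^ 2) •
      ((2 * (y.re - a.re)) • Complex.reCLM + (2 * (y.im - a.im)) • Complex.imCLM)) y := fun y =>
    (hmdd _).comp_hasFDerivAt y (hNd y)
  have h1 : (fun y => fderiv ℝ (fun x => m (‖x - a‖ ^ 2)) y 1)
      = fun y => deriv m (‖y - a‖ ^ 2) * (2 * (y.re - a.re)) := by
    ext y; rw [(hfd y).fderiv]; simp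
  have h2 : (fun y => fderiv ℝ (fun x => m (‖x - a‖ ^ 2)) y Complex.I)
      = fun y => deriv m (‖y - a‖ ^ 2) * (2 * (y.im - a.im)) := by
    ext y; rw [(hfd y).fderiv]; simp
  rw [laplacian_eq_fderiv_fderiv hMc.contDiffAt, h1, h2]
  have e1 := ((hdd x).fun_mul (((Complex.reCLM.hasFDerivAt (x := x)).sub_const a.re).const_mul 2)).fderiv
  have e2 := ((hdd x).fun_mul (((Complex.imCLM.hasFDerivAt (x := x)).sub_const a.im).const_mul 2)).fderiv
  have e3 : deriv (fun s => s * deriv m s) (‖x - a‖ ^ 2)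
      = deriv m (‖x - a‖ ^ 2) + ‖x - a‖ ^ 2 * deriv (deriv m) (‖x - a‖ ^ 2) := by
    have := ((hasDerivAt_id' (‖x - a‖ ^ 2)).fun_mul (hmdd _)).deriv
    rw [this, one_mul]
  simp only [Complex.reCLM_apply, Complex.imCLM_apply] at e1 e2
  rw [e1, e2, e3]
  generalize deriv m (‖x - a‖ ^ 2) = A
  generalize deriv (deriv m) (‖x - a‖ ^ 2) = B
  simp [hN]
  ring

/-- A smooth function of `s` that equals `(1 / 4π) log s` for `s ≥ ρ² / 2`. -/
def softLog (ρ s : ℝ) : ℝ :=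
  Real.smoothTransition (4 * s / ρ ^ 2 - 1) * (1 / (4 * Real.pi) * Real.log s)

lemma softLog_of_le {ρ s : ℝ} (hρ : 0 < ρ) (hs : ρ ^ 2 / 2 ≤ s) :
    softLog ρ s = 1 / (4 * Real.pi) * Real.log s := by
  rw [softLog, Real.smoothTransition.one_of_one_le, one_mul]
  rw [le_sub_iff_add_le, le_div_iff₀ (by positivity)]
  linarith

lemma contDiff_softLog {ρ : ℝ} (hρ : 0 < ρ) : ContDiff ℝ 2 (softLog ρ) := by
  refine contDiff_iff_contDiffAt.2 fun s => ?_
  by_cases hs : s < ρ ^ 2 / 4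
  · refine contDiffAt_const (c := (0 : ℝ)) |>.congr_of_eventuallyEq ?_
    filter_upwards [Iio_mem_nhds hs] with r hr
    rw [softLog, Real.smoothTransition.zero_of_nonpos, zero_mul]
    rw [sub_nonpos, div_le_one (by positivity)]
    linarith [mem_Iio.1 hr]
  · have hs0 : s ≠ 0 := by
      have : 0 < ρ ^ 2 := by positivity
      intro h; apply hs; rw [h]; positivity
    refine ContDiffAt.mul ?_ (contDiffAt_const.mul (Real.contDiffAt_log.2 hs0))
    refine Real.smoothTransition.contDiff.contDiffAt.comp s ?_
    exact (((contDiff_const.mul contDiff_id).div_const _).sub contDiff_const).contDiffAt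

/-- The density `Δ (softLog ρ ‖x‖²)` as a function of `‖x‖`. -/
def smearedMass (ρ r : ℝ) : ℝ := 4 * deriv (fun s => s * deriv (softLog ρ) s) (r ^ 2)

lemma hasDerivAt_softLog_of_lt {ρ s : ℝ} (hρ : 0 < ρ) (hs : ρ ^ 2 / 2 < s) :
    s * deriv (softLog ρ) s = 1 / (4 * Real.pi) := by
  have hs0 : s ≠ 0 := by
    have : 0 < ρ ^ 2 := by positivity
    linarith
  have : softLog ρ =ᶠ[𝓝 s] fun s => 1 / (4 * Real.pi) * Real.log s := by
    filter_upwards [Ioi_mem_nhds hs] with r hr using softLog_of_le hρ (le_of_lt hr)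
  rw [this.deriv_eq, deriv_const_mul _ (Real.differentiableAt_log hs0), Real.deriv_log]
  have := Real.pi_pos
  field_simp

lemma smearedMass_eq_zero {ρ r : ℝ} (hρ : 0 < ρ) (hr : ρ ≤ r) : smearedMass ρ r = 0 := by
  have hr2 : ρ ^ 2 / 2 < r ^ 2 := by
    have : ρ ^ 2 ≤ r ^ 2 := pow_le_pow_left₀ hρ.le hr 2
    have : 0 < ρ ^ 2 := by positivity
    linarith
  have : (fun s => s * deriv (softLog ρ) s) =ᶠ[𝓝 (r ^ 2)] fun _ => 1 / (4 * Real.pi) := by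
    filter_upwards [Ioi_mem_nhds hr2] with s hs using hasDerivAt_softLog_of_lt hρ hs
  rw [smearedMass, this.deriv_eq, deriv_const, mul_zero]

lemma contDiff_mul_deriv_softLog {ρ : ℝ} (hρ : 0 < ρ) :
    ContDiff ℝ 1 fun s => s * deriv (softLog ρ) s := by
  have : ContDiff ℝ 1 (deriv (softLog ρ)) :=
    (contDiff_succ_iff_deriv (n := 1)).1
      (by rw [one_add_one_eq_two]; exact contDiff_softLog hρ) |>.2.2
  exact contDiff_id.mul this

lemma continuous_smearedMass {ρ : ℝ} (hρ : 0 < ρ) : Continuous (smearedMass ρ) :=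
  continuous_const.mul
    (((contDiff_mul_deriv_softLog hρ).continuous_deriv le_rfl).comp (continuous_pow 2))

/-- The integrand is the derivative of 2 r² m'(r²), with m = `softLog ρ`. This is 0 at r = 0 and 2 /
(4π) at r = ρ, so the smeared mass is 1 after integration over the angle. -/
lemma integral_mul_smearedMass {ρ : ℝ} (hρ : 0 < ρ) :
    ∫ r in (0 : ℝ)..ρ, r * smearedMass ρ r = 1 / (2 * Real.pi) := by
  have hd : ∀ r ∈ uIcc 0 ρ, HasDerivAt
      (fun r => 2 * ((r ^ 2) * deriv (softLog ρ) (r ^ 2))) (r * smearedMass ρ r) r := by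
    intro r _
    have h1 := ((contDiff_mul_deriv_softLog hρ).differentiable one_ne_zero (r ^ 2)).hasDerivAt
    have h2 := hasDerivAt_pow 2 r
    refine ((h1.comp_of_eq r h2 rfl).const_mul 2).congr_deriv ?_
    simp only [smearedMass]
    push_cast; ring
  rw [intervalIntegral.integral_eq_sub_of_hasDerivAt hd
    ((continuous_id.mul (continuous_smearedMass hρ)).intervalIntegrable _ _),
    hasDerivAt_softLog_of_lt hρ (half_lt_self (by positivity))]
  have := Real.pi_pos
  simp only [ne_eq, OfNat.ofNat_ne_zero, not_false_eq_true, zero_pow, zero_mul, mul_zero, sub_zero]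
  field_simp
  norm_num

lemma integral_circle_eq {v : ℂ → ℝ} {a : ℂ} {r : ℝ} (hr : 0 ≤ r)
    (hv : HarmonicOnNhd v (Metric.closedBall a r)) :
    ∫ θ in Ioo (-Real.pi) Real.pi, v (circleMap a r θ) = 2 * Real.pi * v a := by
  have h := InnerProductSpace.HarmonicOnNhd.circleAverage_eq (f := v) (c := a) (R := r) (by rwa [abs_of_nonneg hr])
  rw [Real.circleAverage_def, smul_eq_mul] at h
  have hper : Function.Periodic (fun θ => v (circleMap a r θ)) (2 * Real.pi) := fun θ => by
    simp [periodic_circleMap a r θ]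
  have h2 := hper.intervalIntegral_add_eq (-Real.pi) 0
  rw [zero_add, show -Real.pi + 2 * Real.pi = Real.pi by ring] at h2
  rw [← integral_Ioc_eq_integral_Ioo, ← intervalIntegral.integral_of_le (by linarith [Real.pi_pos]),
    h2, ← h]
  have := Real.pi_pos
  field_simp

/-- The mean value property with respect to the smeared unit mass. -/
lemma integral_mul_smearedMass_eq {v : ℂ → ℝ} {a : ℂ} {ρ : ℝ} (hρ : 0 < ρ)
    (hv : HarmonicOnNhd v (Metric.closedBall a ρ)) :
    ∫ x, v x * smearedMass ρ ‖x - a‖ = v a := by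
  have hsub : ∀ p : ℝ × ℝ, (Complex.polarCoord.symm p : ℂ) + a = circleMap a p.1 p.2 := by
    intro p
    rw [Complex.polarCoord_symm_apply, circleMap, Complex.exp_mul_I]
    push_cast; ring
  have hpc := continuous_smearedMass hρ
  have hvc : ContinuousOn v (Metric.closedBall a ρ) := fun x hx =>
    (hv x hx).1.continuousAt.continuousWithinAt
  set F : ℝ × ℝ → ℝ := fun p => p.1 * (v (circleMap a p.1 p.2) * smearedMass ρ p.1)
  have e1 : ∫ x, v x * smearedMass ρ ‖x - a‖ = ∫ p in polarCoord.target, F p := by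
    rw [← integral_add_right_eq_self (fun x => v x * smearedMass ρ ‖x - a‖) a,
      ← Complex.integral_comp_polarCoord_symm]
    refine setIntegral_congr_fun polarCoord.open_target.measurableSet fun p hp => ?_
    have hp1 : 0 < p.1 := by
      rw [polarCoord_target] at hp; exact hp.1
    have : ‖(Complex.polarCoord.symm p : ℂ)‖ = p.1 := by
      rw [Complex.norm_polarCoord_symm, abs_of_pos hp1]
    simp only [F, ← hsub, add_sub_cancel_right, this, smul_eq_mul]
  have hcm : Continuous fun p : ℝ × ℝ => circleMap a p.1 p.2 := by
    unfold circleMap; fun_prop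
  have hmem : ∀ p : ℝ × ℝ, 0 ≤ p.1 → p.1 ≤ ρ → circleMap a p.1 p.2 ∈ Metric.closedBall a ρ := by
    intro p h0 h1
    exact Metric.closedBall_subset_closedBall h1 (circleMap_mem_closedBall a h0 p.2)
  have hFc : ContinuousOn F (Icc 0 ρ ×ˢ univ) := by
    refine continuousOn_fst.mul ((hvc.comp hcm.continuousOn fun p hp => hmem p hp.1.1 hp.1.2).mul
      (hpc.comp continuous_fst).continuousOn)
  have e2 : ∫ p in polarCoord.target, F p
      = ∫ p in Ioc 0 ρ ×ˢ Ioo (-Real.pi) Real.pi, F p := by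
    refine setIntegral_eq_of_subset_of_forall_sdiff_eq_zero polarCoord.open_target.measurableSet
      ?_ ?_
    · rw [polarCoord_target]; exact prod_mono Ioc_subset_Ioi_self subset_rfl
    · rintro p ⟨hp, hp'⟩
      rw [polarCoord_target] at hp
      have : ρ ≤ p.1 := by
        by_contra h
        exact hp' ⟨⟨hp.1, (not_le.1 h).le⟩, hp.2⟩
      simp [F, smearedMass_eq_zero hρ this]
  have hint : IntegrableOn F (Ioc 0 ρ ×ˢ Ioo (-Real.pi) Real.pi) :=
    ((hFc.mono (prod_mono subset_rfl (subset_univ _))).integrableOn_compact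
      (isCompact_Icc.prod (isCompact_Icc (a := -Real.pi) (b := Real.pi)))).mono_set
      (prod_mono Ioc_subset_Icc_self Ioo_subset_Icc_self)
  rw [e1, e2, Measure.volume_eq_prod, setIntegral_prod F hint]
  have e3 : ∀ r ∈ Ioc 0 ρ, ∫ θ in Ioo (-Real.pi) Real.pi, F (r, θ)
      = (2 * Real.pi * v a) * (r * smearedMass ρ r) := by
    intro r hr
    rw [← integral_circle_eq hr.1.le fun x hx => hv x (Metric.closedBall_subset_closedBall hr.2 hx),
      ← integral_mul_const]
    refine integral_congr_ae (Eventually.of_forall fun θ => ?_)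
    simp only [F]; ring
  rw [setIntegral_congr_fun measurableSet_Ioc e3, integral_const_mul,
    ← intervalIntegral.integral_of_le hρ.le, integral_mul_smearedMass hρ]
  have := Real.pi_pos
  field_simp

/-! ### Symmetry and sign of the hydrodynamic Green function -/

lemma inner_gradient (f : ℂ → ℝ) (x v : ℂ) : inner ℝ (gradient f x) v = fderiv ℝ f x v := by
  rw [gradient, InnerProductSpace.toDual_symm_apply]

lemma norm_gradient (f : ℂ → ℝ) (x : ℂ) : ‖gradient f x‖ = ‖fderiv ℝ f x‖ := by
  rw [gradient, LinearIsometryEquiv.norm_map]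

lemma conjGrad_eq_conj_gradient (f : ℂ → ℝ) (x : ℂ) :
    conjGrad f x = (starRingEnd ℂ) (gradient f x) := by
  have h1 := inner_gradient f x 1
  have h2 := inner_gradient f x Complex.I
  rw [Complex.inner] at h1 h2
  simp only [Complex.conj_re, Complex.mul_re, Complex.I_re, Complex.conj_im, Complex.I_im] at h1 h2
  rw [conjGrad, ← h1, ← h2]
  apply Complex.ext <;> simp

/-- Compactness of the closure. It serves for gradients, which are controlled near a boundary point
only through limits from inside. -/
lemma exists_bound_of_eventually {Ω : Set ℂ} (hb : Bornology.IsBounded Ω) {f : ℂ → ℝ}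
    (h : ∀ p ∈ closure Ω, ∃ C, ∀ᶠ x in 𝓝[Ω] p, f x ≤ C) : ∃ C, ∀ x ∈ Ω, f x ≤ C := by
  have key : ∃ C, ∀ x ∈ closure Ω, x ∈ Ω → f x ≤ C := by
    refine hb.isCompact_closure.induction_on (p := fun s => ∃ C, ∀ x ∈ s, x ∈ Ω → f x ≤ C)
      ⟨0, by simp⟩ (fun s t hst ⟨C, hC⟩ => ⟨C, fun x hx => hC x (hst hx)⟩) ?_ ?_
    · rintro s t ⟨C, hC⟩ ⟨C', hC'⟩
      refine ⟨max C C', ?_⟩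
      rintro x (hx | hx) hxΩ
      · exact (hC x hx hxΩ).trans (le_max_left _ _)
      · exact (hC' x hx hxΩ).trans (le_max_right _ _)
    · intro p hp
      obtain ⟨C, hC⟩ := h p hp
      rw [eventually_nhdsWithin_iff] at hC
      exact ⟨_, mem_nhdsWithin_of_mem_nhds hC, C, fun x hx => hx⟩
  obtain ⟨C, hC⟩ := key
  exact ⟨C, fun x hx => hC x (subset_closure hx) hx⟩

/-- The function `G (·, b)`, with its singularity smoothed inside the disc of radius `ρ`. -/
def smoothedGreen (G : ℂ → ℂ → ℝ) (ρ : ℝ) (b x : ℂ) : ℝ :=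
  regularPart G x b + softLog ρ (‖x - b‖ ^ 2)

lemma smoothedGreen_eq {G : ℂ → ℂ → ℝ} {ρ : ℝ} (hρ : 0 < ρ) {b x : ℂ} (hx : ρ ≤ ‖x - b‖) :
    smoothedGreen G ρ b x = G x b := by
  have h : ρ ^ 2 ≤ ‖x - b‖ ^ 2 := pow_le_pow_left₀ hρ.le hx 2
  have h' : 0 < ρ ^ 2 := by positivity
  rw [smoothedGreen, softLog_of_le hρ (by linarith), regularPart, Real.log_pow]
  have := Real.pi_pos
  push_cast
  field_simp
  ring

lemma smoothedGreen_eventuallyEq {G : ℂ → ℂ → ℝ} {ρ : ℝ} (hρ : 0 < ρ) {b x : ℂ}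
    (hx : ρ < ‖x - b‖) : smoothedGreen G ρ b =ᶠ[𝓝 x] fun x => G x b := by
  have : IsOpen {x : ℂ | ρ < ‖x - b‖} := isOpen_lt continuous_const (by fun_prop)
  filter_upwards [this.mem_nhds hx] with y hy using smoothedGreen_eq hρ (le_of_lt hy)

/-! ### The smoothed Green function up to the boundary, and the symmetry of G -/

section
variable {d : ℕ} {Ω : Set ℂ} {γ : Fin (d + 1) → ℝ → ℂ} {G : ℂ → ℂ → ℝ}

lemma IsC2Domain.isRegularLoop (hΩ : IsC2Domain Ω γ) (i : Fin (d + 1)) : IsRegularLoop (γ i) :=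
  .of_injOn (hΩ.contDiff i) (hΩ.periodic i) (hΩ.injOn i) (hΩ.regular i)

lemma IsC2Domain.isCompact_range (hΩ : IsC2Domain Ω γ) (i : Fin (d + 1)) :
    IsCompact (range (γ i)) := by
  have : range (γ i) = γ i '' Icc 0 1 := by
    have := (hΩ.periodic i).image_Icc one_pos 0
    rw [zero_add] at this; exact this.symm
  rw [this]
  exact isCompact_Icc.image (hΩ.contDiff i).continuous

lemma IsC2Domain.range_subset_frontier (hΩ : IsC2Domain Ω γ) (i : Fin (d + 1)) :
    range (γ i) ⊆ frontier Ω := by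
  rw [hΩ.frontier_eq]; exact subset_iUnion (fun i => range (γ i)) i

lemma IsC2Domain.notMem_of_mem_frontier (hΩ : IsC2Domain Ω γ) {p : ℂ} (hp : p ∈ frontier Ω) :
    p ∉ Ω := by
  rw [hΩ.isOpen.frontier_eq] at hp; exact hp.2

lemma contDiffOn_smoothedGreen (hG : IsHydrodynamicGreen Ω γ G) {ρ : ℝ} (hρ : 0 < ρ) {b : ℂ}
    (hb : b ∈ Ω) : ContDiffOn ℝ 2 (smoothedGreen G ρ b) Ω := by
  intro x hx
  exact ((hG.harmonic b hb x hx).1.add ((contDiff_softLog hρ).contDiffAt.comp x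
    ((contDiff_norm_sq ℝ).comp (contDiff_id.sub contDiff_const)).contDiffAt)).contDiffWithinAt

lemma laplacian_smoothedGreen (hG : IsHydrodynamicGreen Ω γ G) {ρ : ℝ} (hρ : 0 < ρ) {b : ℂ}
    (hb : b ∈ Ω) {x : ℂ} (hx : x ∈ Ω) :
    Δ (smoothedGreen G ρ b) x = smearedMass ρ ‖x - b‖ := by
  have h1 := (hG.harmonic b hb x hx).1
  have h2 : ContDiffAt ℝ 2 (fun x => softLog ρ (‖x - b‖ ^ 2)) x :=
    (contDiff_softLog hρ).contDiffAt.comp x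
      ((contDiff_norm_sq ℝ).comp (contDiff_id.sub contDiff_const)).contDiffAt
  have h3 := h1.laplacian_add h2
  have h4 := (hG.harmonic b hb x hx).2.eq_of_nhds
  have h5 := laplacian_radial (contDiff_softLog hρ) b x
  have h6 : smoothedGreen G ρ b
      = (fun x => regularPart G x b) + fun x => softLog ρ (‖x - b‖ ^ 2) := rfl
  rw [h6, h3, h4, h5]
  simp [smearedMass]

lemma harmonicAt_smoothedGreen (hΩ : IsC2Domain Ω γ) (hG : IsHydrodynamicGreen Ω γ G) {ρ : ℝ}
    (hρ : 0 < ρ) {b : ℂ} (hb : b ∈ Ω) {x : ℂ} (hx : x ∈ Ω) (hxb : ρ < ‖x - b‖) :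
    HarmonicAt (smoothedGreen G ρ b) x := by
  refine ⟨(contDiffOn_smoothedGreen hG hρ hb).contDiffAt (hΩ.isOpen.mem_nhds hx), ?_⟩
  have : IsOpen {x : ℂ | ρ < ‖x - b‖} := isOpen_lt continuous_const (by fun_prop)
  filter_upwards [hΩ.isOpen.mem_nhds hx, this.mem_nhds hxb] with y hy hyb
  rw [laplacian_smoothedGreen hG hρ hb hy, smearedMass_eq_zero hρ (le_of_lt hyb)]
  rfl

lemma harmonicAt_green (hΩ : IsC2Domain Ω γ) (hG : IsHydrodynamicGreen Ω γ G) {b x : ℂ}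
    (hb : b ∈ Ω) (hx : x ∈ Ω) (hxb : x ≠ b) : HarmonicAt (fun x => G x b) x := by
  have h : 0 < ‖x - b‖ := norm_pos_iff.2 (sub_ne_zero.2 hxb)
  exact (harmonicAt_congr_nhds (smoothedGreen_eventuallyEq (half_pos h) (half_lt_self h))).1
    (harmonicAt_smoothedGreen hΩ hG (half_pos h) hb hx (half_lt_self h))

lemma lt_norm_sub_of_mem_frontier (hΩ : IsC2Domain Ω γ) {ρ : ℝ} {b : ℂ}
    (hball : Metric.closedBall b ρ ⊆ Ω) {p : ℂ} (hp : p ∈ frontier Ω) : ρ < ‖p - b‖ := by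
  by_contra h
  exact hΩ.notMem_of_mem_frontier hp (hball (by simpa [dist_eq_norm] using h))

lemma mem_or_mem_frontier {p : ℂ} (hΩ : IsC2Domain Ω γ) (hp : p ∈ closure Ω) :
    p ∈ Ω ∨ p ∈ frontier Ω := by
  by_cases h : p ∈ Ω
  · exact Or.inl h
  · rw [hΩ.isOpen.frontier_eq]; exact Or.inr ⟨hp, h⟩

lemma continuousOn_smoothedGreen (hΩ : IsC2Domain Ω γ) (hG : IsHydrodynamicGreen Ω γ G) {ρ : ℝ}
    (hρ : 0 < ρ) {b : ℂ} (hball : Metric.closedBall b ρ ⊆ Ω) :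
    ContinuousOn (smoothedGreen G ρ b) (closure Ω) := by
  have hb : b ∈ Ω := hball (Metric.mem_closedBall_self hρ.le)
  intro p hp
  rcases mem_or_mem_frontier hΩ hp with h | h
  · exact ((contDiffOn_smoothedGreen hG hρ hb).continuousOn.continuousAt
      (hΩ.isOpen.mem_nhds h)).continuousWithinAt
  · have hpb := lt_norm_sub_of_mem_frontier hΩ hball h
    have hne : p ≠ b := by rintro rfl; exact hΩ.notMem_of_mem_frontier h hb
    have h1 := hG.continuousOn b hb p ⟨hp, hne⟩
    have h2 : ContinuousWithinAt (fun x => G x b) (closure Ω) p := by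
      refine h1.mono_of_mem_nhdsWithin ?_
      exact inter_mem self_mem_nhdsWithin (mem_nhdsWithin_of_mem_nhds
        (isOpen_compl_singleton.mem_nhds hne))
    exact h2.congr_of_eventuallyEq
      ((smoothedGreen_eventuallyEq hρ hpb).filter_mono nhdsWithin_le_nhds)
      (smoothedGreen_eq hρ hpb.le)

lemma exists_bound_fderiv_smoothedGreen (hΩ : IsC2Domain Ω γ) (hG : IsHydrodynamicGreen Ω γ G)
    {ρ : ℝ} (hρ : 0 < ρ) {b : ℂ} (hball : Metric.closedBall b ρ ⊆ Ω) :
    ∃ B, ∀ x ∈ Ω, ‖fderiv ℝ (smoothedGreen G ρ b) x‖ ≤ B := by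
  have hb : b ∈ Ω := hball (Metric.mem_closedBall_self hρ.le)
  refine exists_bound_of_eventually hΩ.isBounded fun p hp => ?_
  rcases mem_or_mem_frontier hΩ hp with h | h
  · have hc : ContinuousAt (fderiv ℝ (smoothedGreen G ρ b)) p :=
      ((contDiffOn_smoothedGreen hG hρ hb).continuousOn_fderiv_of_isOpen hΩ.isOpen
        (by norm_num)).continuousAt (hΩ.isOpen.mem_nhds h)
    refine ⟨‖fderiv ℝ (smoothedGreen G ρ b) p‖ + 1, ?_⟩
    have := hc.norm.eventually_lt_const (lt_add_one _)
    exact (this.filter_mono nhdsWithin_le_nhds).mono fun x hx => hx.le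
  -- Near the boundary the smoothing has no effect, and the gradient of G has a limit.
  · obtain ⟨v, hv⟩ := hG.gradient_limit b hb p h
    refine ⟨‖v‖ + 1, ?_⟩
    have h1 := hv.norm.eventually_lt_const (lt_add_one _)
    have h2 := (smoothedGreen_eventuallyEq (G := G) hρ
      (lt_norm_sub_of_mem_frontier hΩ hball h)).eventuallyEq_nhds.filter_mono
      (nhdsWithin_le_nhds (s := Ω))
    filter_upwards [h1, h2] with x hx hx'
    rw [hx'.fderiv_eq, ← norm_gradient]
    exact hx.le

/-- The boundary values of the conjugate gradient of `u`. -/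
def conjGradBoundary (Ω : Set ℂ) (u : ℂ → ℝ) (p : ℂ) : ℂ :=
  Complex.I * (starRingEnd ℂ) (extendFrom Ω (perpGrad u) p)

lemma tendsto_conjGrad_smoothedGreen (hΩ : IsC2Domain Ω γ) (hG : IsHydrodynamicGreen Ω γ G)
    {ρ : ℝ} (hρ : 0 < ρ) {b : ℂ} (hball : Metric.closedBall b ρ ⊆ Ω) {p : ℂ}
    (hp : p ∈ frontier Ω) :
    Tendsto (conjGrad (smoothedGreen G ρ b)) (𝓝[Ω] p)
      (𝓝 (conjGradBoundary Ω (fun x => G x b) p)) := by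
  have hb : b ∈ Ω := hball (Metric.mem_closedBall_self hρ.le)
  obtain ⟨v, hv⟩ := hG.gradient_limit b hb p hp
  have h1 : Tendsto (perpGrad fun x => G x b) (𝓝[Ω] p) (𝓝 (Complex.I * v)) := hv.const_mul _
  have h2 : conjGradBoundary Ω (fun x => G x b) p = (starRingEnd ℂ) v := by
    rw [conjGradBoundary, extendFrom_eq (frontier_subset_closure hp) h1, map_mul, Complex.conj_I,
      ← mul_assoc, mul_neg, Complex.I_mul_I, neg_neg, one_mul]
  rw [h2]
  have h3 := (Complex.continuous_conj.tendsto v).comp hv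
  refine h3.congr' ?_
  have h4 := (smoothedGreen_eventuallyEq (G := G) hρ
      (lt_norm_sub_of_mem_frontier hΩ hball hp)).eventuallyEq_nhds.filter_mono
      (nhdsWithin_le_nhds (s := Ω))
  filter_upwards [h4] with x hx
  rw [Function.comp_apply, ← conjGrad_eq_conj_gradient, conjGrad, conjGrad, hx.fderiv_eq]

/-- The flux of ∇u through a curve is the circulation of ∇^⊥u along it. In this way the condition on
the circulations becomes the zero flux required by the cutoffs. -/
lemma im_conjGradBoundary_mul (u : ℂ → ℝ) (p a : ℂ) :
    (conjGradBoundary Ω u p * a).im = inner ℝ (extendFrom Ω (perpGrad u) p) a := by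
  rw [conjGradBoundary, Complex.inner]
  simp
  ring

/-- Green's identity for the smoothed Green function, and functions that are constant on every
boundary curve. -/
lemma setIntegral_mul_smearedMass_eq (hΩ : IsC2Domain Ω γ) (hG : IsHydrodynamicGreen Ω γ G)
    {ρ : ℝ} (hρ : 0 < ρ) {b : ℂ} (hball : Metric.closedBall b ρ ⊆ Ω) {U : ℂ → ℝ}
    (hU : ContDiffOn ℝ 1 U Ω) (hUc : ContinuousOn U (closure Ω)) {A : ℝ}
    (hA : ∀ x ∈ Ω, ‖fderiv ℝ U x‖ ≤ A) (hU0 : ∀ x ∈ range (γ 0), U x = 0)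
    (hUl : ∀ l : Fin d, ∃ c, ∀ x ∈ range (γ l.succ), U x = c) :
    ∫ x in Ω, U x * smearedMass ρ ‖x - b‖ = - ∫ x in Ω, gradDot U (smoothedGreen G ρ b) x := by
  classical
  have hb : b ∈ Ω := hball (Metric.mem_closedBall_self hρ.le)
  choose κ hκ using hUl
  set V := smoothedGreen G ρ b
  have hV : ContDiffOn ℝ 2 V Ω := contDiffOn_smoothedGreen hG hρ hb
  have hV1 : ContDiffOn ℝ 1 V Ω := hV.of_le (by norm_num)
  obtain ⟨B, hB⟩ := exists_bound_fderiv_smoothedGreen hΩ hG hρ hball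
  obtain ⟨C, hC⟩ : ∃ C, ∀ x ∈ Ω, |Δ V x| ≤ C := by
    obtain ⟨C, hC⟩ := hΩ.isBounded.isCompact_closure.exists_bound_of_continuousOn
      (f := fun x => smearedMass ρ ‖x - b‖)
      ((continuous_smearedMass hρ).comp (by fun_prop)).continuousOn
    exact ⟨C, fun x hx => by
      rw [laplacian_smoothedGreen hG hρ hb hx]; exact hC x (subset_closure hx)⟩
  -- `O l` stays away from the other boundary curves and from the disc around b, outside which the
  -- smoothed Green function is harmonic.
  let O : Fin d → Set ℂ := fun l =>
    (⋃ k ∈ {k | k ≠ l.succ}, range (γ k))ᶜ ∩ (Metric.closedBall b ρ)ᶜ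
  have hO : ∀ l, IsOpen (O l) := fun l =>
    ((toFinite {k | k ≠ l.succ}).isClosed_biUnion
      fun k _ => (hΩ.isCompact_range k).isClosed).isOpen_compl.inter
      Metric.isClosed_closedBall.isOpen_compl
  have hcO : ∀ l : Fin d, range (γ l.succ) ⊆ O l := by
    intro l p hp
    refine ⟨fun h => ?_, fun h => hΩ.notMem_of_mem_frontier
      (hΩ.range_subset_frontier _ hp) (hball h)⟩
    simp only [mem_iUnion] at h
    obtain ⟨k, hk, hk'⟩ := h
    exact disjoint_left.1 (hΩ.disjoint k l.succ hk) hk' hp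
  have hfr : ∀ l : Fin d, O l ∩ frontier Ω ⊆ range (γ l.succ) := by
    rintro l p ⟨⟨h1, -⟩, h2⟩
    rw [hΩ.frontier_eq] at h2
    obtain ⟨k, hk⟩ := mem_iUnion.1 h2
    by_cases hkl : k = l.succ
    · rwa [hkl] at hk
    · exact absurd (mem_biUnion (x := k) hkl hk) h1
  have hleft : ∀ (l : Fin d) (s : ℝ), ∀ᶠ ε : ℝ in 𝓝[>] 0, normalPush (γ l.succ) s ε ∈ Ω :=
    fun l s => (hΩ.left l.succ s).mono fun ε h => by simpa [normalPush] using h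
  choose χ hχd hχc hχO hχ1 hχV using fun l : Fin d =>
    (hΩ.isRegularLoop l.succ).exists_cutoff hΩ.isOpen (hO l) (hcO l)
      (hΩ.range_subset_frontier _) (hfr l) (hleft l)
  have horth : ∀ l, ∫ x in Ω, gradDot (χ l) V x = 0 := by
    intro l
    refine hχV l V (conjGradBoundary Ω fun x => G x b) B (fun x hx => ?_) (fun x hx => hB x hx.1)
      (fun s => tendsto_conjGrad_smoothedGreen hΩ hG hρ hball
        (hΩ.range_subset_frontier _ ⟨s, rfl⟩)) ?_
    · refine harmonicAt_smoothedGreen hΩ hG hρ hb hx.1 ?_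
      have := hx.2.2
      simpa [dist_eq_norm] using this
    · simp_rw [im_conjGradBoundary_mul]
      exact hG.circulation_inner b hb l
  have hχ1d : ∀ l, ContDiff ℝ 1 (χ l) := fun l => (hχd l).of_le (by norm_num)
  have hχzero : ∀ l, ∀ x, x ∉ O l → χ l x = 0 := fun l x hx =>
    image_eq_zero_of_notMem_tsupport fun h => hx (hχO l h)
  choose D hD using fun l => ((hχd l).continuous_fderiv two_ne_zero).bounded_above_of_compact_support
    ((hχc l).fderiv ℝ)
  -- Subtracting the boundary constants makes the function vanish on the whole frontier. Nothing is
  -- subtracted for the outer curve, so no condition on the flux through it is needed.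
  set U' : ℂ → ℝ := fun x => U x - ∑ l, κ l * χ l x
  have hsum : ContDiff ℝ 1 fun x => ∑ l, κ l * χ l x :=
    ContDiff.sum fun l _ => contDiff_const.mul (hχ1d l)
  have hsumd : ∀ x, fderiv ℝ (fun x => ∑ l, κ l * χ l x) x = ∑ l, κ l • fderiv ℝ (χ l) x := by
    intro x
    rw [fderiv_fun_sum fun l _ => ((hχ1d l).differentiable one_ne_zero x).const_mul _]
    exact Finset.sum_congr rfl fun l _ =>
      fderiv_const_mul ((hχ1d l).differentiable one_ne_zero x) _
  have hUdiff : ∀ x ∈ Ω, DifferentiableAt ℝ U x := fun x hx =>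
    (hU.contDiffAt (hΩ.isOpen.mem_nhds hx)).differentiableAt one_ne_zero
  have hU'd : ∀ x ∈ Ω, fderiv ℝ U' x = fderiv ℝ U x - ∑ l, κ l • fderiv ℝ (χ l) x := by
    intro x hx
    rw [← hsumd]
    exact fderiv_fun_sub (hUdiff x hx) (hsum.differentiable one_ne_zero x)
  have hgrad : ∀ x ∈ Ω, gradDot U' V x = gradDot U V x - ∑ l, κ l * gradDot (χ l) V x := by
    intro x hx
    simp only [gradDot, hU'd x hx, _root_.sub_apply, _root_.sum_apply, _root_.smul_apply,
      smul_eq_mul, sub_mul, Finset.sum_mul, mul_add, Finset.sum_add_distrib]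
    simp only [mul_assoc]
    ring
  have hmain := integral_mul_laplacian_eq hΩ.isOpen hΩ.isBounded (U := U') (V := V)
    (A := A + ∑ l, |κ l| * D l) (B := B) (C := C)
    (hU.sub hsum.contDiffOn) (hUc.sub hsum.continuous.continuousOn) ?_ hV ?_ hB hC
  · have : IsFiniteMeasure (volume.restrict Ω) := ⟨by
      simpa using hΩ.isBounded.measure_lt_top⟩
    have hint : ∀ {W : ℂ → ℝ} {E : ℝ}, ContDiffOn ℝ 1 W Ω → (∀ x ∈ Ω, ‖fderiv ℝ W x‖ ≤ E) →
        IntegrableOn (gradDot W V) Ω := by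
      intro W E hW hE
      refine IntegrableOn.of_bound (C := 2 * (E * B)) hΩ.isBounded.measure_lt_top
        ((hW.continuousOn_gradDot hΩ.isOpen hV1).aestronglyMeasurable hΩ.isOpen.measurableSet) ?_
      exact (ae_restrict_iff' hΩ.isOpen.measurableSet).2 (Eventually.of_forall fun x hx =>
        abs_gradDot_le (hE x hx) (hB x hx))
    have hχint : ∀ l, IntegrableOn (gradDot (χ l) V) Ω := fun l =>
      hint (hχ1d l).contDiffOn fun x _ => hD l x
    rw [setIntegral_congr_fun hΩ.isOpen.measurableSet hgrad, integral_sub (hint hU hA)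
      (integrable_finsetSum _ fun l _ => (hχint l).const_mul _),
      integral_finsetSum _ fun l _ => (hχint l).const_mul _] at hmain
    simp_rw [integral_const_mul, horth, mul_zero, Finset.sum_const_zero, sub_zero] at hmain
    rw [← hmain]
    refine setIntegral_congr_fun hΩ.isOpen.measurableSet fun x hx => ?_
    simp only [V, U']
    rw [laplacian_smoothedGreen hG hρ hb hx]
    -- The mass sits in the disc around b and the cutoffs vanish there, so U and `U'` have the same
    -- integral against it.
    by_cases hxb : ρ ≤ ‖x - b‖
    · rw [smearedMass_eq_zero hρ hxb, mul_zero, mul_zero]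
    · have : ∀ l, χ l x = 0 := fun l => hχzero l x fun h => h.2 (by
        rw [Metric.mem_closedBall, dist_eq_norm]; exact (not_le.1 hxb).le)
      simp [this]
  · intro x hx
    rw [hΩ.frontier_eq] at hx
    obtain ⟨k, hk⟩ := mem_iUnion.1 hx
    have hother : ∀ l : Fin d, l.succ ≠ k → χ l x = 0 := fun l hl => hχzero l x fun h =>
      h.1 (mem_biUnion (x := k) (fun h' => hl h'.symm) hk)
    rcases Fin.eq_zero_or_eq_succ k with rfl | ⟨j, rfl⟩
    · simp only [U', hU0 x hk]
      rw [Finset.sum_eq_zero fun l _ => by rw [hother l (Fin.succ_ne_zero l), mul_zero], sub_zero]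
    · have hone : χ j x = 1 := by
        obtain ⟨s, rfl⟩ := hk; exact hχ1 j s
      simp only [U', hκ j x hk]
      rw [Finset.sum_eq_single j (fun l _ hl => by
        rw [hother l fun h => hl (Fin.succ_injective _ h), mul_zero]) (by simp), hone]
      ring
  · intro x hx
    rw [hU'd x hx]
    refine (norm_sub_le _ _).trans (add_le_add (hA x hx) ((norm_sum_le _ _).trans
      (Finset.sum_le_sum fun l _ => ?_)))
    rw [norm_smul, Real.norm_eq_abs]
    exact mul_le_mul_of_nonneg_left (hD l x) (abs_nonneg _)

lemma setIntegral_mul_smearedMass_eq_self {ρ : ℝ} (hρ : 0 < ρ) {b : ℂ}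
    (hball : Metric.closedBall b ρ ⊆ Ω) {U : ℂ → ℝ}
    (hU : HarmonicOnNhd U (Metric.closedBall b ρ)) :
    ∫ x in Ω, U x * smearedMass ρ ‖x - b‖ = U b := by
  rw [← integral_mul_smearedMass_eq hρ hU]
  refine setIntegral_eq_integral_of_forall_compl_eq_zero fun x hx => ?_
  have : ρ ≤ ‖x - b‖ := by
    by_contra h
    exact hx (hball (by rw [Metric.mem_closedBall, dist_eq_norm]; exact (not_le.1 h).le))
  rw [smearedMass_eq_zero hρ this, mul_zero]

/-- Green's identity is applied with U the Green function smoothed at a. Since the two discs are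
disjoint, U is harmonic on the disc around b and the smeared mass returns its value at b, which is
G(b, a). The right side is symmetric in a and b. -/
lemma green_eq_neg_setIntegral (hΩ : IsC2Domain Ω γ) (hG : IsHydrodynamicGreen Ω γ G) {ρ : ℝ}
    (hρ : 0 < ρ) {a b : ℂ} (ha : Metric.closedBall a ρ ⊆ Ω) (hb : Metric.closedBall b ρ ⊆ Ω)
    (hab : 2 * ρ < ‖b - a‖) :
    G b a = - ∫ x in Ω, gradDot (smoothedGreen G ρ a) (smoothedGreen G ρ b) x := by
  have haΩ : a ∈ Ω := ha (Metric.mem_closedBall_self hρ.le)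
  obtain ⟨A, hA⟩ := exists_bound_fderiv_smoothedGreen hΩ hG hρ ha
  have hfar : ∀ p ∈ frontier Ω, smoothedGreen G ρ a p = G p a := fun p hp =>
    smoothedGreen_eq hρ (lt_norm_sub_of_mem_frontier hΩ ha hp).le
  rw [← setIntegral_mul_smearedMass_eq hΩ hG hρ hb
    ((contDiffOn_smoothedGreen hG hρ haΩ).of_le (by norm_num))
    (continuousOn_smoothedGreen hΩ hG hρ ha) hA
    (fun x hx => by
      rw [hfar x (hΩ.range_subset_frontier _ hx)]; exact hG.zero_outer a haΩ x hx)
    (fun l => by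
      obtain ⟨c, hc⟩ := hG.const_inner a haΩ l
      exact ⟨c, fun x hx => by
        rw [hfar x (hΩ.range_subset_frontier _ hx)]; exact hc x hx⟩),
    setIntegral_mul_smearedMass_eq_self hρ hb, smoothedGreen_eq hρ (by linarith)]
  intro x hx
  refine harmonicAt_smoothedGreen hΩ hG hρ haΩ (hb hx) ?_
  rw [Metric.mem_closedBall, dist_eq_norm] at hx
  have h1 : ‖b - a‖ ≤ ‖x - a‖ + ‖x - b‖ := by
    rw [norm_sub_rev x b]
    calc ‖b - a‖ = ‖(x - a) + (b - x)‖ := by ring_nf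
      _ ≤ _ := norm_add_le _ _
  linarith

lemma exists_closedBall_subset (hΩ : IsC2Domain Ω γ) {a : ℂ} (ha : a ∈ Ω) :
    ∃ r > 0, ∀ ρ ≤ r, Metric.closedBall a ρ ⊆ Ω := by
  obtain ⟨r, hr, h⟩ := Metric.nhds_basis_closedBall.mem_iff.1 (hΩ.isOpen.mem_nhds ha)
  exact ⟨r, hr, fun ρ hρ => (Metric.closedBall_subset_closedBall hρ).trans h⟩

/-- The hydrodynamic Green function is symmetric. -/
lemma IsHydrodynamicGreen.symm (hΩ : IsC2Domain Ω γ) (hG : IsHydrodynamicGreen Ω γ G) {a b : ℂ}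
    (ha : a ∈ Ω) (hb : b ∈ Ω) : G a b = G b a := by
  rcases eq_or_ne a b with rfl | hab
  · rfl
  obtain ⟨r, hr, hra⟩ := exists_closedBall_subset hΩ ha
  obtain ⟨r', hr', hrb⟩ := exists_closedBall_subset hΩ hb
  have hpos : 0 < ‖a - b‖ := norm_pos_iff.2 (sub_ne_zero.2 hab)
  set ρ := min (min r r') (‖a - b‖ / 4)
  have hρ : 0 < ρ := lt_min (lt_min hr hr') (by positivity)
  have h1 : ρ ≤ r := (min_le_left _ _).trans (min_le_left _ _)
  have h2 : ρ ≤ r' := (min_le_left _ _).trans (min_le_right _ _)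
  have h3 : 2 * ρ < ‖a - b‖ := by
    have : ρ ≤ ‖a - b‖ / 4 := min_le_right _ _
    linarith
  rw [green_eq_neg_setIntegral hΩ hG hρ (hrb ρ h2) (hra ρ h1) h3,
    green_eq_neg_setIntegral hΩ hG hρ (hra ρ h1) (hrb ρ h2) (by rwa [norm_sub_rev])]
  simp_rw [gradDot_comm (smoothedGreen G ρ b)]

end

/-! ### The sign of the hydrodynamic Green function -/

lemma gradDot_self_nonneg (u : ℂ → ℝ) (x : ℂ) : 0 ≤ gradDot u u x :=
  add_nonneg (mul_self_nonneg _) (mul_self_nonneg _)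

lemma fderiv_eq_zero_of_gradDot_self {u : ℂ → ℝ} {x : ℂ} (h : gradDot u u x = 0) :
    fderiv ℝ u x = 0 := by
  have h1 := mul_self_nonneg (fderiv ℝ u x 1)
  have h2 := mul_self_nonneg (fderiv ℝ u x Complex.I)
  have h' : fderiv ℝ u x 1 * fderiv ℝ u x 1
    + fderiv ℝ u x Complex.I * fderiv ℝ u x Complex.I = 0 := h
  have e1 : fderiv ℝ u x 1 = 0 := mul_self_eq_zero.1 (by linarith)
  have e2 : fderiv ℝ u x Complex.I = 0 := mul_self_eq_zero.1 (by linarith)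
  ext v
  have hv : v = v.re • (1 : ℂ) + v.im • Complex.I := by
    apply Complex.ext <;> simp
  rw [hv, map_add, map_smul, map_smul, e1, e2]
  simp

section
variable {d : ℕ} {Ω : Set ℂ} {γ : Fin (d + 1) → ℝ → ℂ} {G : ℂ → ℂ → ℝ}

/-- The logarithm tends to -∞ at the pole, whereas the regular part stays bounded. -/
lemma eventually_green_neg (hG : IsHydrodynamicGreen Ω γ G) {a : ℂ} (ha : a ∈ Ω) :
    ∀ᶠ x in 𝓝 a, x ≠ a → G x a < 0 := by
  have h1 : ContinuousAt (fun x => regularPart G x a) a := (hG.harmonic a ha a ha).1.continuousAt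
  have h2 := h1.eventually_lt_const (lt_add_one _)
  set C := regularPart G a a + 1
  have h3 : Tendsto (fun x => Real.log ‖x - a‖) (𝓝[≠] a) atBot := by
    refine Real.tendsto_log_nhdsGT_zero.comp ?_
    exact tendsto_norm_sub_self_nhdsNE a
  have h4 := h3.eventually_lt_atBot (-(2 * Real.pi * C))
  rw [eventually_nhdsWithin_iff] at h4
  filter_upwards [h2, h4] with x hx hx' hxa
  have := hx' hxa
  rw [regularPart] at hx
  have hp := Real.pi_pos
  have : 1 / (2 * Real.pi) * Real.log ‖x - a‖ < -C := by
    rw [one_div, inv_mul_lt_iff₀ (by positivity)]; linarith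
  linarith

/-- The hydrodynamic Green function is nonpositive. -/
lemma IsHydrodynamicGreen.nonpos (hΩ : IsC2Domain Ω γ) (hG : IsHydrodynamicGreen Ω γ G) {a x : ℂ}
    (ha : a ∈ Ω) (hx : x ∈ Ω) (hxa : x ≠ a) : G x a ≤ 0 := by
  classical
  obtain ⟨r, hr, hra⟩ := exists_closedBall_subset hΩ ha
  obtain ⟨s, hs, hsa⟩ := Metric.nhds_basis_ball.mem_iff.1 (eventually_green_neg hG ha)
  set ρ := min r (s / 2)
  have hρ : 0 < ρ := lt_min hr (half_pos hs)
  have hball : Metric.closedBall a ρ ⊆ Ω := hra ρ (min_le_left _ _)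
  have hneg : ∀ y, ‖y - a‖ < 2 * ρ → y ≠ a → G y a < 0 := fun y hy =>
    hsa (by
      have : ρ ≤ s / 2 := min_le_right _ _
      rw [Metric.mem_ball, dist_eq_norm]; linarith)
  set u := smoothedGreen G ρ a
  -- `expNegInvGlue` is a smooth nondecreasing function η that vanishes exactly on (-∞, 0]; it
  -- replaces the positive part. The composite w = η(G) is zero around the pole, where G < 0; at a
  -- itself the value is prescribed, because `G a a` encodes the regular part. As w vanishes on the
  -- smeared mass, Green's identity says that η'(G) |∇G|² has integral 0. Hence w is constant, so w
  -- = 0 and G ≤ 0.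
  set w : ℂ → ℝ := fun y => if y = a then 0 else expNegInvGlue (G y a)
  have hη : ContDiff ℝ 2 expNegInvGlue := expNegInvGlue.contDiff
  have hηd : ∀ t, 0 ≤ deriv expNegInvGlue t := fun t => expNegInvGlue.monotone.deriv_nonneg
  have hηc : Continuous (deriv expNegInvGlue) := hη.continuous_deriv (by norm_num)
  have hw0 : ∀ y, ‖y - a‖ < 2 * ρ → w y = 0 := by
    intro y hy
    by_cases h : y = a
    · simp [w, h]
    · simp only [w, if_neg h]
      exact expNegInvGlue.zero_of_nonpos (hneg y hy h).le
  have hwu : ∀ y, ρ ≤ ‖y - a‖ → w y = expNegInvGlue (u y) := by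
    intro y hy
    have : y ≠ a := by rintro rfl; rw [sub_self, norm_zero] at hy; linarith
    simp only [w, if_neg this, u, smoothedGreen_eq hρ hy]
  have hw0' : ∀ y, ‖y - a‖ < 2 * ρ → w =ᶠ[𝓝 y] fun _ => 0 := by
    intro y hy
    have : IsOpen {x : ℂ | ‖x - a‖ < 2 * ρ} := isOpen_lt (by fun_prop) continuous_const
    filter_upwards [this.mem_nhds hy] with z hz using hw0 z hz
  have hwu' : ∀ y, 2 * ρ ≤ ‖y - a‖ → w =ᶠ[𝓝 y] fun y => expNegInvGlue (u y) := by
    intro y hy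
    have : IsOpen {x : ℂ | ρ < ‖x - a‖} := isOpen_lt continuous_const (by fun_prop)
    filter_upwards [this.mem_nhds (show ρ < ‖y - a‖ by linarith)] with z hz using hwu z (le_of_lt hz)
  have hu : ContDiffOn ℝ 2 u Ω := contDiffOn_smoothedGreen hG hρ ha
  have huc : ContinuousOn u (closure Ω) := continuousOn_smoothedGreen hΩ hG hρ hball
  have hud : ∀ y ∈ Ω, HasFDerivAt u (fderiv ℝ u y) y := fun y hy =>
    ((hu.contDiffAt (hΩ.isOpen.mem_nhds hy)).differentiableAt two_ne_zero).hasFDerivAt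
  have hwd0 : ∀ y, ‖y - a‖ < 2 * ρ → fderiv ℝ w y = 0 := fun y hy => by
    rw [(hw0' y hy).fderiv_eq]; simp
  have hwdu : ∀ y ∈ Ω, 2 * ρ ≤ ‖y - a‖ →
      fderiv ℝ w y = deriv expNegInvGlue (u y) • fderiv ℝ u y := fun y hyΩ hy => by
    rw [(hwu' y hy).fderiv_eq]
    exact (((hη.differentiable two_ne_zero _).hasDerivAt).comp_hasFDerivAt y (hud y hyΩ)).fderiv
  have hw : ContDiffOn ℝ 1 w Ω := by
    intro y hy
    rcases lt_or_ge ‖y - a‖ (2 * ρ) with h | h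
    · exact (contDiffAt_const.congr_of_eventuallyEq (hw0' y h)).contDiffWithinAt
    · refine (ContDiffAt.congr_of_eventuallyEq ?_ (hwu' y h)).contDiffWithinAt
      exact (hη.contDiffAt.comp y (hu.contDiffAt (hΩ.isOpen.mem_nhds hy))).of_le (by norm_num)
  have hwc : ContinuousOn w (closure Ω) := by
    intro y hy
    rcases lt_or_ge ‖y - a‖ (2 * ρ) with h | h
    · exact (continuousAt_const.congr (hw0' y h).symm).continuousWithinAt
    · refine ContinuousWithinAt.congr_of_eventuallyEq ?_
        ((hwu' y h).filter_mono nhdsWithin_le_nhds) (hwu' y h).eq_of_nhds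
      exact hη.continuous.continuousAt.comp_continuousWithinAt (huc y hy)
  obtain ⟨B, hB⟩ := exists_bound_fderiv_smoothedGreen hΩ hG hρ hball
  obtain ⟨C, hC⟩ := hΩ.isBounded.isCompact_closure.exists_bound_of_continuousOn
    (hηc.comp_continuousOn huc)
  have hC0 : 0 ≤ C := (norm_nonneg _).trans (hC a (subset_closure ha))
  have hB0 : 0 ≤ B := (norm_nonneg _).trans (hB a ha)
  have hA : ∀ y ∈ Ω, ‖fderiv ℝ w y‖ ≤ C * B := by
    intro y hy
    rcases lt_or_ge ‖y - a‖ (2 * ρ) with h | h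
    · rw [hwd0 y h, norm_zero]; positivity
    · rw [hwdu y hy h, norm_smul]
      exact mul_le_mul (hC y (subset_closure hy)) (hB y hy) (norm_nonneg _) hC0
  have hfar : ∀ p ∈ frontier Ω, w p = expNegInvGlue (G p a) := fun p hp => by
    have : p ≠ a := by rintro rfl; exact hΩ.notMem_of_mem_frontier hp ha
    simp [w, this]
  have key := setIntegral_mul_smearedMass_eq hΩ hG hρ hball hw hwc hA
    (fun y hy => by
      rw [hfar y (hΩ.range_subset_frontier _ hy), hG.zero_outer a ha y hy, expNegInvGlue.zero])
    (fun l => by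
      obtain ⟨c, hc⟩ := hG.const_inner a ha l
      exact ⟨expNegInvGlue c, fun y hy => by
        rw [hfar y (hΩ.range_subset_frontier _ hy), hc y hy]⟩)
  rw [setIntegral_congr_fun (g := fun _ => 0) hΩ.isOpen.measurableSet (fun y _ => ?_),
    integral_zero, zero_eq_neg] at key
  swap
  · rcases lt_or_ge ‖y - a‖ ρ with h | h
    · simp only [hw0 y (by linarith), zero_mul]
    · simp only [smearedMass_eq_zero hρ h, mul_zero]
  have hu1 : ContDiffOn ℝ 1 u Ω := hu.of_le (by norm_num)
  have hcont : ContinuousOn (gradDot w u) Ω := hw.continuousOn_gradDot hΩ.isOpen hu1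
  have hgrad : ∀ y ∈ Ω, 2 * ρ ≤ ‖y - a‖ →
      gradDot w u y = deriv expNegInvGlue (u y) * gradDot u u y := by
    intro y hy h
    simp only [gradDot, hwdu y hy h, _root_.smul_apply, smul_eq_mul]
    ring
  have hnn : ∀ y ∈ Ω, 0 ≤ gradDot w u y := by
    intro y hy
    rcases lt_or_ge ‖y - a‖ (2 * ρ) with h | h
    · simp [gradDot, hwd0 y h]
    · rw [hgrad y hy h]; exact mul_nonneg (hηd _) (gradDot_self_nonneg _ _)
  have hint : IntegrableOn (gradDot w u) Ω := by
    refine IntegrableOn.of_bound (C := 2 * (C * B * B)) hΩ.isBounded.measure_lt_top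
      (hcont.aestronglyMeasurable hΩ.isOpen.measurableSet) ?_
    exact (ae_restrict_iff' hΩ.isOpen.measurableSet).2 (Eventually.of_forall fun y hy =>
      abs_gradDot_le (hA y hy) (hB y hy))
  rw [setIntegral_eq_zero_iff_of_nonneg_ae ((ae_restrict_iff' hΩ.isOpen.measurableSet).2
    (Eventually.of_forall hnn)) hint] at key
  have hzero : EqOn (gradDot w u) 0 Ω :=
    Measure.eqOn_open_of_ae_eq key hΩ.isOpen hcont continuousOn_const
  have hfd : EqOn (fderiv ℝ w) 0 Ω := by
    intro y hy
    rcases lt_or_ge ‖y - a‖ (2 * ρ) with h | h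
    · exact hwd0 y h
    · have h0 := hzero hy
      rw [hgrad y hy h, Pi.zero_apply, mul_eq_zero] at h0
      rw [hwdu y hy h]
      rcases h0 with h0 | h0
      · rw [h0, zero_smul]; rfl
      · rw [fderiv_eq_zero_of_gradDot_self h0, smul_zero]; rfl
  have hconst := hΩ.isOpen.is_const_of_fderiv_eq_zero hΩ.isConnected.isPreconnected
    (hw.differentiableOn one_ne_zero) hfd hx ha
  simp only [w, if_neg hxa, if_true] at hconst
  exact expNegInvGlue.zero_iff_nonpos.1 hconst

end

/-! ### Joint analyticity of separately harmonic functions -/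

/-- Harnack's inequality on the concentric disc of half the radius. -/
lemma le_three_mul_of_harmonicOnNhd {u : ℂ → ℝ} {c w : ℂ} {R : ℝ}
    (hu : HarmonicOnNhd u (Metric.closedBall c R)) (h0 : ∀ x ∈ Metric.closedBall c R, 0 ≤ u x)
    (hR : 0 < R) (hw : ‖w - c‖ ≤ R / 2) : u w ≤ 3 * u c := by
  have hwb : w ∈ Metric.ball c R := by rw [Metric.mem_ball, dist_eq_norm]; linarith
  have hsub : Metric.sphere c |R| ⊆ Metric.closedBall c R := by
    rw [abs_of_pos hR]; exact Metric.sphere_subset_closedBall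
  have huc : ContinuousOn u (Metric.sphere c |R|) := fun x hx =>
    (hu x (hsub hx)).1.continuousAt.continuousWithinAt
  have h1 : Real.circleAverage u c R = u c :=
    InnerProductSpace.HarmonicOnNhd.circleAverage_eq (by rwa [abs_of_pos hR])
  rw [← hu.circleAverage_re_herglotzRieszKernel_smul hwb, ← h1, ← smul_eq_mul,
    ← Real.circleAverage_smul]
  refine Real.circleAverage_mono ?_ ?_ fun z hz => ?_
  · exact ((Complex.continuous_re.comp_continuousOn
      (continuousOn_herglotzRieszKernel_sphere hwb)).smul huc).circleIntegrable'
  · exact (continuousOn_const.smul huc).circleIntegrable'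
  · rw [abs_of_pos hR] at hz
    have h3 := re_herglotzRieszKernel_le hz hwb
    simp only [Pi.smul_apply', Function.comp_apply, Pi.smul_apply, smul_eq_mul]
    refine mul_le_mul_of_nonneg_right ?_ (h0 z (Metric.sphere_subset_closedBall hz))
    -- For ‖w - c‖ ≤ R / 2 the maximum (R + ‖w - c‖) / (R - ‖w - c‖) of the Poisson kernel is at
    -- most 3.
    refine h3.trans ?_
    rw [div_le_iff₀ (by linarith)]
    linarith

/-- The bilinear form on bounded continuous functions with a separately continuous kernel. -/
lemma exists_bilinear_of_kernel {a : ℝ → ℝ → ℝ} {C : ℝ} (hC : ∀ s t, |a s t| ≤ C)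
    (h1 : ∀ t, Continuous fun s => a s t) (h2 : ∀ s, Continuous (a s)) :
    ∃ B : (BoundedContinuousFunction ℝ ℂ) →L[ℝ] (BoundedContinuousFunction ℝ ℂ) →L[ℝ] ℝ,
      ∀ h k, B h k = ∫ s in (0 : ℝ)..2 * Real.pi, (h s).re *
        ∫ t in (0 : ℝ)..2 * Real.pi, (k t).re * a s t := by
  have hC0 : 0 ≤ C := (abs_nonneg _).trans (hC 0 0)
  have hπ : (0 : ℝ) ≤ 2 * Real.pi := by positivity
  have hre : ∀ (h : BoundedContinuousFunction ℝ ℂ) s, |(h s).re| ≤ ‖h‖ := fun h s =>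
    (Complex.abs_re_le_norm _).trans (h.norm_coe_le_norm s)
  have hrec : ∀ h : BoundedContinuousFunction ℝ ℂ, Continuous fun s => (h s).re := fun h =>
    Complex.continuous_re.comp h.continuous
  have hi : ∀ (k : BoundedContinuousFunction ℝ ℂ) s, IntervalIntegrable
      (fun t => (k t).re * a s t) volume 0 (2 * Real.pi) := fun k s =>
    ((hrec k).mul (h2 s)).intervalIntegrable _ _
  set I : BoundedContinuousFunction ℝ ℂ → ℝ → ℝ := fun k s =>
    ∫ t in (0 : ℝ)..2 * Real.pi, (k t).re * a s t
  -- Joint continuity of the kernel is not available; the uniform bound and dominated convergence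
  -- give continuity of the inner integral.
  have hIc : ∀ k, Continuous (I k) := by
    intro k
    refine intervalIntegral.continuous_of_dominated_interval (bound := fun _ => ‖k‖ * C)
      (fun s => ((hrec k).mul (h2 s)).aestronglyMeasurable) ?_ (by simp) ?_
    · refine fun s => Eventually.of_forall fun t _ => ?_
      rw [norm_mul]
      exact mul_le_mul (hre k t) (hC s t) (norm_nonneg _) (norm_nonneg _)
    · exact Eventually.of_forall fun t _ => continuous_const.mul (h1 t)
  have hIb : ∀ k s, |I k s| ≤ ‖k‖ * C * (2 * Real.pi) := by
    intro k s
    have := intervalIntegral.norm_integral_le_of_norm_le_const (a := 0) (b := 2 * Real.pi)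
      (f := fun t => (k t).re * a s t) (C := ‖k‖ * C) (fun t _ => by
        rw [norm_mul]; exact mul_le_mul (hre k t) (hC s t) (norm_nonneg _) (norm_nonneg _))
    rwa [sub_zero, abs_of_nonneg hπ] at this
  have hii : ∀ h k : BoundedContinuousFunction ℝ ℂ, IntervalIntegrable
      (fun s => (h s).re * I k s) volume 0 (2 * Real.pi) := fun h k =>
    ((hrec h).mul (hIc k)).intervalIntegrable _ _
  have hIadd : ∀ k k' s, I (k + k') s = I k s + I k' s := fun k k' s => by
    simp only [I]
    rw [← intervalIntegral.integral_add (hi k s) (hi k' s)]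
    simp [add_mul]
  have hIsmul : ∀ (r : ℝ) k s, I (r • k) s = r * I k s := fun r k s => by
    simp only [I]
    rw [← intervalIntegral.integral_const_mul]
    simp [mul_assoc]
  let L : (BoundedContinuousFunction ℝ ℂ) →ₗ[ℝ] (BoundedContinuousFunction ℝ ℂ) →ₗ[ℝ] ℝ :=
    LinearMap.mk₂ ℝ (fun h k => ∫ s in (0 : ℝ)..2 * Real.pi, (h s).re * I k s)
      (fun h h' k => by
        rw [← intervalIntegral.integral_add (hii h k) (hii h' k)]; simp [add_mul])
      (fun r h k => by
        rw [smul_eq_mul, ← intervalIntegral.integral_const_mul]; simp [mul_assoc])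
      (fun h k k' => by
        rw [← intervalIntegral.integral_add (hii h k) (hii h k')]; simp [hIadd, mul_add])
      (fun r h k => by
        rw [smul_eq_mul, ← intervalIntegral.integral_const_mul]
        simp [hIsmul, mul_left_comm])
  refine ⟨L.mkContinuous₂ (C * (2 * Real.pi) * (2 * Real.pi)) fun h k => ?_, fun h k => rfl⟩
  have := intervalIntegral.norm_integral_le_of_norm_le_const (a := 0) (b := 2 * Real.pi)
      (f := fun s => (h s).re * I k s) (C := ‖h‖ * (‖k‖ * C * (2 * Real.pi))) (fun t _ => by
        rw [norm_mul]; exact mul_le_mul (hre h t) (hIb k t) (norm_nonneg _) (norm_nonneg _))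
  rw [sub_zero, abs_of_nonneg hπ] at this
  refine this.trans (le_of_eq ?_)
  ring

/-- The Herglotz–Riesz kernel of a disc is an analytic function of the interior point with values in
the bounded continuous functions on the boundary. -/
lemma exists_analyticAt_herglotzRieszKernel (c : ℂ) {R : ℝ} (hR : 0 < R) :
    ∃ k : ℂ → BoundedContinuousFunction ℝ ℂ, AnalyticAt ℝ k c ∧
      ∀ᶠ w in 𝓝 c, ∀ θ, k w θ = herglotzRieszKernel c w (circleMap c R θ) := by
  -- In the Banach algebra of bounded continuous functions the kernel is (e + m) (e - m)⁻¹, where e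
  -- is the boundary point minus c and m is the constant w - c. At w = c the denominator is the unit
  -- e, and inversion is analytic at units.
  set e : BoundedContinuousFunction ℝ ℂ := BoundedContinuousFunction.ofNormedAddCommGroup
    (fun θ => circleMap c R θ - c) (by fun_prop) R (fun θ => by simp [abs_of_pos hR])
  set e' : BoundedContinuousFunction ℝ ℂ := BoundedContinuousFunction.ofNormedAddCommGroup
    (fun θ => (circleMap c R θ - c)⁻¹) (by
      refine Continuous.inv₀ (by fun_prop) fun θ => ?_
      simp [hR.ne']) R⁻¹ (fun θ => by simp [abs_of_pos hR])
  have hne : ∀ θ, circleMap c R θ - c ≠ 0 := fun θ => by simp [hR.ne']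
  have hee : e * e' = 1 := by
    ext θ : 1
    exact mul_inv_cancel₀ (hne θ)
  have hu : IsUnit e := IsUnit.of_mul_eq_one _ hee
  let m : ℂ → BoundedContinuousFunction ℝ ℂ := fun w => (w - c) • 1
  have hm : AnalyticAt ℂ m c := (analyticAt_id.sub analyticAt_const).smul analyticAt_const
  have hmc : e - m c = e := by simp [m]
  have hinv : AnalyticAt ℂ (fun w => Ring.inverse (e - m w)) c := by
    obtain ⟨u, hu'⟩ := hu
    have := analyticAt_inverse (𝕜 := ℂ) u
    refine AnalyticAt.fun_comp (g := Ring.inverse) (f := fun w => e - m w) ?_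
      (analyticAt_const.sub hm)
    rwa [hmc, ← hu']
  refine ⟨fun w => (e + m w) * Ring.inverse (e - m w),
    ((analyticAt_const.add hm).mul hinv).restrictScalars, ?_⟩
  have hev : ∀ᶠ w in 𝓝 c, IsUnit (e - m w) := by
    have hcont : ContinuousAt (fun w => e - m w) c := continuousAt_const.sub hm.continuousAt
    refine hcont.eventually (p := IsUnit) ?_
    exact Units.isOpen.mem_nhds (show IsUnit (e - m c) by rwa [hmc])
  filter_upwards [hev] with w hw θ
  have h1 := Ring.mul_inverse_cancel _ hw
  have h2 : (circleMap c R θ - c - (w - c)) * Ring.inverse (e - m w) θ = 1 := by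
    have := congrArg (fun f : BoundedContinuousFunction ℝ ℂ => f θ) h1
    simpa [m, e] using this
  rw [herglotzRieszKernel_def, div_eq_mul_inv, ← eq_inv_of_mul_eq_one_right h2]
  simp [m, e]

/-- A separately harmonic function that is bounded on the distinguished boundary of a bidisc is
analytic at its centre. -/
lemma analyticAt_of_separately_harmonic {g : ℂ → ℂ → ℝ} {p q : ℂ} {R S C : ℝ} (hR : 0 < R)
    (hS : 0 < S)
    (h1 : ∀ y ∈ Metric.closedBall q S, HarmonicOnNhd (fun x => g x y) (Metric.closedBall p R))
    (h2 : ∀ x ∈ Metric.closedBall p R, HarmonicOnNhd (g x) (Metric.closedBall q S))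
    (hC : ∀ x ∈ Metric.sphere p R, ∀ y ∈ Metric.sphere q S, |g x y| ≤ C) :
    AnalyticAt ℝ (fun z : ℂ × ℂ => g z.1 z.2) (p, q) := by
  have hsp : ∀ θ, circleMap p R θ ∈ Metric.sphere p R := circleMap_mem_sphere p hR.le
  have hsq : ∀ θ, circleMap q S θ ∈ Metric.sphere q S := circleMap_mem_sphere q hS.le
  have hcp : ∀ θ, circleMap p R θ ∈ Metric.closedBall p R := circleMap_mem_closedBall p hR.le
  have hcq : ∀ θ, circleMap q S θ ∈ Metric.closedBall q S := circleMap_mem_closedBall q hS.le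
  obtain ⟨B, hB⟩ := exists_bilinear_of_kernel
    (a := fun s t => g (circleMap p R s) (circleMap q S t))
    (fun s t => hC _ (hsp s) _ (hsq t))
    (fun t => continuous_iff_continuousAt.2 fun s =>
      ContinuousAt.comp (f := circleMap p R) (g := fun x => g x (circleMap q S t))
        (h1 _ (hcq t) _ (hcp s)).1.continuousAt (continuous_circleMap p R).continuousAt)
    (fun s => continuous_iff_continuousAt.2 fun t =>
      ContinuousAt.comp (f := circleMap q S) (g := g (circleMap p R s))
        (h2 _ (hcp s) _ (hcq t)).1.continuousAt (continuous_circleMap q S).continuousAt)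
  obtain ⟨k, hk, hk'⟩ := exists_analyticAt_herglotzRieszKernel p hR
  obtain ⟨l, hl, hl'⟩ := exists_analyticAt_herglotzRieszKernel q hS
  -- Poisson's formula in both variables expresses g as a bounded bilinear form, evaluated at the
  -- two kernels; those depend analytically on the interior points.
  have hmain : AnalyticAt ℝ (fun z : ℂ × ℂ => (2 * Real.pi)⁻¹ * ((2 * Real.pi)⁻¹ *
      B (k z.1) (l z.2))) (p, q) := by
    refine analyticAt_const.mul (analyticAt_const.mul ?_)
    exact (B.analyticAt_bilinear _).fun_comp ((AnalyticAt.fun_comp (f := Prod.fst) hk analyticAt_fst).prod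
      (AnalyticAt.fun_comp (f := Prod.snd) hl analyticAt_snd))
  refine hmain.congr ?_
  have hk2 := hk'.and (Metric.ball_mem_nhds p hR)
  have hl2 := hl'.and (Metric.ball_mem_nhds q hS)
  rw [nhds_prod_eq]
  filter_upwards [hk2.prod_mk hl2] with ⟨x, y⟩ ⟨⟨hx, hxb⟩, ⟨hy, hyb⟩⟩
  have e1 : ∀ y ∈ Metric.closedBall q S, g x y = (2 * Real.pi)⁻¹ *
      ∫ s in (0 : ℝ)..2 * Real.pi, (k x s).re * g (circleMap p R s) y := by
    intro y hy
    rw [← (h1 y hy).circleAverage_re_herglotzRieszKernel_smul hxb, Real.circleAverage_def]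
    simp [hx]
  have e2 : ∀ x ∈ Metric.closedBall p R, g x y = (2 * Real.pi)⁻¹ *
      ∫ t in (0 : ℝ)..2 * Real.pi, (l y t).re * g x (circleMap q S t) := by
    intro x hx
    rw [← (h2 x hx).circleAverage_re_herglotzRieszKernel_smul hyb, Real.circleAverage_def]
    simp [hy]
  dsimp only
  rw [e1 y (Metric.ball_subset_closedBall hyb), hB, ← intervalIntegral.integral_const_mul]
  congr 1
  refine intervalIntegral.integral_congr fun s _ => ?_
  rw [e2 _ (hcp s)]
  ring

/-! ### Joint analyticity of the hydrodynamic Green function -/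

section
variable {d : ℕ} {Ω : Set ℂ} {γ : Fin (d + 1) → ℝ → ℂ} {G : ℂ → ℂ → ℝ}

lemma IsHydrodynamicGreen.harmonicAt_snd (hΩ : IsC2Domain Ω γ) (hG : IsHydrodynamicGreen Ω γ G)
    {x y : ℂ} (hx : x ∈ Ω) (hy : y ∈ Ω) : HarmonicAt (regularPart G x) y := by
  refine (harmonicAt_congr_nhds ?_).2 (hG.harmonic x hx y hy)
  filter_upwards [hΩ.isOpen.mem_nhds hy] with z hz
  simp only [regularPart]
  rw [hG.symm hΩ hx hz, norm_sub_rev]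

lemma IsHydrodynamicGreen.harmonicAt_green_snd (hΩ : IsC2Domain Ω γ)
    (hG : IsHydrodynamicGreen Ω γ G) {x y : ℂ} (hx : x ∈ Ω) (hy : y ∈ Ω) (hxy : x ≠ y) :
    HarmonicAt (G x) y := by
  refine (harmonicAt_congr_nhds ?_).2 (harmonicAt_green hΩ hG hx hy hxy.symm)
  filter_upwards [hΩ.isOpen.mem_nhds hy] with z hz
  exact hG.symm hΩ hx hz

/-- Harnack's inequality for the nonnegative function -G, once in x and once in y, costs a factor 3
each time. The discs have radius at most a third of the distance of p and q, so they are disjoint.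
-/
lemma IsHydrodynamicGreen.eventually_abs_le (hΩ : IsC2Domain Ω γ) (hG : IsHydrodynamicGreen Ω γ G)
    {p q : ℂ} (hp : p ∈ Ω) (hq : q ∈ Ω) (hpq : p ≠ q) :
    ∀ᶠ z : ℂ × ℂ in 𝓝 (p, q), |G z.1 z.2| ≤ 9 * |G p q| := by
  have hd : 0 < ‖p - q‖ := norm_pos_iff.2 (sub_ne_zero.2 hpq)
  obtain ⟨r, hr, hrp⟩ := exists_closedBall_subset hΩ hp
  obtain ⟨r', hr', hrq⟩ := exists_closedBall_subset hΩ hq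
  set R := min (min r r') (‖p - q‖ / 3)
  have hR : 0 < R := lt_min (lt_min hr hr') (by positivity)
  have hRp : Metric.closedBall p R ⊆ Ω := hrp R ((min_le_left _ _).trans (min_le_left _ _))
  have hRq : Metric.closedBall q R ⊆ Ω := hrq R ((min_le_left _ _).trans (min_le_right _ _))
  have hRd : R ≤ ‖p - q‖ / 3 := min_le_right _ _
  have hne : ∀ x ∈ Metric.closedBall p R, ∀ y ∈ Metric.closedBall q R, x ≠ y := by
    rintro x hx y hy rfl
    rw [Metric.mem_closedBall, dist_eq_norm] at hx hy
    have : ‖p - q‖ ≤ ‖x - p‖ + ‖x - q‖ := by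
      rw [norm_sub_rev x p]
      calc ‖p - q‖ = ‖(p - x) + (x - q)‖ := by ring_nf
        _ ≤ _ := norm_add_le _ _
    linarith
  have hpc := Metric.mem_closedBall_self (x := p) hR.le
  have hqc := Metric.mem_closedBall_self (x := q) hR.le
  have hneg : ∀ x ∈ Metric.closedBall p R, ∀ y ∈ Metric.closedBall q R, 0 ≤ -G x y :=
    fun x hx y hy => by
      have := hG.nonpos hΩ (hRq hy) (hRp hx) (hne x hx y hy); linarith
  rw [nhds_prod_eq]
  filter_upwards [prod_mem_prod (Metric.closedBall_mem_nhds p (half_pos hR))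
    (Metric.closedBall_mem_nhds q (half_pos hR))]
  rintro ⟨x, y⟩ ⟨hx, hy⟩
  have hx' : x ∈ Metric.closedBall p R := Metric.closedBall_subset_closedBall (by linarith) hx
  have hy' : y ∈ Metric.closedBall q R := Metric.closedBall_subset_closedBall (by linarith) hy
  rw [Metric.mem_closedBall, dist_eq_norm] at hx hy
  have h1 : -G x y ≤ 3 * -G p y := le_three_mul_of_harmonicOnNhd (u := fun x => -G x y)
    (fun z hz => (harmonicAt_green hΩ hG (hRq hy') (hRp hz) (hne z hz y hy')).neg)
    (fun z hz => hneg z hz y hy') hR hx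
  have h2 : -G p y ≤ 3 * -G p q := le_three_mul_of_harmonicOnNhd (u := fun y => -G p y)
    (fun z hz => (hG.harmonicAt_green_snd hΩ hp (hRq hz) (hne p hpc z hz)).neg)
    (fun z hz => hneg p hpc z hz) hR hy
  have h3 := hneg x hx' y hy'
  have h4 := hneg p hpc q hqc
  rw [← abs_neg, abs_of_nonneg h3, ← abs_neg (G p q), abs_of_nonneg h4]
  linarith

lemma IsHydrodynamicGreen.exists_bound (hΩ : IsC2Domain Ω γ) (hG : IsHydrodynamicGreen Ω γ G)
    {K L : Set ℂ} (hK : IsCompact K) (hL : IsCompact L) (hKΩ : K ⊆ Ω) (hLΩ : L ⊆ Ω)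
    (hKL : ∀ x ∈ K, ∀ y ∈ L, x ≠ y) : ∃ C, ∀ x ∈ K, ∀ y ∈ L, |regularPart G x y| ≤ C := by
  have key : ∃ C, ∀ z ∈ K ×ˢ L, |regularPart G z.1 z.2| ≤ C := by
    refine (hK.prod hL).induction_on
      (p := fun s => ∃ C, ∀ z ∈ s, |regularPart G z.1 z.2| ≤ C)
      ⟨0, by simp⟩ (fun s t hst ⟨C, hC⟩ => ⟨C, fun x hx => hC x (hst hx)⟩) ?_ ?_
    · rintro s t ⟨C, hC⟩ ⟨C', hC'⟩
      refine ⟨max C C', ?_⟩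
      rintro x (hx | hx)
      · exact (hC x hx).trans (le_max_left _ _)
      · exact (hC' x hx).trans (le_max_right _ _)
    · rintro ⟨p, q⟩ ⟨hp, hq⟩
      have hne := hKL p hp q hq
      have h1 := hG.eventually_abs_le hΩ (hKΩ hp) (hLΩ hq) hne
      have h2 : ContinuousAt (fun z : ℂ × ℂ => 1 / (2 * Real.pi) * Real.log ‖z.1 - z.2‖) (p, q) := by
        refine continuousAt_const.mul (ContinuousAt.log (by fun_prop) ?_)
        exact norm_ne_zero_iff.2 (sub_ne_zero.2 hne)
      have h3 := h2.abs.eventually_lt_const (lt_add_one _)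
      refine ⟨_, mem_nhdsWithin_of_mem_nhds (h1.and h3), 9 * |G p q| +
        (|1 / (2 * Real.pi) * Real.log ‖p - q‖| + 1), fun z hz => ?_⟩
      exact (abs_sub _ _).trans (add_le_add hz.1 hz.2.le)
  obtain ⟨C, hC⟩ := key
  exact ⟨C, fun x hx y hy => hC (x, y) ⟨hx, hy⟩⟩

/-- The regular part of the hydrodynamic Green function is jointly analytic. -/
lemma IsHydrodynamicGreen.analyticAt_regularPart (hΩ : IsC2Domain Ω γ)
    (hG : IsHydrodynamicGreen Ω γ G) {p q : ℂ} (hp : p ∈ Ω) (hq : q ∈ Ω) :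
    AnalyticAt ℝ (fun z : ℂ × ℂ => regularPart G z.1 z.2) (p, q) := by
  obtain ⟨r₀, hr₀, hrp⟩ := exists_closedBall_subset hΩ hp
  obtain ⟨r', hr', hrq⟩ := exists_closedBall_subset hΩ hq
  -- The radius r differs from the distance of p and q, so the circle around p misses q, and a small
  -- circle around q misses the first one. Thus the torus avoids the diagonal, also for p = q. The
  -- bidisc may meet the diagonal, where the regular part is still separately harmonic.
  obtain ⟨r, hr, hrr, hd⟩ : ∃ r > 0, r ≤ r₀ ∧ dist p q ≠ r := by
    by_cases h : dist p q = r₀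
    · exact ⟨r₀ / 2, half_pos hr₀, by linarith, by rw [h]; linarith⟩
    · exact ⟨r₀, hr₀, le_rfl, h⟩
  have hdpos := abs_pos.2 (sub_ne_zero.2 hd)
  obtain ⟨S, hS, hSr, hne⟩ : ∃ S > 0, S ≤ r' ∧
      ∀ x ∈ Metric.sphere p r, ∀ y ∈ Metric.sphere q S, x ≠ y := by
    refine ⟨min r' (|dist p q - r| / 2), lt_min hr' (by positivity), min_le_left _ _, ?_⟩
    rintro x hx y hy rfl
    have hx' : dist x p = r := hx
    have hy' : dist x q ≤ |dist p q - r| / 2 := (le_of_eq hy).trans (min_le_right _ _)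
    have h1 : |dist p q - r| ≤ dist x q := by
      rw [← hx', abs_le]
      constructor
      · linarith [dist_triangle x q p, dist_comm p q]
      · linarith [dist_triangle p x q, dist_comm p x]
    linarith
  have hcp := hrp r hrr
  have hcq := hrq S hSr
  obtain ⟨C, hC⟩ := hG.exists_bound hΩ (isCompact_sphere p r) (isCompact_sphere q S)
    (Metric.sphere_subset_closedBall.trans hcp) (Metric.sphere_subset_closedBall.trans hcq) hne
  exact analyticAt_of_separately_harmonic hr hS
    (fun y hy x hx => hG.harmonic y (hcq hy) x (hcp hx))
    (fun x hx y hy => hG.harmonicAt_snd hΩ (hcp hx) (hcq hy)) hC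

lemma IsHydrodynamicGreen.analyticAt (hΩ : IsC2Domain Ω γ) (hG : IsHydrodynamicGreen Ω γ G)
    {p q : ℂ} (hp : p ∈ Ω) (hq : q ∈ Ω) (hpq : p ≠ q) :
    AnalyticAt ℝ (fun z : ℂ × ℂ => G z.1 z.2) (p, q) := by
  have h1 : AnalyticAt ℝ (fun z : ℂ × ℂ => Real.log (‖z.1 - z.2‖ ^ 2)) (p, q) := by
    have h2 : AnalyticAt ℝ (fun z : ℂ × ℂ => ‖z.1 - z.2‖ ^ 2) (p, q) := by
      have hre : AnalyticAt ℝ (fun z : ℂ × ℂ => (z.1 - z.2).re) (p, q) :=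
        (Complex.reCLM.analyticAt _).comp (analyticAt_fst.sub analyticAt_snd)
      have him : AnalyticAt ℝ (fun z : ℂ × ℂ => (z.1 - z.2).im) (p, q) :=
        (Complex.imCLM.analyticAt _).comp (analyticAt_fst.sub analyticAt_snd)
      refine ((hre.pow 2).add (him.pow 2)).congr (Eventually.of_forall fun z => ?_)
      simp only [Pi.add_apply, Pi.pow_apply]
      rw [← Complex.normSq_eq_norm_sq, Complex.normSq_apply]
      ring
    refine (analyticAt_log ?_).fun_comp h2
    have := norm_pos_iff.2 (sub_ne_zero.2 hpq)
    positivity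
  refine ((hG.analyticAt_regularPart hΩ hp hq).add
    ((analyticAt_const (v := 1 / (4 * Real.pi))).mul h1)).congr (Eventually.of_forall fun z => ?_)
  simp only [Pi.add_apply, Pi.mul_apply, regularPart, Real.log_pow]
  have := Real.pi_pos
  push_cast
  field_simp
  ring

/-- Separates off the default value 0, which is trivially symmetric and analytic, so that existence
of the Green function is never needed. -/
lemma green_eq_zero_or (Ω : Set ℂ) (γ : Fin (d + 1) → ℝ → ℂ) :
    green Ω γ = 0 ∨ IsHydrodynamicGreen Ω γ (green Ω γ) := by
  classical
  by_cases h : ∃ G, IsHydrodynamicGreen Ω γ G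
  · right
    have : green Ω γ = h.choose := dif_pos h
    rw [this]
    exact h.choose_spec
  · exact Or.inl (dif_neg h)

lemma green_comm (hΩ : IsC2Domain Ω γ) {x y : ℂ} (hx : x ∈ Ω) (hy : y ∈ Ω) :
    green Ω γ x y = green Ω γ y x := by
  rcases green_eq_zero_or Ω γ with h | h
  · rw [h]; rfl
  · exact h.symm hΩ hx hy

lemma analyticAt_green (hΩ : IsC2Domain Ω γ) {x y : ℂ} (hx : x ∈ Ω) (hy : y ∈ Ω) (hxy : x ≠ y) :
    AnalyticAt ℝ (fun z : ℂ × ℂ => green Ω γ z.1 z.2) (x, y) := by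
  rcases green_eq_zero_or Ω γ with h | h
  · rw [h]; exact analyticAt_const
  · exact h.analyticAt hΩ hx hy hxy

lemma analyticAt_robin (hΩ : IsC2Domain Ω γ) {x : ℂ} (hx : x ∈ Ω) :
    AnalyticAt ℝ (robin Ω γ) x := by
  rcases green_eq_zero_or Ω γ with h | h
  · have : robin Ω γ = fun _ => 0 := by
      ext x; simp [robin, regularPart, h]
    rw [this]; exact analyticAt_const
  · exact (h.analyticAt_regularPart hΩ hx hx).fun_comp (f := fun x => (x, x))
      (analyticAt_id.prod analyticAt_id)

lemma analyticAt_harmonicMeasure {x : ℂ} (hx : x ∈ Ω) (j : Fin d) :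
    AnalyticAt ℝ (harmonicMeasure Ω γ j) x := by
  classical
  by_cases h : ∃ u, IsHarmonicMeasure Ω γ j u
  · have : harmonicMeasure Ω γ j = h.choose := dif_pos h
    rw [this]
    exact HarmonicAt.analyticAt (h.choose_spec.harmonic x hx)
  · have : harmonicMeasure Ω γ j = 0 := dif_neg h
    rw [this]; exact analyticAt_const

lemma analyticAt_psi0 {x : ℂ} (hx : x ∈ Ω) (Γ : Fin d → ℝ) : AnalyticAt ℝ (psi0 Ω γ Γ) x :=
  Finset.analyticAt_fun_sum _ fun _ _ => Finset.analyticAt_fun_sum _ fun j _ =>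
    analyticAt_const.mul (analyticAt_harmonicMeasure hx j)

end

/-! ### Analyticity of the solutions of analytic differential equations -/

section ODE
variable {E : Type*} [NormedAddCommGroup E] [NormedSpace ℝ E]

/-- The superposition operator of a continuous multilinear map on paths. -/
def pathMultilinear {n : ℕ} (p : ContinuousMultilinearMap ℝ (fun _ : Fin n => E) E) :
    ContinuousMultilinearMap ℝ (fun _ : Fin n => C(Icc (0 : ℝ) 1, E)) C(Icc (0 : ℝ) 1, E) :=
  MultilinearMap.mkContinuous
    { toFun := fun w => ⟨fun s => p fun i => w i s, by fun_prop⟩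
      map_update_add' := by
        intro _ w i x y
        ext s
        have h : ∀ v : C(Icc (0 : ℝ) 1, E), (fun j => Function.update w i v j s)
            = Function.update (fun j => w j s) i (v s) := by
          intro v; ext j; by_cases hj : j = i
          · subst hj; simp
          · simp [hj]
        simp [h]
      map_update_smul' := by
        intro _ w i c x
        ext s
        have h : ∀ v : C(Icc (0 : ℝ) 1, E), (fun j => Function.update w i v j s)
            = Function.update (fun j => w j s) i (v s) := by
          intro v; ext j; by_cases hj : j = i
          · subst hj; simp
          · simp [hj]
        simp [h] }
    ‖p‖ fun w => by
      refine (ContinuousMap.norm_le _ (by positivity)).2 fun s => ?_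
      exact (p.le_opNorm _).trans (mul_le_mul_of_nonneg_left
        (Finset.prod_le_prod (fun _ _ => norm_nonneg _) fun i _ => (w i).norm_coe_le_norm s)
        (norm_nonneg _))

lemma norm_pathMultilinear_le {n : ℕ} (p : ContinuousMultilinearMap ℝ (fun _ : Fin n => E) E) :
    ‖pathMultilinear p‖ ≤ ‖p‖ :=
  MultilinearMap.mkContinuous_norm_le _ (norm_nonneg _) _

/-- The superposition operator of an analytic map is analytic on the space of paths. -/
lemma exists_analyticAt_superposition [CompleteSpace E] {f : E → E} (hf : AnalyticAt ℝ f 0) :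
    ∃ N : C(Icc (0 : ℝ) 1, E) → C(Icc (0 : ℝ) 1, E), AnalyticAt ℝ N 0 ∧
      ∀ᶠ w in 𝓝 0, ∀ s, N w s = f (w s) := by
  obtain ⟨p, r, hp⟩ := hf
  -- The power series of f acts pointwise on paths. The norms of its terms do not increase, so it
  -- converges on a ball of paths as well.
  let P : FormalMultilinearSeries ℝ C(Icc (0 : ℝ) 1, E) C(Icc (0 : ℝ) 1, E) :=
    fun n => pathMultilinear (p n)
  obtain ⟨ρ, hρ, hρr⟩ := ENNReal.lt_iff_exists_nnreal_btwn.1 hp.r_pos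
  have hρp : (ρ : ENNReal) < p.radius := hρr.trans_le hp.r_le
  obtain ⟨C, -, hC⟩ := p.norm_mul_pow_le_of_lt_radius hρp
  have hPr : (ρ : ENNReal) ≤ P.radius := P.le_radius_of_bound C fun n =>
    (mul_le_mul_of_nonneg_right (norm_pathMultilinear_le _) (by positivity)).trans (hC n)
  have hP := P.hasFPowerSeriesOnBall (hρ.trans_le hPr)
  refine ⟨P.sum, hP.analyticAt, ?_⟩
  filter_upwards [Metric.eball_mem_nhds (0 : C(Icc (0 : ℝ) 1, E)) hρ] with w hw s
  have h1 := hP.hasSum (Metric.eball_subset_eball hPr hw)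
  have h2 := h1.mapL (ContinuousMap.evalCLM ℝ s)
  have hws : w s ∈ Metric.eball (0 : E) r := by
    refine Metric.eball_subset_eball hρr.le ?_
    rw [Metric.mem_eball, edist_zero_right] at hw ⊢
    refine lt_of_le_of_lt ?_ hw
    exact enorm_le_iff_norm_le.2 (w.norm_coe_le_norm s)
  have h3 := hp.hasSum hws
  rw [zero_add] at h2 h3
  exact h2.unique h3

/-- Integration of paths from the starting point on. -/
def pathPrimitive [CompleteSpace E] : C(Icc (0 : ℝ) 1, E) →L[ℝ] C(Icc (0 : ℝ) 1, E) :=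
  LinearMap.mkContinuous
    { toFun := fun w => ⟨fun s => ∫ u in (0 : ℝ)..s, IccExtend zero_le_one w u, by
        have hw : Continuous (IccExtend (zero_le_one' ℝ) w) := w.continuous.Icc_extend'
        exact (intervalIntegral.continuous_primitive
          (fun a b => hw.intervalIntegrable a b) 0).comp continuous_subtype_val⟩
      map_add' := by
        intro v w
        ext s
        have hv : Continuous (IccExtend (zero_le_one' ℝ) v) := v.continuous.Icc_extend'
        have hw : Continuous (IccExtend (zero_le_one' ℝ) w) := w.continuous.Icc_extend'
        exact intervalIntegral.integral_add (hv.intervalIntegrable _ _) (hw.intervalIntegrable _ _)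
      map_smul' := by
        intro c w
        ext s
        exact intervalIntegral.integral_smul c _ }
    1 fun w => by
      rw [one_mul]
      refine (ContinuousMap.norm_le _ (norm_nonneg _)).2 fun s => ?_
      have := intervalIntegral.norm_integral_le_of_norm_le_const (a := 0) (b := s)
        (f := IccExtend (zero_le_one' ℝ) w) (C := ‖w‖) (fun t _ => w.norm_coe_le_norm _)
      refine this.trans ?_
      rw [sub_zero, abs_of_nonneg s.2.1]
      exact mul_le_of_le_one_right (norm_nonneg _) s.2.2

lemma pathPrimitive_apply [CompleteSpace E] (w : C(Icc (0 : ℝ) 1, E)) (s : Icc (0 : ℝ) 1) :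
    pathPrimitive w s = ∫ u in (0 : ℝ)..s, IccExtend zero_le_one w u := rfl

/-- The small solutions `w` of `w = λ J (N w)` are analytic functions of `λ`. -/
lemma exists_analyticAt_of_eq_smul {X : Type*} [NormedAddCommGroup X] [NormedSpace ℝ X]
    [CompleteSpace X] {M : X → X} (hM : AnalyticAt ℝ M 0) :
    ∃ Y : ℝ → X, AnalyticAt ℝ Y 0 ∧
      ∀ᶠ v : ℝ × X in 𝓝 (0, 0), v.2 = v.1 • M v.2 → v.2 = Y v.1 := by
  let Θ : ℝ × X → ℝ × X := fun v => (v.1, v.2 - v.1 • M v.2)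
  have hM' : AnalyticAt ℝ (fun v : ℝ × X => M v.2) ((0 : ℝ), (0 : X)) :=
    AnalyticAt.fun_comp (f := Prod.snd) hM analyticAt_snd
  have hΘ : AnalyticAt ℝ Θ (0, 0) :=
    analyticAt_fst.prod (analyticAt_snd.sub (analyticAt_fst.smul hM'))
  let e : (ℝ × X) ≃L[ℝ] (ℝ × X) := ContinuousLinearEquiv.equivOfInverse
    ((ContinuousLinearMap.fst ℝ ℝ X).prod
      (ContinuousLinearMap.snd ℝ ℝ X - (ContinuousLinearMap.fst ℝ ℝ X).smulRight (M 0)))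
    ((ContinuousLinearMap.fst ℝ ℝ X).prod
      (ContinuousLinearMap.snd ℝ ℝ X + (ContinuousLinearMap.fst ℝ ℝ X).smulRight (M 0)))
    (fun v => by ext <;> simp) (fun v => by ext <;> simp)
  have he : HasFDerivAt Θ (e : (ℝ × X) →L[ℝ] (ℝ × X)) (0, 0) := by
    have h1 := hM'.differentiableAt.hasFDerivAt
    refine (hasFDerivAt_fst.prodMk (hasFDerivAt_snd.sub (hasFDerivAt_fst.smul h1))).congr_fderiv ?_
    ext v <;> simp [e]
  -- Here `⊤` is the analytic class ω, so the local inverse is analytic and not merely smooth.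
  have hcd : ContDiffAt ℝ ⊤ Θ (0, 0) := hΘ.contDiffAt
  have h0 : Θ (0, 0) = (0, 0) := by simp [Θ]
  have hinv := hcd.to_localInverse he (by simp)
  have hleft := (hcd.hasStrictFDerivAt' he (by simp)).eventually_left_inverse
  set Φ := hcd.localInverse he (by simp)
  rw [h0] at hinv
  have hinv' : AnalyticAt ℝ Φ (0, 0) := by
    rw [← analyticWithinAt_univ, ← contDiffWithinAt_omega_iff_analyticWithinAt]
    exact hinv.contDiffWithinAt
  refine ⟨fun l => (Φ (l, 0)).2, ?_, ?_⟩
  · have h1 : AnalyticAt ℝ (fun l : ℝ => (l, (0 : X))) 0 := analyticAt_id.prod analyticAt_const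
    exact analyticAt_snd.fun_comp
      (AnalyticAt.fun_comp (f := fun l : ℝ => (l, (0 : X))) (x := 0) hinv' h1)
  · filter_upwards [hleft] with v hv hv'
    have h1 : Θ v = (v.1, 0) := by
      simp only [Θ]
      rw [← hv', sub_self]
    have h2 : Φ (Θ v) = v := hv
    rw [h1] at h2
    rw [h2]

/-- Near `t₀`, the solutions of an analytic autonomous equation that pass through `x₀` at time `t₀`
are given by one and the same analytic function. -/
lemma exists_analyticAt_eventually_eq_of_ode [CompleteSpace E] {F : E → E} {x₀ : E}
    (hF : AnalyticAt ℝ F x₀) (t₀ : ℝ) :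
    ∃ Y : ℝ → E, AnalyticAt ℝ Y t₀ ∧ ∀ (a b : ℝ) (z : ℝ → E),
      (∀ t ∈ Icc a b, HasDerivWithinAt z (F (z t)) (Icc a b) t) → t₀ ∈ Icc a b → z t₀ = x₀ →
      z =ᶠ[𝓝[Icc a b] t₀] Y := by
  have hf : AnalyticAt ℝ (fun u => F (x₀ + u)) 0 := by
    have h1 : AnalyticAt ℝ (fun u => x₀ + u) 0 := analyticAt_const.add analyticAt_id
    exact AnalyticAt.fun_comp (by simpa using hF) h1
  obtain ⟨N, hN, hN'⟩ := exists_analyticAt_superposition hf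
  obtain ⟨W, hW, hW'⟩ := exists_analyticAt_of_eq_smul (M := fun w => pathPrimitive (N w))
    ((pathPrimitive.analyticAt _).fun_comp hN)
  let one : Icc (0 : ℝ) 1 := ⟨1, by simp⟩
  refine ⟨fun t => x₀ + W (t - t₀) one, ?_, ?_⟩
  · have h1 : AnalyticAt ℝ (fun t => t - t₀) t₀ := analyticAt_id.sub analyticAt_const
    have h2 : AnalyticAt ℝ (fun t => W (t - t₀)) t₀ :=
      AnalyticAt.fun_comp (by simpa using hW) h1
    exact analyticAt_const.add (((ContinuousMap.evalCLM ℝ one).analyticAt _).fun_comp h2)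
  intro a b z hz ht₀ hz₀
  have hzc : ContinuousOn z (Icc a b) := fun t ht => (hz t ht).continuousWithinAt
  rw [nhds_prod_eq] at hW'
  obtain ⟨U₁, hU₁, V₁, hV₁, hUV⟩ := Filter.mem_prod_iff.1 hW'
  obtain ⟨ε, hε, hεV⟩ := Metric.nhds_basis_closedBall.mem_iff.1 (Filter.inter_mem hV₁ hN')
  have h1 : ∀ᶠ t in 𝓝[Icc a b] t₀, dist (z t) x₀ < ε := by
    rw [← hz₀]; exact (hzc t₀ ht₀) (Metric.ball_mem_nhds _ hε)
  rw [eventually_nhdsWithin_iff] at h1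
  obtain ⟨δ, hδ, hδz⟩ := Metric.mem_nhds_iff.1 h1
  have h2 : ∀ᶠ t in 𝓝 t₀, t - t₀ ∈ U₁ := by
    have : Tendsto (fun t : ℝ => t - t₀) (𝓝 t₀) (𝓝 0) := by
      have : ContinuousAt (fun t : ℝ => t - t₀) t₀ := by fun_prop
      simpa [ContinuousAt] using this
    exact this hU₁
  filter_upwards [self_mem_nhdsWithin, mem_nhdsWithin_of_mem_nhds (Metric.ball_mem_nhds t₀ hδ),
    mem_nhdsWithin_of_mem_nhds h2] with t ht htδ htU
  have hseg : ∀ s ∈ Icc (0 : ℝ) 1, t₀ + s * (t - t₀) ∈ Icc a b ∩ Metric.ball t₀ δ := by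
    intro s hs
    refine ⟨?_, ?_⟩
    · have := (convex_Icc a b).add_smul_sub_mem ht₀ ht hs
      simpa using this
    · rw [Metric.mem_ball, Real.dist_eq] at htδ ⊢
      rw [add_sub_cancel_left, abs_mul, abs_of_nonneg hs.1]
      exact lt_of_le_of_lt (mul_le_of_le_one_left (abs_nonneg _) hs.2) htδ
  have hsegc : Continuous fun s : ℝ => t₀ + s * (t - t₀) := by fun_prop
  -- The solution between t₀ and t, rescaled to [0, 1] and translated to start at 0, satisfies w = λ
  -- J(N w) with λ = t - t₀ and J the primitive. Small solutions of this equation are unique and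
  -- analytic in λ, and evaluation at 1 recovers z(t). Negative λ is allowed.
  let w : C(Icc (0 : ℝ) 1, E) := ⟨fun s => z (t₀ + s * (t - t₀)) - x₀, by
    refine Continuous.sub ?_ continuous_const
    exact hzc.comp_continuous (hsegc.comp continuous_subtype_val) fun s => (hseg s s.2).1⟩
  have hwε : w ∈ Metric.closedBall 0 ε := by
    rw [mem_closedBall_zero_iff]
    refine (ContinuousMap.norm_le _ hε.le).2 fun s => ?_
    have := hδz (hseg s s.2).2 (hseg s s.2).1
    rw [dist_eq_norm] at this
    exact this.le
  obtain ⟨hwV, hwN⟩ := hεV hwε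
  have hwN' : ∀ s, N w s = F (x₀ + w s) := hwN
  have hfix : w = (t - t₀) • pathPrimitive (N w) := by
    ext s
    have hcont : ContinuousOn (fun s : ℝ => z (t₀ + s * (t - t₀))) (Icc 0 1) :=
      hzc.comp hsegc.continuousOn fun s hs => (hseg s hs).1
    have hder : ∀ u ∈ Ioo (0 : ℝ) 1, HasDerivAt (fun s : ℝ => z (t₀ + s * (t - t₀)))
        ((t - t₀) • F (z (t₀ + u * (t - t₀)))) u := by
      intro u hu
      have hu' := Ioo_subset_Icc_self hu
      have h3 : HasDerivWithinAt (fun s : ℝ => t₀ + s * (t - t₀)) (t - t₀) (Icc 0 1) u := by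
        have := (((hasDerivAt_id' u).mul_const (t - t₀)).const_add t₀).hasDerivWithinAt
          (s := Icc 0 1)
        simpa using this
      exact ((hz _ (hseg u hu').1).scomp u h3 fun s hs => (hseg s hs).1).hasDerivAt
        (Icc_mem_nhds hu.1 hu.2)
    have hFz : ∀ u ∈ Icc (0 : ℝ) 1, IccExtend (zero_le_one' ℝ) (N w) u
        = F (z (t₀ + u * (t - t₀))) := by
      intro u hu
      rw [IccExtend_of_mem _ _ hu, hwN']
      simp [w]
    have hsub : Icc (0 : ℝ) s ⊆ Icc 0 1 := Icc_subset_Icc_right s.2.2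
    have hint := intervalIntegral.integral_eq_sub_of_hasDerivAt_of_le (a := 0) (b := (s : ℝ))
      (f := fun s : ℝ => z (t₀ + s * (t - t₀)))
      (f' := fun u => (t - t₀) • IccExtend (zero_le_one' ℝ) (N w) u) s.2.1 (hcont.mono hsub)
      (fun u hu => by
        have hu' : u ∈ Ioo (0 : ℝ) 1 := ⟨hu.1, lt_of_lt_of_le hu.2 s.2.2⟩
        rw [hFz u (Ioo_subset_Icc_self hu')]
        exact hder u hu')
      ((continuous_const.smul (N w).continuous.Icc_extend').intervalIntegrable _ _)
    rw [intervalIntegral.integral_smul] at hint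
    rw [ContinuousMap.smul_apply, pathPrimitive_apply, hint]
    simp [w, hz₀]
  have hY := hUV (mk_mem_prod htU hwV) hfix
  have hY1 := congrArg (fun v : C(Icc (0 : ℝ) 1, E) => v one) hY
  simp only [w, one, ContinuousMap.coe_mk, one_mul, add_sub_cancel] at hY1
  rw [← hY1]
  abel

lemma analyticOn_of_ode [CompleteSpace E] {F : E → E} {a b : ℝ} {z : ℝ → E}
    (hz : ∀ t ∈ Icc a b, HasDerivWithinAt z (F (z t)) (Icc a b) t)
    (hF : ∀ t ∈ Icc a b, AnalyticAt ℝ F (z t)) : AnalyticOn ℝ z (Icc a b) := by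
  intro t ht
  obtain ⟨Y, hY, h⟩ := exists_analyticAt_eventually_eq_of_ode (hF t ht) t
  have := h a b z hz ht rfl
  exact hY.analyticWithinAt.congr_of_eventuallyEq this (this.eq_of_nhdsWithin ht)

/-- At a time of agreement both solutions are given locally by the same analytic function. The set
of agreement is therefore closed and open to the right. -/
lemma eqOn_of_ode [CompleteSpace E] {F : E → E} {a b : ℝ} {z w : ℝ → E}
    (hz : ∀ t ∈ Icc a b, HasDerivWithinAt z (F (z t)) (Icc a b) t)
    (hw : ∀ t ∈ Icc a b, HasDerivWithinAt w (F (w t)) (Icc a b) t)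
    (hF : ∀ t ∈ Icc a b, AnalyticAt ℝ F (z t)) (h0 : w a = z a) : EqOn w z (Icc a b) := by
  have hzc : ContinuousOn z (Icc a b) := fun t ht => (hz t ht).continuousWithinAt
  have hwc : ContinuousOn w (Icc a b) := fun t ht => (hw t ht).continuousWithinAt
  have hclosed : IsClosed ({t | w t = z t} ∩ Icc a b) := by
    have := (hwc.prodMk hzc).preimage_isClosed_of_isClosed isClosed_Icc isClosed_diagonal
    rwa [inter_comm]
  refine hclosed.Icc_subset_of_forall_mem_nhdsWithin h0 ?_
  rintro t ⟨ht, htab⟩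
  have ht' := Ico_subset_Icc_self htab
  obtain ⟨Y, -, h⟩ := exists_analyticAt_eventually_eq_of_ode (hF t ht') t
  have h1 : w =ᶠ[𝓝[Icc a b] t] z := (h a b w hw ht' ht).trans (h a b z hz ht' rfl).symm
  have h2 : 𝓝[>] t ≤ 𝓝[Icc a b] t := by
    rw [← nhdsWithin_Ioc_eq_nhdsGT htab.2]
    exact nhdsWithin_mono _ fun s hs => ⟨htab.1.trans hs.1.le, hs.2⟩
  exact h1.filter_mono h2

end ODE

/-! ### The Kirchhoff–Routh–Lin vector field -/

lemma inner_perpGrad (f : ℂ → ℝ) (x v : ℂ) :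
    inner ℝ v (perpGrad f x) = fderiv ℝ f x (-(Complex.I * v)) := by
  rw [← inner_gradient, perpGrad, Complex.inner, Complex.inner]
  simp
  ring

lemma perpGrad_eq (f : ℂ → ℝ) (x : ℂ) :
    perpGrad f x = Complex.I * (fderiv ℝ f x 1 + fderiv ℝ f x Complex.I * Complex.I) := by
  rw [perpGrad, ← inner_gradient, ← inner_gradient, Complex.inner, Complex.inner]
  congr 1
  apply Complex.ext <;> simp

/-- The map L inserts the plane as one slot of E. This treats at once a function on the plane, the
first variable of G, and the position of one vortex in W. -/
lemma analyticAt_perpGrad_of_fderiv_eq {E : Type*} [NormedAddCommGroup E] [NormedSpace ℝ E]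
    {H : E → ℝ} {e : E} (hH : AnalyticAt ℝ H e) (L : ℂ →L[ℝ] E) :
    AnalyticAt ℝ (fun e => Complex.I *
      ((fderiv ℝ H e (L 1) : ℂ) + (fderiv ℝ H e (L Complex.I) : ℂ) * Complex.I)) e := by
  have h1 : ∀ v : E, AnalyticAt ℝ (fun e => (fderiv ℝ H e v : ℂ)) e := fun v =>
    (Complex.ofRealCLM.analyticAt _).fun_comp
      (((ContinuousLinearMap.apply ℝ ℝ v).analyticAt _).fun_comp hH.fderiv)
  exact analyticAt_const.mul ((h1 _).add ((h1 _).mul analyticAt_const))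

lemma analyticAt_perpGrad {f : ℂ → ℝ} {x : ℂ} (hf : AnalyticAt ℝ f x) :
    AnalyticAt ℝ (perpGrad f) x := by
  have h : perpGrad f = fun x => Complex.I *
      ((fderiv ℝ f x (ContinuousLinearMap.id ℝ ℂ 1) : ℂ)
        + (fderiv ℝ f x (ContinuousLinearMap.id ℝ ℂ Complex.I) : ℂ) * Complex.I) :=
    funext fun x => perpGrad_eq f x
  rw [h]
  exact analyticAt_perpGrad_of_fderiv_eq hf _

section
variable {d N : ℕ} {Ω : Set ℂ} {γ : Fin (d + 1) → ℝ → ℂ}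

lemma differentiableAt_green_fst (hΩ : IsC2Domain Ω γ) {x y : ℂ} (hx : x ∈ Ω) (hy : y ∈ Ω)
    (hxy : x ≠ y) : DifferentiableAt ℝ (fun x' => green Ω γ x' y) x :=
  ((analyticAt_green hΩ hx hy hxy).fun_comp (f := fun x' => (x', y))
    (analyticAt_id.prod analyticAt_const)).differentiableAt

lemma continuousAt_kernelK (hΩ : IsC2Domain Ω γ) {x y : ℂ} (hx : x ∈ Ω) (hy : y ∈ Ω)
    (hxy : x ≠ y) : ContinuousAt (fun p : ℂ × ℂ => kernelK Ω γ p.1 p.2) (x, y) := by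
  have h1 := analyticAt_perpGrad_of_fderiv_eq (analyticAt_green hΩ hx hy hxy)
    (ContinuousLinearMap.inl ℝ ℂ ℂ)
  refine h1.continuousAt.congr ?_
  have h2 : IsOpen {p : ℂ × ℂ | p.1 ∈ Ω ∧ p.2 ∈ Ω ∧ p.1 ≠ p.2} :=
    (hΩ.isOpen.preimage continuous_fst).inter
      ((hΩ.isOpen.preimage continuous_snd).inter (isOpen_ne_fun continuous_fst continuous_snd))
  filter_upwards [h2.mem_nhds ⟨hx, hy, hxy⟩]
  rintro ⟨a, b⟩ ⟨ha, hb, hab⟩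
  have h3 : HasFDerivAt (fun x' => green Ω γ x' b)
      ((fderiv ℝ (fun z : ℂ × ℂ => green Ω γ z.1 z.2) (a, b)).comp
        (ContinuousLinearMap.inl ℝ ℂ ℂ)) a :=
    HasFDerivAt.comp (f := fun x' => (x', b)) a
      (analyticAt_green hΩ ha hb hab).differentiableAt.hasFDerivAt (hasFDerivAt_prodMk_left a b)
  rw [kernelK, perpGrad_eq, h3.fderiv]
  rfl

lemma isOpen_configSpace (hΩ : IsC2Domain Ω γ) : IsOpen (configSpace Ω N) := by
  have : configSpace Ω N = (⋂ l, {z | z l ∈ Ω}) ∩ ⋂ l, ⋂ m, ⋂ (_ : l ≠ m), {z | z l ≠ z m} := by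
    ext z
    simp only [configSpace, mem_ofPred_eq, mem_inter_iff, mem_iInter]
    refine and_congr_right fun _ => ⟨fun h l m hlm h' => hlm (h h'), fun h l m hlm => ?_⟩
    by_contra h'
    exact h l m h' hlm
  rw [this]
  refine (isOpen_iInter_of_finite fun l => hΩ.isOpen.preimage (continuous_apply l)).inter ?_
  exact isOpen_iInter_of_finite fun l => isOpen_iInter_of_finite fun m =>
    isOpen_iInter_of_finite fun _ => isOpen_ne_fun (continuous_apply l) (continuous_apply m)

lemma analyticAt_krlW (hΩ : IsC2Domain Ω γ) (Γ : Fin d → ℝ) (α : Fin N → ℝ) {z : Fin N → ℂ}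
    (hz : z ∈ configSpace Ω N) : AnalyticAt ℝ (krlW Ω γ Γ α) z := by
  have hp : ∀ l, AnalyticAt ℝ (fun z : Fin N → ℂ => z l) z := fun l =>
    (ContinuousLinearMap.proj (R := ℝ) (φ := fun _ : Fin N => ℂ) l).analyticAt z
  refine AnalyticAt.add (AnalyticAt.add ?_ (analyticAt_const.mul ?_)) (analyticAt_const.mul ?_)
  · exact Finset.analyticAt_fun_sum _ fun l _ => analyticAt_const.mul
      (AnalyticAt.fun_comp (f := fun z : Fin N → ℂ => z l) (analyticAt_psi0 (hz.1 l) Γ) (hp l))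
  · exact Finset.analyticAt_fun_sum _ fun l _ => analyticAt_const.mul
      (AnalyticAt.fun_comp (f := fun z : Fin N → ℂ => z l) (analyticAt_robin hΩ (hz.1 l)) (hp l))
  · refine Finset.analyticAt_fun_sum _ fun l _ => Finset.analyticAt_fun_sum _ fun m hm =>
      analyticAt_const.mul ?_
    have hlm : z l ≠ z m := fun h => (Finset.mem_erase.1 hm).1 (hz.2 h).symm
    exact AnalyticAt.fun_comp (f := fun z : Fin N → ℂ => (z l, z m))
      (analyticAt_green hΩ (hz.1 l) (hz.1 m) hlm) ((hp l).prod (hp m))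

lemma analyticAt_krlField (hΩ : IsC2Domain Ω γ) (Γ : Fin d → ℝ) (α : Fin N → ℝ) {z : Fin N → ℂ}
    (hz : z ∈ configSpace Ω N) : AnalyticAt ℝ (krlField Ω γ Γ α) z := by
  refine analyticAt_pi_iff.2 fun i => ?_
  let L : ℂ →L[ℝ] (Fin N → ℂ) := .pi (Pi.single i (.id ℝ ℂ))
  have h1 := (analyticAt_const (v := 1 / α i)).smul
    (analyticAt_perpGrad_of_fderiv_eq (analyticAt_krlW hΩ Γ α hz) L)
  refine h1.congr ?_
  filter_upwards [(isOpen_configSpace hΩ).mem_nhds hz] with w hw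
  have h2 : HasFDerivAt (fun p => krlW Ω γ Γ α (Function.update w i p))
      ((fderiv ℝ (krlW Ω γ Γ α) w).comp L) (w i) := by
    have h3 : HasFDerivAt (Function.update w i) L (w i) := hasFDerivAt_update w (w i)
    have h4 : HasFDerivAt (krlW Ω γ Γ α) (fderiv ℝ (krlW Ω γ Γ α) w)
        (Function.update w i (w i)) := by
      rw [Function.update_eq_self]
      exact (analyticAt_krlW hΩ Γ α hw).differentiableAt.hasFDerivAt
    exact h4.comp (w i) h3
  rw [krlField, perpGrad_eq, h2.fderiv]
  rfl

/-- The dependence of the Kirchhoff–Routh–Lin function on the position of one vortex. -/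
lemma exists_krlW_update_eq (hΩ : IsC2Domain Ω γ) (Γ : Fin d → ℝ) (α : Fin N → ℝ) {z : Fin N → ℂ}
    (hz : z ∈ configSpace Ω N) (i : Fin N) :
    ∃ c, ∀ p ∈ Ω, krlW Ω γ Γ α (Function.update z i p) = c + (α i * psi0 Ω γ Γ p
      + 1 / 2 * α i ^ 2 * robin Ω γ p
      + ∑ m ∈ Finset.univ.erase i, α i * α m * green Ω γ p (z m)) := by
  refine ⟨∑ l ∈ Finset.univ.erase i, α l * psi0 Ω γ Γ (z l)
    + 1 / 2 * ∑ l ∈ Finset.univ.erase i, α l ^ 2 * robin Ω γ (z l)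
    + 1 / 2 * ∑ l ∈ Finset.univ.erase i, ∑ m ∈ (Finset.univ.erase l).erase i,
      α l * α m * green Ω γ (z l) (z m), fun p hp => ?_⟩
  have hu : ∀ l ∈ Finset.univ.erase i, Function.update z i p l = z l := fun l hl =>
    Function.update_of_ne (Finset.ne_of_mem_erase hl) _ _
  have e1 : ∀ f : Fin N → ℂ → ℝ, ∑ l, f l (Function.update z i p l)
      = f i p + ∑ l ∈ Finset.univ.erase i, f l (z l) := by
    intro f
    rw [← Finset.add_sum_erase _ _ (Finset.mem_univ i), Function.update_self]
    congr 1
    exact Finset.sum_congr rfl fun l hl => by rw [hu l hl]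
  -- The pairs (i, m) and (m, i) contribute equally by symmetry of G; the resulting 2 cancels the
  -- factor 1/2 in W.
  have e2 : ∑ l, ∑ m ∈ Finset.univ.erase l,
        α l * α m * green Ω γ (Function.update z i p l) (Function.update z i p m)
      = 2 * ∑ m ∈ Finset.univ.erase i, α i * α m * green Ω γ p (z m)
        + ∑ l ∈ Finset.univ.erase i, ∑ m ∈ (Finset.univ.erase l).erase i,
          α l * α m * green Ω γ (z l) (z m) := by
    have e3 : ∀ l ∈ Finset.univ.erase i, ∑ m ∈ Finset.univ.erase l,
        α l * α m * green Ω γ (Function.update z i p l) (Function.update z i p m)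
        = α i * α l * green Ω γ p (z l) + ∑ m ∈ (Finset.univ.erase l).erase i,
          α l * α m * green Ω γ (z l) (z m) := by
      intro l hl
      have hil : i ∈ Finset.univ.erase l :=
        Finset.mem_erase.2 ⟨(Finset.ne_of_mem_erase hl).symm, Finset.mem_univ _⟩
      rw [← Finset.add_sum_erase _ _ hil, Function.update_self, hu l hl,
        green_comm hΩ (hz.1 l) hp, mul_comm (α l)]
      congr 1
      refine Finset.sum_congr rfl fun m hm => ?_
      rw [hu m (Finset.mem_erase.2 ⟨Finset.ne_of_mem_erase hm, Finset.mem_univ _⟩)]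
    rw [← Finset.add_sum_erase _ _ (Finset.mem_univ i), Finset.sum_congr rfl e3,
      Finset.sum_add_distrib, Function.update_self, two_mul, add_assoc]
    congr 1
    exact Finset.sum_congr rfl fun m hm => by rw [hu m hm]
  rw [krlW, e1 fun l p => α l * psi0 Ω γ Γ p, e1 fun l p => α l ^ 2 * robin Ω γ p, e2]
  ring

/-- The velocity of a vortex, tested with a vector. -/
lemma inner_krlField (hΩ : IsC2Domain Ω γ) (Γ : Fin d → ℝ) {α : Fin N → ℝ} {z : Fin N → ℂ}
    (hz : z ∈ configSpace Ω N) {i : Fin N} (hα : α i ≠ 0) (v : ℂ) :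
    inner ℝ v (krlField Ω γ Γ α z i) = inner ℝ v (X0 Ω γ Γ (z i))
      + 1 / 2 * α i * inner ℝ v (perpGrad (robin Ω γ) (z i))
      + ∑ m ∈ Finset.univ.erase i, α m * inner ℝ v (kernelK Ω γ (z i) (z m)) := by
  obtain ⟨c, hc⟩ := exists_krlW_update_eq hΩ Γ α hz i
  have h1 : (fun p => krlW Ω γ Γ α (Function.update z i p)) =ᶠ[𝓝 (z i)] fun p =>
      c + (α i * psi0 Ω γ Γ p + 1 / 2 * α i ^ 2 * robin Ω γ p
      + ∑ m ∈ Finset.univ.erase i, α i * α m * green Ω γ p (z m)) := by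
    filter_upwards [hΩ.isOpen.mem_nhds (hz.1 i)] with p hp using hc p hp
  have h2 := (((((analyticAt_psi0 (γ := γ) (hz.1 i) Γ).differentiableAt.hasFDerivAt.const_mul
    (α i)).add ((analyticAt_robin hΩ (hz.1 i)).differentiableAt.hasFDerivAt.const_mul
      (1 / 2 * α i ^ 2))).add (HasFDerivAt.fun_sum (u := Finset.univ.erase i) fun m hm =>
      (differentiableAt_green_fst hΩ (hz.1 i) (hz.1 m) (fun h =>
        Finset.ne_of_mem_erase hm (hz.2 h).symm)).hasFDerivAt.const_mul (α i * α m))).const_add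
      c).congr_of_eventuallyEq h1
  rw [krlField, real_inner_smul_right, inner_perpGrad, h2.fderiv]
  simp only [X0, kernelK, inner_perpGrad, _root_.add_apply, _root_.smul_apply, _root_.sum_apply,
    smul_eq_mul, mul_add, Finset.mul_sum]
  congr 1
  · field_simp
  · refine Finset.sum_congr rfl fun m _ => ?_
    field_simp

end

/-! ### Point vortices as weak solutions -/

/-- On a finite carrier every function is integrable, without any measurability assumption; this is
applied to the test kernels. -/
lemma integrable_of_measure_compl_finite {X : Type*} [MeasurableSpace X]
    [MeasurableSingletonClass X] {μ : Measure X} [IsFiniteMeasure μ] {S : Set X} (hS : S.Finite)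
    (h : μ Sᶜ = 0) (f : X → ℝ) : Integrable f μ := by
  have h1 : μ.restrict S = μ := Measure.restrict_eq_self_of_ae_mem (mem_ae_iff.2 h)
  rw [← h1, ← biUnion_of_singleton S]
  exact (integrableOn_finite_biUnion hS).2 fun x _ =>
    integrableOn_singleton (by simp) (measure_lt_top μ _)

section
variable {d N : ℕ} {Ω : Set ℂ} {γ : Fin (d + 1) → ℝ → ℂ}

lemma integrable_dirac_one (z : ℂ) (f : ℂ → ℝ) :
    (VectorMeasure.dirac z (1 : ℝ)).Integrable f := by
  rw [VectorMeasure.Integrable, VectorMeasure.variation_dirac]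
  simpa using integrable_dirac (f := f) (a := z) (by simp)

lemma signedIntegral_vortexMeasure (α : Fin N → ℝ) (z : Fin N → ℂ) (f : ℂ → ℝ) :
    signedIntegral (vortexMeasure α z) f = ∑ l, α l * f (z l) := by
  rw [signedIntegral, vortexMeasure, VectorMeasure.integral_finsetSum_vectorMeasure fun l _ =>
    (integrable_dirac_one (z l) f).smul_vectorMeasure (α l)]
  simp

lemma totalVariation_vortexMeasure_le (α : Fin N → ℝ) (z : Fin N → ℂ) :
    (vortexMeasure α z).totalVariation ≤ ∑ l, ‖α l‖₊ • Measure.dirac (z l) := by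
  rw [SignedMeasure.totalVariation_eq_variation]
  refine (VectorMeasure.variation_finsetSum_le _ _).trans (le_of_eq ?_)
  refine Finset.sum_congr rfl fun l _ => ?_
  rw [VectorMeasure.variation_smul, VectorMeasure.variation_dirac]
  simp

lemma totalVariation_vortexMeasure_eq_zero (α : Fin N → ℝ) {z : Fin N → ℂ} {s : Set ℂ}
    (hs : MeasurableSet s) (h : ∀ l, z l ∉ s) : (vortexMeasure α z).totalVariation s = 0 := by
  refine le_antisymm ((totalVariation_vortexMeasure_le α z s).trans (le_of_eq ?_)) bot_le
  rw [Measure.finsetSum_apply]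
  refine Finset.sum_eq_zero fun l _ => ?_
  rw [Measure.smul_apply, Measure.dirac_apply' _ hs, indicator_of_notMem (h l), smul_zero]

lemma totalVariation_vortexMeasure_univ_le (α : Fin N → ℝ) (z : Fin N → ℂ) :
    (vortexMeasure α z).totalVariation univ ≤ ENNReal.ofReal (∑ l, |α l|) := by
  refine (totalVariation_vortexMeasure_le α z univ).trans (le_of_eq ?_)
  rw [Measure.finsetSum_apply, ENNReal.ofReal_sum_of_nonneg fun _ _ => abs_nonneg _]
  refine Finset.sum_congr rfl fun l _ => ?_
  rw [Measure.smul_apply, measure_univ, ← Real.norm_eq_abs, ofReal_norm]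
  simp [ENNReal.smul_def, enorm_eq_nnnorm]

lemma integrable_totalVariation_vortexMeasure (α : Fin N → ℝ) (z : Fin N → ℂ) (f : ℂ → ℝ) :
    Integrable f (vortexMeasure α z).totalVariation :=
  integrable_of_measure_compl_finite (finite_range z) (totalVariation_vortexMeasure_eq_zero α
    (finite_range z).measurableSet.compl fun l h => h ⟨l, rfl⟩) f

lemma integrable_prod_totalVariation_vortexMeasure (α : Fin N → ℝ) (z : Fin N → ℂ)
    (f : ℂ × ℂ → ℝ) : Integrable f ((vortexMeasure α z).totalVariation.prod
      (vortexMeasure α z).totalVariation) := by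
  refine integrable_of_measure_compl_finite ((finite_range z).prod (finite_range z)) ?_ f
  have h0 : (vortexMeasure α z).totalVariation (range z)ᶜ = 0 :=
    totalVariation_vortexMeasure_eq_zero α (finite_range z).measurableSet.compl
      fun l h => h ⟨l, rfl⟩
  rw [compl_prod_eq_union]
  refine measure_union_null ?_ ?_
  · rw [Measure.prod_prod, h0, zero_mul]
  · rw [Measure.prod_prod, h0, mul_zero]

/-- Collects the time derivative and the spatial gradient in one total derivative, which is jointly
continuous in (t, x). -/
lemma fderiv_test_apply {φ : ℝ × ℂ → ℝ} (hφ : ContDiff ℝ (⊤ : ℕ∞) φ) (t : ℝ) (x v : ℂ) (s : ℝ) :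
    fderiv ℝ φ (t, x) (s, v) = s * deriv (fun s => φ (s, x)) t + inner ℝ (gradX φ t x) v := by
  have h := (hφ.differentiable (by simp) (t, x)).hasFDerivAt
  have h1 : HasFDerivAt (fun s => φ (s, x))
      ((fderiv ℝ φ (t, x)).comp (ContinuousLinearMap.inl ℝ ℝ ℂ)) t :=
    HasFDerivAt.comp (f := fun s => (s, x)) t h (hasFDerivAt_prodMk_left t x)
  have h2 : HasFDerivAt (fun x' => φ (t, x'))
      ((fderiv ℝ φ (t, x)).comp (ContinuousLinearMap.inr ℝ ℝ ℂ)) x :=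
    HasFDerivAt.comp (f := fun x' => (t, x')) x h (hasFDerivAt_prodMk_right t x)
  rw [gradX, inner_gradient, h2.fderiv, h1.hasDerivAt.deriv]
  have h3 : ((s, v) : ℝ × ℂ) = s • ((1 : ℝ), (0 : ℂ)) + ((0 : ℝ), v) := by ext <;> simp
  rw [h3, map_add, map_smul]
  simp

lemma testL_eq (Γ : Fin d → ℝ) {φ : ℝ × ℂ → ℝ} (hφ : ContDiff ℝ (⊤ : ℕ∞) φ) (t : ℝ) (x : ℂ) :
    testL Ω γ Γ φ t x = fderiv ℝ φ (t, x) (1, X0 Ω γ Γ x) := by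
  rw [fderiv_test_apply hφ, testL, one_mul, real_inner_comm]

/-- The symmetrized kernel, summed over all pairs of vortices, reproduces the mutual
interactions. -/
lemma sum_sum_testH (φ : ℝ × ℂ → ℝ) (t : ℝ) (α : Fin N → ℝ) {z : Fin N → ℂ}
    (hz : Function.Injective z) :
    ∑ m, α m * ∑ l, α l * testH Ω γ φ t (z l) (z m)
      = ∑ l, α l * (1 / 2 * α l * inner ℝ (gradX φ t (z l)) (perpGrad (robin Ω γ) (z l))
        + ∑ m ∈ Finset.univ.erase l,
          α m * inner ℝ (gradX φ t (z l)) (kernelK Ω γ (z l) (z m))) := by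
  -- `A l m` is the unsymmetrized action of vortex m on vortex l, with the Robin term on the
  -- diagonal. The kernel H_φ is its symmetrization, and a double sum does not notice
  -- symmetrization.
  let A : Fin N → Fin N → ℝ := fun l m =>
    if l = m then 1 / 2 * α l ^ 2 * inner ℝ (gradX φ t (z l)) (perpGrad (robin Ω γ) (z l))
    else α l * α m * inner ℝ (gradX φ t (z l)) (kernelK Ω γ (z l) (z m))
  have h1 : ∀ l m, α m * (α l * testH Ω γ φ t (z l) (z m)) = 1 / 2 * A l m + 1 / 2 * A m l := by
    intro l m
    by_cases h : l = m
    · subst h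
      simp only [A, testH, if_true]
      ring
    · have h' : z l ≠ z m := fun e => h (hz e)
      simp only [A, testH, if_neg h, if_neg h', if_neg (Ne.symm h)]
      ring
  have h2 : ∀ l, ∑ m, A l m
      = α l * (1 / 2 * α l * inner ℝ (gradX φ t (z l)) (perpGrad (robin Ω γ) (z l))
        + ∑ m ∈ Finset.univ.erase l,
          α m * inner ℝ (gradX φ t (z l)) (kernelK Ω γ (z l) (z m))) := by
    intro l
    rw [← Finset.add_sum_erase _ _ (Finset.mem_univ l), mul_add, Finset.mul_sum]
    congr 1
    · simp only [A, if_true]; ring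
    · refine Finset.sum_congr rfl fun m hm => ?_
      simp only [A, if_neg (Finset.ne_of_mem_erase hm).symm]
      ring
  have h3 : ∀ m, α m * ∑ l, α l * testH Ω γ φ t (z l) (z m)
      = 1 / 2 * ∑ l, A l m + 1 / 2 * ∑ l, A m l := by
    intro m
    rw [Finset.mul_sum, Finset.mul_sum, Finset.mul_sum, ← Finset.sum_add_distrib]
    exact Finset.sum_congr rfl fun l _ => h1 l m
  simp_rw [h3, Finset.sum_add_distrib, ← Finset.mul_sum]
  rw [Finset.sum_comm (f := fun m l => A l m), ← add_mul, add_halves, one_mul]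
  exact Finset.sum_congr rfl fun l _ => h2 l

/-! ### Trajectories: regularity, uniqueness, existence, and the weak formulation -/

lemma IsVortexTrajectory.analyticOn (hΩ : IsC2Domain Ω γ) {Γ : Fin d → ℝ} {α : Fin N → ℝ}
    {x : Fin N → ℂ} {T : ℝ} {z : ℝ → Fin N → ℂ} (hz : IsVortexTrajectory Ω γ Γ α x T z) :
    AnalyticOn ℝ z (Icc 0 T) :=
  analyticOn_of_ode hz.ode fun t ht => analyticAt_krlField hΩ Γ α (hz.mem t ht)

lemma IsVortexTrajectory.eqOn (hΩ : IsC2Domain Ω γ) {Γ : Fin d → ℝ} {α : Fin N → ℝ}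
    {x : Fin N → ℂ} {T : ℝ} {z w : ℝ → Fin N → ℂ} (hz : IsVortexTrajectory Ω γ Γ α x T z)
    (hw : IsVortexTrajectory Ω γ Γ α x T w) : EqOn w z (Icc 0 T) :=
  eqOn_of_ode hz.ode hw.ode (fun t ht => analyticAt_krlField hΩ Γ α (hz.mem t ht))
    (hw.initial.trans hz.initial.symm)

/-- Picard–Lindelöf for the field, which is C¹ near x; the configuration space is open, so no
collision occurs for a short time. -/
lemma exists_isVortexTrajectory (hΩ : IsC2Domain Ω γ) (Γ : Fin d → ℝ) (α : Fin N → ℝ)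
    {x : Fin N → ℂ} (hx : x ∈ configSpace Ω N) :
    ∃ T > 0, ∃ z, IsVortexTrajectory Ω γ Γ α x T z := by
  have h1 : ContDiffAt ℝ 1 (krlField Ω γ Γ α) x := (analyticAt_krlField hΩ Γ α hx).contDiffAt
  obtain ⟨z, hz0, ε, hε, hz⟩ :=
    h1.exists_forall_mem_closedBall_exists_eq_forall_mem_Ioo_hasDerivAt₀ 0
  have hc : ContinuousAt z 0 := (hz 0 (by constructor <;> linarith)).continuousAt
  have h2 : ∀ᶠ t in 𝓝 (0 : ℝ), z t ∈ configSpace Ω N :=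
    hc ((isOpen_configSpace hΩ).mem_nhds (by rwa [hz0]))
  obtain ⟨δ, hδ, hδz⟩ := Metric.nhds_basis_closedBall.mem_iff.1 h2
  refine ⟨min δ (ε / 2), lt_min hδ (half_pos hε), z, hz0, fun t ht => hδz ?_, fun t ht => ?_⟩
  · rw [Metric.mem_closedBall, Real.dist_eq, sub_zero, abs_of_nonneg ht.1]
    exact ht.2.trans (min_le_left _ _)
  · have := ht.2.trans (min_le_right δ (ε / 2))
    exact (hz t ⟨by linarith [ht.1], by linarith⟩).hasDerivWithinAt

lemma continuousOn_testL_comp (Γ : Fin d → ℝ) {φ : ℝ × ℂ → ℝ}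
    (hφ : ContDiff ℝ (⊤ : ℕ∞) φ) {s : Set ℝ} {p : ℝ → ℂ} (hp : ContinuousOn p s)
    (hpΩ : ∀ t ∈ s, p t ∈ Ω) : ContinuousOn (fun t => testL Ω γ Γ φ t (p t)) s := by
  simp_rw [testL_eq Γ hφ]
  refine ((hφ.continuous_fderiv (by simp)).comp_continuousOn
    (continuousOn_id.prodMk hp)).clm_apply (continuousOn_const.prodMk fun t ht => ?_)
  have h1 : ContinuousAt (X0 Ω γ Γ) (p t) :=
    (analyticAt_perpGrad (analyticAt_psi0 (hpΩ t ht) Γ)).continuousAt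
  exact h1.comp_continuousWithinAt (hp t ht)

lemma continuousOn_inner_gradX {φ : ℝ × ℂ → ℝ} (hφ : ContDiff ℝ (⊤ : ℕ∞) φ) {s : Set ℝ}
    {p v : ℝ → ℂ} (hp : ContinuousOn p s) (hv : ContinuousOn v s) :
    ContinuousOn (fun t => (inner ℝ (gradX φ t (p t)) (v t) : ℝ)) s := by
  have h : ∀ t, (inner ℝ (gradX φ t (p t)) (v t) : ℝ) = fderiv ℝ φ (t, p t) (0, v t) := by
    intro t; rw [fderiv_test_apply hφ, zero_mul, zero_add]
  simp_rw [h]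
  exact ((hφ.continuous_fderiv (by simp)).comp_continuousOn
    (continuousOn_id.prodMk hp)).clm_apply (continuousOn_const.prodMk hv)

/-- Without collisions, the case distinction in H_φ is decided by the indices alone and does not
change with time; each case is continuous. -/
lemma continuousOn_testH_comp (hΩ : IsC2Domain Ω γ) {φ : ℝ × ℂ → ℝ}
    (hφ : ContDiff ℝ (⊤ : ℕ∞) φ) {s : Set ℝ} {z : ℝ → Fin N → ℂ} (hz : ContinuousOn z s)
    (hzΩ : ∀ t ∈ s, z t ∈ configSpace Ω N) (l m : Fin N) :
    ContinuousOn (fun t => testH Ω γ φ t (z t l) (z t m)) s := by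
  have hzl : ∀ l, ContinuousOn (fun t => z t l) s := fun l => (continuous_apply l).comp_continuousOn
    hz
  by_cases h : l = m
  · subst h
    simp only [testH, if_true]
    refine continuousOn_const.mul (continuousOn_inner_gradX hφ (hzl l) fun t ht => ?_)
    have h1 : ContinuousAt (perpGrad (robin Ω γ)) (z t l) :=
      (analyticAt_perpGrad (analyticAt_robin hΩ ((hzΩ t ht).1 l))).continuousAt
    exact ContinuousAt.comp_continuousWithinAt (f := fun t => z t l) h1 (hzl l t ht)
  · have hne : ∀ t ∈ s, z t l ≠ z t m := fun t ht e => h ((hzΩ t ht).2 e)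
    have hK : ∀ l m, l ≠ m → ContinuousOn (fun t => kernelK Ω γ (z t l) (z t m)) s := by
      intro l m hlm t ht
      have h1 := continuousAt_kernelK hΩ ((hzΩ t ht).1 l) ((hzΩ t ht).1 m)
        fun e => hlm ((hzΩ t ht).2 e)
      exact ContinuousAt.comp_continuousWithinAt (f := fun t => (z t l, z t m)) h1
        ((hzl l t ht).prodMk (hzl m t ht))
    refine ContinuousOn.congr (f := fun t => 1 / 2 *
      ((inner ℝ (gradX φ t (z t l)) (kernelK Ω γ (z t l) (z t m)) : ℝ)
        + inner ℝ (gradX φ t (z t m)) (kernelK Ω γ (z t m) (z t l)))) ?_ fun t ht => ?_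
    · exact continuousOn_const.mul ((continuousOn_inner_gradX hφ (hzl l) (hK l m h)).add
        (continuousOn_inner_gradX hφ (hzl m) (hK m l (Ne.symm h))))
    · simp only [testH, if_neg (hne t ht)]

lemma IsVortexTrajectory.isWeakSolution (hΩ : IsC2Domain Ω γ) {Γ : Fin d → ℝ} {α : Fin N → ℝ}
    (hα : ∀ l, α l ≠ 0) {x : Fin N → ℂ} {T : ℝ} (hT : 0 < T) {z : ℝ → Fin N → ℂ}
    (hz : IsVortexTrajectory Ω γ Γ α x T z) :
    IsWeakSolution Ω γ Γ T (vortexMeasure α x) fun t => vortexMeasure α (z t) := by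
  have hzc : ContinuousOn z (Icc 0 T) := fun t ht => (hz.ode t ht).continuousWithinAt
  have hzl : ∀ l, ContinuousOn (fun t => z t l) (Icc 0 T) := fun l =>
    (continuous_apply l).comp_continuousOn hzc
  have hcarried : ∀ t ∈ Icc 0 T, (vortexMeasure α (z t)).totalVariation Ωᶜ = 0 := fun t ht =>
    totalVariation_vortexMeasure_eq_zero α hΩ.isOpen.measurableSet.compl
      fun l h => h ((hz.mem t ht).1 l)
  have hLc : ∀ φ, IsTestFunction Ω T φ → ContinuousOn
      (fun t => signedIntegral (vortexMeasure α (z t)) (testL Ω γ Γ φ t)) (Icc 0 T) := by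
    intro φ hφ
    simp_rw [signedIntegral_vortexMeasure]
    exact continuousOn_finsetSum _ fun l _ => continuousOn_const.mul
      (continuousOn_testL_comp Γ hφ.smooth (hzl l) fun t ht => (hz.mem t ht).1 l)
  have hHc : ∀ φ, IsTestFunction Ω T φ → ContinuousOn
      (fun t => signedIntegral (vortexMeasure α (z t)) fun y =>
        signedIntegral (vortexMeasure α (z t)) fun x => testH Ω γ φ t x y) (Icc 0 T) := by
    intro φ hφ
    simp_rw [signedIntegral_vortexMeasure]
    exact continuousOn_finsetSum _ fun m _ => continuousOn_const.mul
      (continuousOn_finsetSum _ fun l _ => continuousOn_const.mul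
        (continuousOn_testH_comp hΩ hφ.smooth hzc hz.mem l m))
  refine ⟨?_, hcarried, ?_, ?_, ?_, ?_, ?_, ?_⟩
  · have := hcarried 0 (left_mem_Icc.2 hT.le)
    rwa [hz.initial] at this
  · intro f hf _ _
    simp_rw [signedIntegral_vortexMeasure]
    refine ContinuousOn.aemeasurable ?_ measurableSet_Icc
    exact continuousOn_finsetSum _ fun l _ => continuousOn_const.mul
      (hf.comp_continuousOn (hzl l))
  · exact ⟨∑ l, |α l|, Eventually.of_forall fun t => totalVariation_vortexMeasure_univ_le α (z t)⟩
  · exact fun φ _ => Eventually.of_forall fun t =>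
      ⟨integrable_totalVariation_vortexMeasure α (z t) _,
        integrable_prod_totalVariation_vortexMeasure α (z t) _⟩
  · exact fun φ hφ => (hLc φ hφ).integrableOn_Icc
  · exact fun φ hφ => (hHc φ hφ).integrableOn_Icc
  · intro φ hφ
    -- The two integrands of the weak formulation add up to the time derivative of ∑ α_l φ(t,
    -- z_l(t)); the rest is the fundamental theorem of calculus.
    have hder : ∀ t ∈ Icc 0 T, HasDerivWithinAt (fun t => ∑ l, α l * φ (t, z t l))
        (signedIntegral (vortexMeasure α (z t)) (testL Ω γ Γ φ t)
          + signedIntegral (vortexMeasure α (z t)) fun y =>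
            signedIntegral (vortexMeasure α (z t)) fun x => testH Ω γ φ t x y) (Icc 0 T) t := by
      intro t ht
      have h1 : ∀ l, HasDerivWithinAt (fun t => α l * φ (t, z t l))
          (α l * fderiv ℝ φ (t, z t l) (1, krlField Ω γ Γ α (z t) l)) (Icc 0 T) t := fun l =>
        ((hφ.smooth.differentiable (by simp) (t, z t l)).hasFDerivAt.comp_hasDerivWithinAt
          (f := fun t => (t, z t l)) t ((hasDerivWithinAt_id t _).prodMk
            (hasDerivWithinAt_pi.1 (hz.ode t ht) l))).const_mul (α l)
      refine (HasDerivWithinAt.fun_sum fun l _ => h1 l).congr_deriv ?_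
      simp_rw [signedIntegral_vortexMeasure]
      rw [sum_sum_testH φ t α (hz.mem t ht).2, ← Finset.sum_add_distrib]
      refine Finset.sum_congr rfl fun l _ => ?_
      rw [fderiv_test_apply hφ.smooth, inner_krlField hΩ Γ (hz.mem t ht) (hα l), testL,
        real_inner_comm (X0 Ω γ Γ (z t l))]
      ring
    have hfin : ∑ l, α l * φ (T, z T l) = 0 := by
      refine Finset.sum_eq_zero fun l _ => ?_
      -- The support of φ lies in times strictly before T, so only the initial term survives.
      have h : φ (T, z T l) = 0 :=
        image_eq_zero_of_notMem_tsupport fun h => lt_irrefl T (hφ.support h).1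
      rw [h, mul_zero]
    have hint := intervalIntegral.integral_eq_sub_of_hasDerivAt_of_le hT.le
      (fun t ht => (hder t ht).continuousWithinAt)
      (fun t ht => (hder t (Ioo_subset_Icc_self ht)).hasDerivAt (Icc_mem_nhds ht.1 ht.2))
      (((hLc φ hφ).add (hHc φ hφ)).intervalIntegrable_of_Icc hT.le)
    rw [hfin, hz.initial, intervalIntegral.integral_of_le hT.le, ← integral_Icc_eq_integral_Ioc,
      integral_add (hLc φ hφ).integrableOn_Icc (hHc φ hφ).integrableOn_Icc] at hint
    rw [signedIntegral_vortexMeasure, add_assoc, hint]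
    ring

end

end PointVortex

end

theorem theorem3p6 {d N : ℕ} {Ω : Set ℂ} {γ : Fin (d + 1) → ℝ → ℂ}
    (hΩ : PointVortex.IsC2Domain Ω γ) (Γ : Fin d → ℝ)
    (x : Fin N → ℂ) (hxΩ : ∀ l, x l ∈ Ω) (hx : Function.Injective x)
    (α : Fin N → ℝ) (hα : ∀ l, α l ≠ 0) :
    (∃ T > 0, ∃ z, PointVortex.IsVortexTrajectory Ω γ Γ α x T z) ∧
    ∀ T > 0, ∀ z, PointVortex.IsVortexTrajectory Ω γ Γ α x T z →
      AnalyticOn ℝ z (Set.Icc 0 T) ∧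
      (∀ w, PointVortex.IsVortexTrajectory Ω γ Γ α x T w → Set.EqOn w z (Set.Icc 0 T)) ∧
      PointVortex.IsWeakSolution Ω γ Γ T (PointVortex.vortexMeasure α x)
        (fun t => PointVortex.vortexMeasure α (z t)) :=
  ⟨PointVortex.exists_isVortexTrajectory hΩ Γ α ⟨hxΩ, hx⟩, fun _ hT _ hz =>
    ⟨hz.analyticOn hΩ, fun _ hw => hz.eqOn hΩ hw, hz.isWeakSolution hΩ hα hT⟩⟩
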